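/- Let $p\ge 0$ be an integer, let $\mathbf a=(a_1,\dots,a_{p+1})$ and $\mathbf b=(b_1,\dots,b_p)$ be real vectors with $b_j\notin\{0,-1,-2,\dots\}$ for all $j$, and let $x>1$. Write $\Gamma(\mathbf a)=\prod_i\Gamma(a_i)$, $\Gamma(\mathbf b)=\prod_j\Gamma(b_j)$, $\mathbf a-\tfrac12=(a_1-\tfrac12,\dots,a_{p+1}-\tfrac12)$ and likewise $\mathbf b-\tfrac12$. Let $F(z)={}_{p+1}F_p(\mathbf a;\mathbf b;z)$ denote the analytic continuation to $\mathbb C\setminus[1,\infty)$ of the sum of $$\sum_{n=0}^\infty \frac{(a_1)_n\cdots(a_{p+1})_n}{(b_1)_n\cdots(b_p)_n\,n!}z^n,\qquad |z|<1,$$ and let $F(x\pm i0)$ denote the limits of $F(z)$ as $z\to x$ with $\pm\operatorname{Im}z>0$. For integers $0\le m\le Q$, $0\le n\le P$ and $z\in(0,1)$, with $P=Q$, Meijer's $G$-function is $$G^{m,n}_{P,Q}\left(z\,\Big|\begin{array}{c}\alpha_1,\dots,\alpha_P\\ \beta_1,\dots,\beta_Q\end{array}\right)=\frac1{2\pi i}\int_{\mathcal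 L}\frac{\prod_{j=1}^m\Gamma(\beta_j-s)\prod_{i=1}^n\Gamma(1-\alpha_i+s)}{\prod_{j=m+1}^Q\Gamma(1-\beta_j+s)\prod_{i=n+1}^P\Gamma(\alpha_i-s)}\,z^s\,ds,$$ where $\mathcal L$ is any loop that comes from $+\infty$ on a line parallel to the positive real axis and returns to $+\infty$ on another such line, encircles each pole of the functions $\Gamma(\beta_j-s)$, $j\le m$, once in the negative sense and encircles no pole of the functions $\Gamma(1-\alpha_i+s)$, $i\le n$. Then the limits $F(x\pm i0)$ exist, the $G$-function below is well defined (such loops exist, the integrals converge absolutely and do not depend on the loop), and $$F(x+i0)-F(x-i0)=2\pi i\,\frac{\Gamma(\mathbf b)}{\Gamma(\mathbf a)}\,G^{p+1,0}_{p+1,p+1}\left(\frac1x\,\Big|\begin{array}{c}1,\mathbf b\\ \mathbf a\end{array}\right),$$ where $1/\Gamma(\mathbf a)=0$ if some $a_i\in\{0,-1,-2,\dots\}$. If moreover $a_i\notin\{0,-1,-2,\dots\}$ for all $i$, then the $G$-function below is also well defined, and $$\frac{F(x+i0)+F(x-i0)}2=-\frac{\pi\,\Gamma(\mathbf b)}{\sqrt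 x\,\Gamma(\mathbf a)}\,G^{p+1,1}_{p+2,p+2}\left(\frac1x\,\Big|\begin{array}{c}\tfrac12,\,1,\,\mathbf b-\tfrac12\\ \mathbf a-\tfrac12,\,1\end{array}\right).$$ -/

import Mathlib

open Filter Topology

/-- The complex plane cut along `[1, ∞)`. -/
def cutPlane : Set ℂ := (Complex.ofReal '' Set.Ici (1 : ℝ))ᶜ

/-- `f` is the analytic continuation to `ℂ \ [1, ∞)` of the sum of the hypergeometric series
`∑ (a₁)ₙ ⋯ (aₚ₊₁)ₙ / ((b₁)ₙ ⋯ (bₚ)ₙ n!) zⁿ`, `|z| < 1`. -/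
def IsHypergeometricContinuation {p : ℕ} (a : Fin (p + 1) → ℂ) (b : Fin p → ℂ) (f : ℂ → ℂ) :
    Prop :=
  AnalyticOnNhd ℂ f cutPlane ∧
    ∀ z : ℂ, ‖z‖ < 1 →
      HasSum (fun n : ℕ => (∏ i, (ascPochhammer ℂ n).eval (a i)) /
        ((∏ j, (ascPochhammer ℂ n).eval (b j)) * (n.factorial : ℂ)) * z ^ n) (f z)

open Classical in
/-- The generalized hypergeometric function `ₚ₊₁Fₚ(a; b; ·)` on `ℂ \ [1, ∞)`. The continuation is
unique there; its values on `[1, ∞)` are unspecified. -/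
noncomputable def hypergeometric {p : ℕ} (a : Fin (p + 1) → ℂ) (b : Fin p → ℂ) : ℂ → ℂ :=
  if h : ∃ f, IsHypergeometricContinuation a b f then Classical.choose h else 0

/-- The Mellin–Barnes integrand of `G^{m,n}_{p,q}(z | a; b)`,
`∏_{j ≤ m} Γ(b_j - s) ∏_{i ≤ n} Γ(1 - a_i + s) z^s /
  (∏_{j > m} Γ(1 - b_j + s) ∏_{i > n} Γ(a_i - s))`.
As `Complex.Gamma` is `0` at its poles, `(Complex.Gamma s)⁻¹` is the entire function `1 / Γ`. -/
noncomputable def meijerIntegrand (m n : ℕ) {p q : ℕ} (a : Fin p → ℂ) (b : Fin q → ℂ) (z s : ℂ) :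
    ℂ :=
  (∏ j : Fin q, if (j : ℕ) < m then Complex.Gamma (b j - s)
      else (Complex.Gamma (1 - b j + s))⁻¹) *
    (∏ i : Fin p, if (i : ℕ) < n then Complex.Gamma (1 - a i + s)
      else (Complex.Gamma (a i - s))⁻¹) * z ^ s

/-- The contour `γ`, both of whose ends run to `+∞` parallel to the real axis with unit speed, misses
`w` and has winding number `k` about `w`:
`(2πi)⁻¹ ∫_{-T}^{T} γ'(t) / (γ(t) - w) dt → k` as `T → ∞`. -/
def HasWindingNumber (γ : ℝ → ℂ) (w : ℂ) (k : ℤ) : Prop :=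
  (∀ t, γ t ≠ w) ∧
    Tendsto (fun T : ℝ => (2 * Real.pi * Complex.I)⁻¹ * ∫ t in (-T)..T, deriv γ t / (γ t - w))
      atTop (𝓝 (k : ℂ))

/-- `γ` is a loop contour for `G^{m,n}_{p,q}(· | a; b)`: a Lipschitz curve, differentiable off a
finite set, that comes from `+∞` on a line parallel to the positive real axis, returns to `+∞` on
another such line, encircles each pole `b_j + k` (`j ≤ m`, `k = 0, 1, …`) of the functions
`Γ(b_j - s)` once in the negative sense, and encircles no pole `a_i - 1 - k` (`i ≤ n`,
`k = 0, 1, …`) of the functions `Γ(1 - a_i + s)`. -/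
structure IsMeijerLoop (m n : ℕ) {p q : ℕ} (a : Fin p → ℂ) (b : Fin q → ℂ) (γ : ℝ → ℂ) :
    Prop where
  lipschitz : ∃ K, LipschitzWith K γ
  differentiable : {t : ℝ | ¬ DifferentiableAt ℝ γ t}.Finite
  start : ∃ (c : ℂ) (T : ℝ), ∀ t ≤ T, γ t = c - (t : ℂ)
  finish : ∃ (c : ℂ) (T : ℝ), ∀ t ≥ T, γ t = c + (t : ℂ)
  encircles : ∀ j : Fin q, (j : ℕ) < m → ∀ k : ℕ, HasWindingNumber γ (b j + k) (-1)
  excludes : ∀ i : Fin p, (i : ℕ) < n → ∀ k : ℕ, HasWindingNumber γ (a i - 1 - k) 0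

/-- Meijer's function `G^{m,n}_{p,q}(z | a; b)` is defined, with value `v`, by the loop contours
from `+∞` to `+∞` (the contours used for `p < q`, `z ≠ 0`, and for `p = q`, `0 < |z| < 1`):
there is such a contour, and over each of them the integral converges absolutely, with
`(2πi)⁻¹ ∫_L (integrand) ds = v`. -/
def HasMeijerG (m n : ℕ) {p q : ℕ} (a : Fin p → ℂ) (b : Fin q → ℂ) (z v : ℂ) : Prop :=
  (∃ γ, IsMeijerLoop m n a b γ) ∧
    ∀ γ, IsMeijerLoop m n a b γ →
      MeasureTheory.Integrable (fun t : ℝ => meijerIntegrand m n a b z (γ t) * deriv γ t) ∧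
        (2 * Real.pi * Complex.I)⁻¹ *
          ∫ t : ℝ, meijerIntegrand m n a b z (γ t) * deriv γ t = v

open Classical in
/-- Meijer's function `G^{m,n}_{p,q}(z | a; b)` for `p < q`, `z ≠ 0`, and for `p = q`,
`0 < |z| < 1`. -/
noncomputable def meijerG (m n : ℕ) {p q : ℕ} (a : Fin p → ℂ) (b : Fin q → ℂ) (z : ℂ) : ℂ :=
  if h : ∃ v, HasMeijerG m n a b z v then Classical.choose h else 0

/-!
The proof rests on Barnes's integral. Let `κ(s) = Γ(s) ∏ Γ(aᵢ - s) / ∏ Γ(bⱼ - s)` and suppose first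
that no `aᵢ` is a nonpositive integer. Away from the real axis a quotient of two Gamma functions grows
at most like a power of `s`, and pairing the `aᵢ` with `1` and the `bⱼ` leaves a factor
`π / sin (π s)`, so `κ(s)` decays like `exp (-π |Im s|)` up to powers
(`exists_norm_barnesKernel_le`). Hence the integral of `κ(s) (-z)⁻ˢ` along a line `Re s = 1/2 - M` to
the left of the poles of the `Γ(aᵢ - s)` is holomorphic in `log (-z)`, `|arg (-z)| < π`
(`differentiableAt_barnesIntegral`).

* For `|z| < 1` the line can be closed to the left, where the only poles are the simple ones of `Γ(s)`
  at `-n`, `n ≥ M`. The residues give the tail of the hypergeometric series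
  (`tendsto_sum_hypergeometricCoeff`), so the integral together with the first `M` terms of the series
  is its analytic continuation (`exists_isHypergeometricContinuation`). It is unique since the cut
  plane is star-shaped about `0`.
* For `|z| > 1` the line can be closed to the right into a hairpin. Adding to the hairpin a turn around
  each of the poles `0, -1, …, 1 - M` of `Γ(s)`, which lie inside it, accounts for the first `M` terms
  and turns it into a loop `γ` about the poles of the `Γ(aᵢ - s)` only (`exists_barnesLoop`).

Thus for `|z| > 1` the function `F(z)` is a constant times `∫_γ κ(s) (-z)⁻ˢ ds`. Along `γ` the imaginary
part of `s` is bounded, so this representation extends continuously to both sides of the cut, where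
`(-z)⁻ˢ` becomes `x⁻ˢ exp (± π i s)` (`exists_loop_tendsto_hypergeometric`). The jump and the average
therefore carry the factors `sin (π s)` and `cos (π s)`, and the reflection formula absorbs them into
the Gamma factors of the two Mellin–Barnes integrands (`meijerIntegrand_zero_eq`,
`meijerIntegrand_half_eq`); for the average the loop is translated by `-1/2`. If some `aᵢ` is a
nonpositive integer, `F` is a polynomial and both sides of the jump formula vanish.

That the `G`-functions do not depend on the loop is a residue theorem for curves from `+∞` to `+∞` and
functions that decrease geometrically under `s ↦ s + 1` (`IsGeometricallyDecaying.integral_eq`). The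
loops are only controlled by their winding numbers, so instead of a homotopy the proof uses that,
on a disc, a meromorphic function has a primitive up to simple poles
(`exists_primitive_add_residues`). The curve is cut off at vertical lines on which the integrand tends
to zero, and the functional equation `Γ(s + 1) = s Γ(s)` shows that Mellin–Barnes integrands with
`P = Q` and `|z| < 1` are of this kind (`isGeometricallyDecaying_meijerIntegrand`).
-/

/-! ### Principal parts and primitives -/

/-- A function with a pole at `w` is, near `w`, the sum of an analytic function, a simple pole and
the derivative of a function holomorphic off `w`. -/
theorem exists_residue_of_analyticAt_div_pow (n : ℕ) (w : ℂ) :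
    ∀ G : ℂ → ℂ, AnalyticAt ℂ G w → ∃ (ρ : ℂ) (H h g : ℂ → ℂ), AnalyticAt ℂ g w ∧
      (∀ s, s ≠ w → HasDerivAt H (h s) s) ∧
      ∀ s, s ≠ w → G s / (s - w) ^ n = g s + ρ / (s - w) + h s := by
  induction n with
  | zero =>
    intro G hG
    exact ⟨0, 0, 0, G, hG, fun s _ => hasDerivAt_const s (0 : ℂ), by simp⟩
  | succ n ih =>
    intro G hG
    obtain ⟨ρ, H, h, g, hg, hH, hd⟩ := ih (dslope G w) (by
      obtain ⟨p, hp⟩ := hG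
      exact hp.has_fpower_series_dslope_fslope.analyticAt)
    have key : ∀ s, s ≠ w → G s / (s - w) ^ (n + 1) =
        G w / (s - w) ^ (n + 1) + dslope G w s / (s - w) ^ n := by
      intro s hs
      have h1 : s - w ≠ 0 := sub_ne_zero.mpr hs
      rw [dslope_of_ne _ hs, slope_def_field]
      field_simp
      ring
    rcases Nat.eq_zero_or_pos n with rfl | hn
    · refine ⟨ρ + G w, H, h, g, hg, hH, fun s hs => ?_⟩
      rw [key s hs, hd s hs]
      simp only [zero_add, pow_one]
      ring
    · refine ⟨ρ, fun s => H s + (-(G w) / n) * ((s - w) ^ n)⁻¹,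
        fun s => h s + G w / (s - w) ^ (n + 1), g, hg, fun s hs => ?_, fun s hs => ?_⟩
      · have h1 : s - w ≠ 0 := sub_ne_zero.mpr hs
        have h2 : HasDerivAt (fun s : ℂ => (s - w) ^ n) ((n : ℂ) * (s - w) ^ (n - 1) * 1) s :=
          ((hasDerivAt_id s).sub_const w).pow n
        refine (hH s hs).add ?_
        refine ((h2.inv (pow_ne_zero _ h1)).const_mul (-(G w) / n)).congr_deriv ?_
        have hn' : (n : ℂ) ≠ 0 := by exact_mod_cast hn.ne'
        obtain ⟨k, rfl⟩ : ∃ k, n = k + 1 := ⟨n - 1, by omega⟩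
        simp only [Nat.add_sub_cancel]
        field_simp
        ring
      · rw [key s hs, hd s hs]
        ring

/-- A meromorphic function on a disc with finitely many poles has a primitive there up to simple
poles. -/
theorem exists_primitive_add_residues (R : ℝ) (S : Finset ℂ) :
    ∀ f : ℂ → ℂ, (∀ s ∈ Metric.ball (0 : ℂ) R, s ∉ S → DifferentiableAt ℂ f s) →
      (∀ w ∈ S, MeromorphicAt f w) →
      ∃ (ρ H : ℂ → ℂ), ∀ s ∈ Metric.ball (0 : ℂ) R, s ∉ S →
        HasDerivAt H (f s - ∑ w ∈ S, ρ w / (s - w)) s := by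
  classical
  induction S using Finset.induction_on with
  | empty =>
    intro f hf _
    obtain ⟨H, hH⟩ := DifferentiableOn.isExactOn_ball (f := f) (c := 0) (r := R)
      fun s hs => (hf s hs (by simp)).differentiableWithinAt
    exact ⟨0, H, fun s hs _ => by simpa using hH s hs⟩
  | insert w S hw ih =>
    intro f hf hm
    obtain ⟨n, hn⟩ := hm w (Finset.mem_insert_self _ _)
    obtain ⟨ρ₀, H₀, h₀, g, hg, hH₀, hdec⟩ := exists_residue_of_analyticAt_div_pow n w _ hn
    have hf' : ∀ s, s ≠ w → f s = g s + ρ₀ / (s - w) + h₀ s := by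
      intro s hs
      rw [← hdec s hs]
      have : s - w ≠ 0 := sub_ne_zero.mpr hs
      simp only [smul_eq_mul]
      field_simp
    -- off `w` the regular part `g` is `f` minus functions holomorphic there
    have hg' : ∀ s, s ≠ w → g =ᶠ[𝓝 s] fun s => f s - (ρ₀ / (s - w) + h₀ s) := by
      intro s hs
      filter_upwards [isOpen_ne.mem_nhds hs] with t ht
      rw [hf' t ht]
      ring
    have hh₀ : ∀ s, s ≠ w → AnalyticAt ℂ (fun s => ρ₀ / (s - w) + h₀ s) s := by
      intro s hs
      have hd : DifferentiableOn ℂ H₀ {w}ᶜ := fun t ht =>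
        (hH₀ t ht).differentiableAt.differentiableWithinAt
      have h1 : AnalyticAt ℂ H₀ s :=
        hd.analyticAt (isOpen_compl_singleton.mem_nhds hs)
      have h2 : h₀ =ᶠ[𝓝 s] deriv H₀ := by
        filter_upwards [isOpen_ne.mem_nhds hs] with t ht
        exact (hH₀ t ht).deriv.symm
      refine (analyticAt_const.div (analyticAt_id.sub analyticAt_const)
        (sub_ne_zero.mpr hs)).add ?_
      exact h1.deriv.congr h2.symm
    obtain ⟨ρ₁, H₁, hH₁⟩ := ih g (by
      intro s hs hsS
      by_cases hsw : s = w
      · exact hsw ▸ hg.differentiableAt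
      · refine (hg' s hsw).differentiableAt_iff.mpr ?_
        exact (hf s hs (by simp [hsw, hsS])).sub (hh₀ s hsw).differentiableAt) (by
      intro v hv
      have hvw : v ≠ w := fun h => hw (h ▸ hv)
      refine MeromorphicAt.congr ?_ ((hg' v hvw).symm.filter_mono nhdsWithin_le_nhds)
      exact (hm v (Finset.mem_insert_of_mem hv)).sub (hh₀ v hvw).meromorphicAt)
    refine ⟨Function.update ρ₁ w ρ₀, fun s => H₁ s + H₀ s, fun s hs hsS => ?_⟩
    simp only [Finset.mem_insert, not_or] at hsS
    refine ((hH₁ s hs hsS.2).add (hH₀ s hsS.1)).congr_deriv ?_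
    rw [Finset.sum_insert hw, Function.update_self, hf' s hsS.1]
    have : ∑ v ∈ S, Function.update ρ₁ w ρ₀ v / (s - v) = ∑ v ∈ S, ρ₁ v / (s - v) :=
      Finset.sum_congr rfl fun v hv => by
        rw [Function.update_of_ne (ne_of_mem_of_not_mem hv hw)]
    rw [this]
    ring

/-! ### Integrals along curves from `+∞` to `+∞` -/

/-- A Lipschitz curve, differentiable off a finite set, that comes from `+∞` on a line parallel to
the real axis and returns to `+∞` on another such line. -/
structure IsCurveFromInfinity (γ : ℝ → ℂ) : Prop where
  lipschitz : ∃ K, LipschitzWith K γ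
  differentiable : {t : ℝ | ¬ DifferentiableAt ℝ γ t}.Finite
  start : ∃ (c : ℂ) (T : ℝ), ∀ t ≤ T, γ t = c - (t : ℂ)
  finish : ∃ (c : ℂ) (T : ℝ), ∀ t ≥ T, γ t = c + (t : ℂ)

namespace IsCurveFromInfinity

variable {γ : ℝ → ℂ}

theorem continuous (h : IsCurveFromInfinity γ) : Continuous γ :=
  h.lipschitz.choose_spec.continuous

theorem exists_norm_deriv_le (h : IsCurveFromInfinity γ) : ∃ K : ℝ, ∀ t, ‖deriv γ t‖ ≤ K := by
  obtain ⟨K, hK⟩ := h.lipschitz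
  exact ⟨K, fun t => norm_deriv_le_of_lipschitz hK⟩

theorem intervalIntegrable_mul_deriv (h : IsCurveFromInfinity γ) {g : ℝ → ℂ} {α β : ℝ}
    (hg : ContinuousOn g (Set.uIcc α β)) :
    IntervalIntegrable (fun t => g t * deriv γ t) MeasureTheory.volume α β := by
  obtain ⟨K, hK⟩ := h.exists_norm_deriv_le
  have h1 : IntervalIntegrable g MeasureTheory.volume α β := hg.intervalIntegrable
  rw [intervalIntegrable_iff] at h1 ⊢
  refine h1.mul_bdd (c := K) (stronglyMeasurable_deriv γ).aestronglyMeasurable ?_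
  exact Eventually.of_forall hK

/-- The fundamental theorem of calculus along the curve. -/
theorem integral_comp_mul_deriv (h : IsCurveFromInfinity γ) {L l : ℂ → ℂ} {α β : ℝ}
    (hL : ∀ t ∈ Set.uIcc α β, HasDerivAt L (l (γ t)) (γ t))
    (hl : ContinuousOn (fun t => l (γ t)) (Set.uIcc α β)) :
    ∫ t in α..β, l (γ t) * deriv γ t = L (γ β) - L (γ α) := by
  refine MeasureTheory.integral_eq_of_hasDerivAt_off_countable (fun t => L (γ t)) _
    h.differentiable.countable ?_ ?_ (h.intervalIntegrable_mul_deriv hl)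
  · intro t ht
    exact ((hL t ht).continuousAt.comp h.continuous.continuousAt).continuousWithinAt
  · intro t ht
    have h1 : DifferentiableAt ℝ γ t := not_not.mp ht.2
    have h2 := (hL t (Set.Ioo_subset_Icc_self ht.1)).scomp t h1.hasDerivAt
    rw [smul_eq_mul, mul_comm] at h2
    exact h2

end IsCurveFromInfinity

/-! ### Winding numbers of truncated curves -/

/-- The two ends of a curve from `+∞` to `+∞` do not contribute to the increment of a logarithm that is
continuous near `+∞`. -/
theorem tendsto_log_add_sub_log_add (A B : ℂ) :
    Tendsto (fun T : ℝ => Complex.log (A + T) - Complex.log (B + T)) atTop (𝓝 0) := by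
  have key : ∀ A : ℂ, Tendsto (fun T : ℝ => Complex.log (A + T) - Real.log T) atTop (𝓝 0) := by
    intro A
    have h1 : Tendsto (fun T : ℝ => 1 + A / (T : ℂ)) atTop (𝓝 1) := by
      have h2 : Tendsto (fun T : ℝ => (T : ℂ)⁻¹) atTop (𝓝 0) := by
        have := (Complex.continuous_ofReal.tendsto 0).comp tendsto_inv_atTop_zero
        simpa [Function.comp_def] using this
      simpa [div_eq_mul_inv] using (h2.const_mul A).const_add 1
    have h3 : Tendsto (fun T : ℝ => Complex.log (1 + A / (T : ℂ))) atTop (𝓝 0) := by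
      have := (continuousAt_clog Complex.one_mem_slitPlane).tendsto.comp h1
      simpa [Function.comp_def] using this
    refine h3.congr' ?_
    filter_upwards [eventually_gt_atTop 0, h1.eventually_ne one_ne_zero] with T hT hne
    have hT' : (T : ℂ) ≠ 0 := by exact_mod_cast hT.ne'
    have : A + T = (T : ℂ) * (1 + A / T) := by field_simp; ring
    rw [this, Complex.log_ofReal_mul hT hne]
    ring
  have := (key A).sub (key B)
  simpa using this

namespace IsCurveFromInfinity

variable {γ : ℝ → ℂ}

/-- Beyond the line `Re s = X` the curve can be integrated against `1 / (s - w)` by means of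
`log (s - w)`, whose values at the two ends cancel at `+∞`. -/
theorem integral_of_hasWindingNumber (h : IsCurveFromInfinity γ) {c₁ c₂ w : ℂ} {T₀ X : ℝ} {k : ℤ}
    (hs : ∀ t ≤ -T₀, γ t = c₁ - t) (hf : ∀ t ≥ T₀, γ t = c₂ + t)
    (hw : HasWindingNumber γ w k) (hX₁ : T₀ ≤ X - c₁.re) (hX₂ : T₀ ≤ X - c₂.re) (hwX : w.re < X) :
    ∫ t in (c₁.re - X)..(X - c₂.re), (γ t - w)⁻¹ * deriv γ t =
      2 * Real.pi * Complex.I * k + Complex.log (γ (X - c₂.re) - w)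
        - Complex.log (γ (c₁.re - X) - w) := by
  obtain ⟨hne, hlim⟩ := hw
  have hcont : Continuous fun t => (γ t - w)⁻¹ :=
    (h.continuous.sub continuous_const).inv₀ fun t => sub_ne_zero.mpr (hne t)
  have hint : ∀ α β, IntervalIntegrable (fun t => (γ t - w)⁻¹ * deriv γ t)
      MeasureTheory.volume α β := fun α β => h.intervalIntegrable_mul_deriv hcont.continuousOn
  have hlog : ∀ α β, (∀ t ∈ Set.uIcc α β, X ≤ (γ t).re) →
      ∫ t in α..β, (γ t - w)⁻¹ * deriv γ t =
        Complex.log (γ β - w) - Complex.log (γ α - w) := by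
    intro α β hre
    refine h.integral_comp_mul_deriv (L := fun s => Complex.log (s - w))
      (l := fun s => (s - w)⁻¹) (fun t ht => ?_) hcont.continuousOn
    have hsl : γ t - w ∈ Complex.slitPlane := by
      left
      simpa using hwX.trans_le (hre t ht)
    simpa using ((hasDerivAt_id (γ t)).sub_const w).clog hsl
  have hre₁ : ∀ t ≤ c₁.re - X, X ≤ (γ t).re := by
    intro t ht
    rw [hs t (by linarith)]
    simp
    linarith
  have hre₂ : ∀ t ≥ X - c₂.re, X ≤ (γ t).re := by
    intro t ht
    rw [hf t (by linarith)]
    simp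
    linarith
  have hlim' : Tendsto (fun T : ℝ => ∫ t in (-T)..T, (γ t - w)⁻¹ * deriv γ t) atTop
      (𝓝 (2 * Real.pi * Complex.I * k)) := by
    have h0 : (2 * Real.pi * Complex.I : ℂ) ≠ 0 := Complex.two_pi_I_ne_zero
    refine (hlim.const_mul (2 * Real.pi * Complex.I)).congr fun T => ?_
    rw [mul_inv_cancel_left₀ h0]
    exact intervalIntegral.integral_congr fun t _ => by simp only [div_eq_inv_mul]
  have hev : (fun T : ℝ => (∫ t in (c₁.re - X)..(X - c₂.re), (γ t - w)⁻¹ * deriv γ t)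
      + (Complex.log (γ (c₁.re - X) - w) - Complex.log (γ (X - c₂.re) - w))
      + (Complex.log (c₂ - w + T) - Complex.log (c₁ - w + T))) =ᶠ[atTop]
      fun T : ℝ => ∫ t in (-T)..T, (γ t - w)⁻¹ * deriv γ t := by
    filter_upwards [eventually_ge_atTop (X - c₁.re), eventually_ge_atTop (X - c₂.re)] with T h1 h2
    rw [← intervalIntegral.integral_add_adjacent_intervals (hint (-T) (c₁.re - X)) (hint _ T),
      ← intervalIntegral.integral_add_adjacent_intervals (hint (c₁.re - X) (X - c₂.re)) (hint _ T),
      hlog (-T) (c₁.re - X) (fun t ht => hre₁ t (by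
        rw [Set.uIcc_of_le (by linarith)] at ht; exact ht.2)),
      hlog (X - c₂.re) T (fun t ht => hre₂ t (by
        rw [Set.uIcc_of_le (by linarith)] at ht; exact ht.1)),
      hs (-T) (by linarith), hf T (by linarith)]
    push_cast
    rw [show c₁ - -(T : ℂ) - w = c₁ - w + T by ring, show c₂ + (T : ℂ) - w = c₂ - w + T by ring]
    ring
  have hlim2 := ((tendsto_log_add_sub_log_add (c₂ - w) (c₁ - w)).const_add
    ((∫ t in (c₁.re - X)..(X - c₂.re), (γ t - w)⁻¹ * deriv γ t)
      + (Complex.log (γ (c₁.re - X) - w) - Complex.log (γ (X - c₂.re) - w)))).congr' hev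
  have := tendsto_nhds_unique hlim2 hlim'
  rw [add_zero] at this
  rw [← this]
  ring

/-- The curve truncated at `Re s = X` and closed by a vertical segment winds `k` times about the
points of winding number `k` to the left of that line, and does not wind about the points to the
right of it. -/
theorem closed_integral_inv_sub (h : IsCurveFromInfinity γ) {c₁ c₂ w : ℂ} {T₀ X : ℝ} {k : ℤ}
    (hs : ∀ t ≤ -T₀, γ t = c₁ - t) (hf : ∀ t ≥ T₀, γ t = c₂ + t)
    (hw : HasWindingNumber γ w k) (hX₁ : T₀ ≤ X - c₁.re) (hX₂ : T₀ ≤ X - c₂.re)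
    (hX : ∀ t ∈ Set.uIcc (c₁.re - X) (X - c₂.re), (γ t).re ≤ X) (hwX : w.re ≠ X) :
    ((∫ t in (c₁.re - X)..(X - c₂.re), (γ t - w)⁻¹ * deriv γ t) -
      ∫ y in c₁.im..c₂.im, (X + y * Complex.I - w)⁻¹ * Complex.I) =
      if w.re < X then 2 * Real.pi * Complex.I * k else 0 := by
  have hγ₁ : γ (c₁.re - X) = X + c₁.im * Complex.I := by
    rw [hs _ (by linarith)]
    apply Complex.ext <;> simp
  have hγ₂ : γ (X - c₂.re) = X + c₂.im * Complex.I := by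
    rw [hf _ (by linarith)]
    apply Complex.ext <;> simp
  have hne' : ∀ y : ℝ, (X + y * Complex.I - w : ℂ) ≠ 0 := by
    intro y h0
    have := congrArg Complex.re h0
    simp at this
    exact hwX (by linarith)
  have hcont' : Continuous fun y : ℝ => (X + y * Complex.I - w : ℂ)⁻¹ * Complex.I :=
    (Continuous.inv₀ (by fun_prop) hne').mul continuous_const
  have hline : ∀ y : ℝ, HasDerivAt (fun y : ℝ => (X + y * Complex.I - w : ℂ)) Complex.I y := by
    intro y
    simpa using (((Complex.ofRealCLM.hasDerivAt (x := y)).mul_const Complex.I).const_add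
      (X : ℂ)).sub_const w
  split_ifs with hlt
  · have h2 : ∫ y in c₁.im..c₂.im, (X + y * Complex.I - w)⁻¹ * Complex.I =
        Complex.log (X + c₂.im * Complex.I - w) - Complex.log (X + c₁.im * Complex.I - w) := by
      refine intervalIntegral.integral_eq_sub_of_hasDerivAt
        (f := fun y : ℝ => Complex.log (X + y * Complex.I - w)) (fun y _ => ?_)
        (hcont'.intervalIntegrable _ _)
      have := (hline y).clog_real (Or.inl (by simpa using hlt))
      simpa [div_eq_inv_mul] using this
    rw [h.integral_of_hasWindingNumber hs hf hw hX₁ hX₂ hlt, h2, hγ₁, hγ₂]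
    ring
  · have hgt : X < w.re := lt_of_le_of_ne (not_lt.mp hlt) (Ne.symm hwX)
    have hcont : Continuous fun t => (γ t - w)⁻¹ :=
      (h.continuous.sub continuous_const).inv₀ fun t => sub_ne_zero.mpr (hw.1 t)
    have h1 : ∀ s : ℂ, s.re ≤ X → HasDerivAt (fun s => Complex.log (w - s)) ((s - w)⁻¹) s := by
      intro s hsX
      have hsl : w - s ∈ Complex.slitPlane := by
        left
        simpa using hsX.trans_lt hgt
      refine (((hasDerivAt_id s).const_sub w).clog hsl).congr_deriv ?_
      rw [← neg_sub w s, inv_neg, id, neg_div, one_div]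
    have h2 : ∫ y in c₁.im..c₂.im, (X + y * Complex.I - w)⁻¹ * Complex.I =
        Complex.log (w - (X + c₂.im * Complex.I)) - Complex.log (w - (X + c₁.im * Complex.I)) := by
      refine intervalIntegral.integral_eq_sub_of_hasDerivAt
        (f := fun y : ℝ => Complex.log (w - (X + y * Complex.I))) (fun y _ => ?_)
        (hcont'.intervalIntegrable _ _)
      have h3 : HasDerivAt (fun y : ℝ => (X + y * Complex.I : ℂ)) Complex.I y := by
        simpa using ((hline y).add_const w)
      have := (h1 (X + y * Complex.I) (by simp)).scomp y h3
      rw [smul_eq_mul, mul_comm] at this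
      exact this
    have h4 : ∫ t in (c₁.re - X)..(X - c₂.re), (γ t - w)⁻¹ * deriv γ t =
        Complex.log (w - γ (X - c₂.re)) - Complex.log (w - γ (c₁.re - X)) := by
      refine h.integral_comp_mul_deriv (L := fun s => Complex.log (w - s))
        (l := fun s => (s - w)⁻¹) (fun t ht => h1 _ (hX t ht)) hcont.continuousOn
    rw [h2, h4, hγ₁, hγ₂]
    ring

/-- The residue theorem for the truncated and closed curve. -/
theorem closed_integral_eq_sum_residues (h : IsCurveFromInfinity γ) {c₁ c₂ : ℂ} {T₀ X R : ℝ}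
    {k f ρ H : ℂ → ℂ} {S : Finset ℂ}
    (hk : ∀ w ∈ S, ∃ n : ℤ, k w = n ∧ HasWindingNumber γ w n)
    (hs : ∀ t ≤ -T₀, γ t = c₁ - t) (hf : ∀ t ≥ T₀, γ t = c₂ + t)
    (hX₁ : T₀ ≤ X - c₁.re) (hX₂ : T₀ ≤ X - c₂.re)
    (hX : ∀ t ∈ Set.uIcc (c₁.re - X) (X - c₂.re), (γ t).re ≤ X) (hSX : ∀ w ∈ S, w.re ≠ X)
    (hR : ∀ t ∈ Set.uIcc (c₁.re - X) (X - c₂.re), ‖γ t‖ < R)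
    (hR' : ∀ y ∈ Set.uIcc c₁.im c₂.im, ‖(X + y * Complex.I : ℂ)‖ < R)
    (hfc : ∀ s ∈ Metric.ball (0 : ℂ) R, s ∉ S → ContinuousAt f s)
    (hH : ∀ s ∈ Metric.ball (0 : ℂ) R, s ∉ S → HasDerivAt H (f s - ∑ w ∈ S, ρ w / (s - w)) s) :
    ((∫ t in (c₁.re - X)..(X - c₂.re), f (γ t) * deriv γ t) -
      ∫ y in c₁.im..c₂.im, f (X + y * Complex.I) * Complex.I) =
      ∑ w ∈ S, ρ w * if w.re < X then 2 * Real.pi * Complex.I * k w else 0 := by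
  have hγ₁ : γ (c₁.re - X) = X + c₁.im * Complex.I := by
    rw [hs _ (by linarith)]
    apply Complex.ext <;> simp
  have hγ₂ : γ (X - c₂.re) = X + c₂.im * Complex.I := by
    rw [hf _ (by linarith)]
    apply Complex.ext <;> simp
  have hγS : ∀ t, γ t ∉ S := fun t ht => by
    obtain ⟨n, -, hn⟩ := hk _ ht
    exact hn.1 t rfl
  have hLS : ∀ y : ℝ, (X + y * Complex.I : ℂ) ∉ S := fun y hy => hSX _ hy (by simp)
  have hLc : Continuous fun y : ℝ => (X + y * Complex.I : ℂ) := by fun_prop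
  have hLd : ∀ y : ℝ, HasDerivAt (fun y : ℝ => (X + y * Complex.I : ℂ)) Complex.I y := by
    intro y
    simpa using ((Complex.ofRealCLM.hasDerivAt (x := y)).mul_const Complex.I).const_add (X : ℂ)
  -- the integrals of `f` and of its singular part along the two pieces
  have hfγ : ContinuousOn (fun t => f (γ t)) (Set.uIcc (c₁.re - X) (X - c₂.re)) := fun t ht =>
    ((hfc _ (by simpa using hR t ht) (hγS t)).comp h.continuous.continuousAt).continuousWithinAt
  have hfL : ContinuousOn (fun y : ℝ => f (X + y * Complex.I)) (Set.uIcc c₁.im c₂.im) :=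
    fun y hy => ContinuousAt.continuousWithinAt <|
      ContinuousAt.comp (f := fun y : ℝ => (X + y * Complex.I : ℂ)) (g := f)
        (hfc _ (by simpa using hR' y hy) (hLS y)) hLc.continuousAt
  have hrγ : ∀ w ∈ S, Continuous fun t => (γ t - w)⁻¹ := fun w hw =>
    (h.continuous.sub continuous_const).inv₀ fun t => sub_ne_zero.mpr fun e => hγS t (e ▸ hw)
  have hrL : ∀ w ∈ S, Continuous fun y : ℝ => (X + y * Complex.I - w : ℂ)⁻¹ := fun w hw =>
    (hLc.sub continuous_const).inv₀ fun y =>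
      sub_ne_zero.mpr (show (X + y * Complex.I : ℂ) ≠ w from fun e => hLS y (e ▸ hw))
  have hsγ : Continuous fun t => ∑ w ∈ S, ρ w / (γ t - w) := by
    refine continuous_finsetSum _ fun w hw => ?_
    simp only [div_eq_mul_inv]
    exact continuous_const.mul (hrγ w hw)
  have hsL : Continuous fun y : ℝ => ∑ w ∈ S, ρ w / (X + y * Complex.I - w : ℂ) := by
    refine continuous_finsetSum _ fun w hw => ?_
    simp only [div_eq_mul_inv]
    exact continuous_const.mul (hrL w hw)
  have e1 : ∫ t in (c₁.re - X)..(X - c₂.re), (f (γ t) - ∑ w ∈ S, ρ w / (γ t - w)) * deriv γ t =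
      H (γ (X - c₂.re)) - H (γ (c₁.re - X)) :=
    h.integral_comp_mul_deriv (L := H) (l := fun s => f s - ∑ w ∈ S, ρ w / (s - w))
      (fun t ht => hH _ (by simpa using hR t ht) (hγS t)) (hfγ.sub hsγ.continuousOn)
  have e2 : ∫ y in c₁.im..c₂.im,
      (f (X + y * Complex.I) - ∑ w ∈ S, ρ w / (X + y * Complex.I - w)) * Complex.I =
      H (γ (X - c₂.re)) - H (γ (c₁.re - X)) := by
    rw [hγ₁, hγ₂]
    refine intervalIntegral.integral_eq_sub_of_hasDerivAt
      (f := fun y : ℝ => H (X + y * Complex.I)) (fun y hy => ?_)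
      ((hfL.sub hsL.continuousOn).mul continuousOn_const).intervalIntegrable
    have := (hH _ (by simpa using hR' y hy) (hLS y)).scomp y (hLd y)
    rw [smul_eq_mul, mul_comm] at this
    exact this
  have e3 : ∫ t in (c₁.re - X)..(X - c₂.re), (∑ w ∈ S, ρ w / (γ t - w)) * deriv γ t =
      ∑ w ∈ S, ρ w * ∫ t in (c₁.re - X)..(X - c₂.re), (γ t - w)⁻¹ * deriv γ t := by
    simp_rw [← intervalIntegral.integral_const_mul]
    rw [← intervalIntegral.integral_finsetSum]
    · refine intervalIntegral.integral_congr fun t _ => ?_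
      simp only [Finset.sum_mul]
      exact Finset.sum_congr rfl fun w _ => by ring
    · exact fun w hw => (h.intervalIntegrable_mul_deriv (hrγ w hw).continuousOn).const_mul _
  have e4 : ∫ y in c₁.im..c₂.im, (∑ w ∈ S, ρ w / (X + y * Complex.I - w)) * Complex.I =
      ∑ w ∈ S, ρ w * ∫ y in c₁.im..c₂.im, (X + y * Complex.I - w)⁻¹ * Complex.I := by
    simp_rw [← intervalIntegral.integral_const_mul]
    rw [← intervalIntegral.integral_finsetSum]
    · refine intervalIntegral.integral_congr fun t _ => ?_
      simp only [Finset.sum_mul]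
      exact Finset.sum_congr rfl fun w _ => by ring
    · exact fun w hw =>
        (((hrL w hw).mul continuous_const).const_smul (ρ w)).intervalIntegrable _ _
  have e5 : ∑ w ∈ S, ρ w * (∫ t in (c₁.re - X)..(X - c₂.re), (γ t - w)⁻¹ * deriv γ t) -
      ∑ w ∈ S, ρ w * (∫ y in c₁.im..c₂.im, (X + y * Complex.I - w)⁻¹ * Complex.I) =
      ∑ w ∈ S, ρ w * if w.re < X then 2 * Real.pi * Complex.I * k w else 0 := by
    rw [← Finset.sum_sub_distrib]
    refine Finset.sum_congr rfl fun w hw => ?_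
    obtain ⟨n, hkn, hn⟩ := hk w hw
    rw [← mul_sub, h.closed_integral_inv_sub hs hf hn hX₁ hX₂ hX (hSX w hw), hkn]
  simp only [sub_mul] at e1 e2
  rw [intervalIntegral.integral_sub (h.intervalIntegrable_mul_deriv hfγ)
    (h.intervalIntegrable_mul_deriv hsγ.continuousOn), e3] at e1
  have i1 : IntervalIntegrable (fun y : ℝ => f (X + y * Complex.I) * Complex.I)
      MeasureTheory.volume c₁.im c₂.im := (hfL.mul continuousOn_const).intervalIntegrable
  have i2 : IntervalIntegrable
      (fun y : ℝ => (∑ w ∈ S, ρ w / (X + y * Complex.I - w : ℂ)) * Complex.I)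
      MeasureTheory.volume c₁.im c₂.im := (hsL.mul continuous_const).intervalIntegrable _ _
  rw [intervalIntegral.integral_sub i1 i2, e4] at e2
  linear_combination e1 - e2 + e5

end IsCurveFromInfinity

/-! ### Independence of the integral from the curve -/

/-- `f` is holomorphic off the locally finite set `P`, meromorphic at the points of `P`, and far to
the right the translation by `1` decreases `f` by a factor `q < 1`. -/
structure IsGeometricallyDecaying (P : Set ℂ) (f : ℂ → ℂ) : Prop where
  finite : ∀ R, (P ∩ Metric.ball 0 R).Finite
  differentiableAt : ∀ s, s ∉ P → DifferentiableAt ℂ f s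
  meromorphicAt : ∀ w ∈ P, MeromorphicAt f w
  decay : ∃ X q : ℝ, 0 < q ∧ q < 1 ∧ ∀ s : ℂ, X ≤ s.re → s ∉ P → ‖f (s + 1)‖ ≤ q * ‖f s‖

/-- A function on a half-line that decreases by a factor `q < 1` under translation by `1` decays
exponentially. -/
theorem integrableOn_Ioi_of_norm_add_one_le {g : ℝ → ℂ} {a q : ℝ} (hq₀ : 0 < q) (hq₁ : q < 1)
    (hg : ContinuousOn g (Set.Ici a)) (hstep : ∀ t ≥ a, ‖g (t + 1)‖ ≤ q * ‖g t‖) :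
    MeasureTheory.IntegrableOn g (Set.Ioi a) := by
  set b := -Real.log q with hb
  have hbpos : 0 < b := by
    rw [hb]; linarith [Real.log_neg hq₀ hq₁]
  obtain ⟨C, hC⟩ := (isCompact_Icc (a := a) (b := a + 1)).exists_bound_of_continuousOn
    (f := fun t => ‖g t‖ * Real.exp (b * t))
    ((hg.mono Set.Icc_subset_Ici_self).norm.mul (by fun_prop))
  have hu : ∀ n : ℕ, ∀ t, a ≤ t → t ≤ a + 1 + n → ‖g t‖ * Real.exp (b * t) ≤ C := by
    intro n
    induction n with
    | zero =>
      intro t h1 h2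
      exact (le_abs_self _).trans (hC t ⟨h1, by simpa using h2⟩)
    | succ n ih =>
      intro t h1 h2
      by_cases h3 : t ≤ a + 1
      · exact (le_abs_self _).trans (hC t ⟨h1, h3⟩)
      · have h4 := ih (t - 1) (by linarith) (by push_cast at h2; linarith)
        refine le_trans ?_ h4
        have h5 := hstep (t - 1) (by linarith)
        rw [sub_add_cancel] at h5
        have h6 : Real.exp (b * (t - 1)) = q * Real.exp (b * t) := by
          rw [mul_sub, sub_eq_add_neg, Real.exp_add, hb]
          simp [Real.exp_log hq₀, mul_comm]
        rw [h6]
        nlinarith [Real.exp_pos (b * t)]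
  have hbound : ∀ t ∈ Set.Ioi a, ‖g t‖ ≤ C * Real.exp (-b * t) := by
    intro t ht
    obtain ⟨n, hn⟩ := exists_nat_ge (t - (a + 1))
    have := hu n t (le_of_lt ht) (by linarith)
    rw [neg_mul, Real.exp_neg, ← div_eq_mul_inv, le_div_iff₀ (Real.exp_pos _)]
    exact this
  refine MeasureTheory.Integrable.mono' ((exp_neg_integrableOn_Ioi a hbpos).const_mul C)
    ((hg.mono Set.Ioi_subset_Ici_self).aestronglyMeasurable measurableSet_Ioi) ?_
  exact (MeasureTheory.ae_restrict_iff' measurableSet_Ioi).mpr (Eventually.of_forall hbound)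

theorem deriv_eq_one_of_eq_add {γ : ℝ → ℂ} {c : ℂ} {T : ℝ}
    (hf : ∀ t ≥ T, γ t = c + t) : ∀ t > T, deriv γ t = 1 := by
  intro t ht
  have h1 : γ =ᶠ[𝓝 t] fun t => c + t := by
    filter_upwards [lt_mem_nhds ht] with u hu using hf u hu.le
  rw [h1.deriv_eq]
  exact ((Complex.ofRealCLM.hasDerivAt (x := t)).const_add c).deriv

theorem deriv_eq_neg_one_of_eq_sub {γ : ℝ → ℂ} {c : ℂ} {T : ℝ}
    (hs : ∀ t ≤ T, γ t = c - t) : ∀ t < T, deriv γ t = -1 := by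
  intro t ht
  have h1 : γ =ᶠ[𝓝 t] fun t => c - t := by
    filter_upwards [gt_mem_nhds ht] with u hu using hs u hu.le
  rw [h1.deriv_eq]
  exact ((Complex.ofRealCLM.hasDerivAt (x := t)).const_sub c).deriv

namespace IsCurveFromInfinity

variable {γ : ℝ → ℂ}

theorem exists_truncation (h : IsCurveFromInfinity γ) : ∃ (c₁ c₂ : ℂ) (T₀ X₁ : ℝ),
    (∀ t ≤ -T₀, γ t = c₁ - t) ∧ (∀ t ≥ T₀, γ t = c₂ + t) ∧ ∀ X ≥ X₁,
      T₀ ≤ X - c₁.re ∧ T₀ ≤ X - c₂.re ∧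
      ∀ t ∈ Set.uIcc (c₁.re - X) (X - c₂.re), (γ t).re ≤ X := by
  obtain ⟨c₁, T₁, hs⟩ := h.start
  obtain ⟨c₂, T₂, hf⟩ := h.finish
  obtain ⟨T₀, h0, h1, h2⟩ : ∃ T₀, 0 ≤ T₀ ∧ -T₁ ≤ T₀ ∧ T₂ ≤ T₀ :=
    ⟨max 0 (max (-T₁) T₂), by simp, by simp, by simp⟩
  obtain ⟨B, hB⟩ := (isCompact_Icc (a := -T₀) (b := T₀)).exists_bound_of_continuousOn
    h.continuous.continuousOn
  have hs' : ∀ t ≤ -T₀, γ t = c₁ - t := fun t ht => hs t (by linarith)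
  have hf' : ∀ t ≥ T₀, γ t = c₂ + t := fun t ht => hf t (by linarith)
  refine ⟨c₁, c₂, T₀, max B (max (T₀ + c₁.re) (T₀ + c₂.re)), hs', hf', fun X hX => ?_⟩
  simp only [ge_iff_le, max_le_iff] at hX
  refine ⟨by linarith, by linarith, fun t ht => ?_⟩
  rw [Set.uIcc_of_le (by linarith)] at ht
  rcases le_total t (-T₀) with h3 | h3
  · rw [hs' t h3]
    simp
    linarith [ht.1]
  rcases le_total T₀ t with h4 | h4
  · rw [hf' t h4]
    simp
    linarith [ht.2]
  · exact ((Complex.abs_re_le_norm _).trans (hB t ⟨h3, h4⟩) |> (le_abs_self _).trans).trans hX.1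

end IsCurveFromInfinity

namespace IsGeometricallyDecaying

variable {P : Set ℂ} {f : ℂ → ℂ} {γ : ℝ → ℂ}

theorem integrable (hf : IsGeometricallyDecaying P f) (h : IsCurveFromInfinity γ)
    (hγ : ∀ t, γ t ∉ P) : MeasureTheory.Integrable fun t => f (γ t) * deriv γ t := by
  obtain ⟨c₁, c₂, T₀, -, hs, hfin, -⟩ := h.exists_truncation
  obtain ⟨X, q, hq₀, hq₁, hstep⟩ := hf.decay
  obtain ⟨A, hA₀, hA₁, hA₂⟩ : ∃ A, T₀ ≤ A ∧ X - c₁.re ≤ A ∧ X - c₂.re ≤ A :=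
    ⟨max T₀ (max (X - c₁.re) (X - c₂.re)), by simp, by simp, by simp⟩
  have hcont : Continuous fun t => f (γ t) := continuous_iff_continuousAt.mpr fun t =>
    (hf.differentiableAt _ (hγ t)).continuousAt.comp h.continuous.continuousAt
  have hright : MeasureTheory.IntegrableOn (fun t => f (γ t) * deriv γ t) (Set.Ioi A) := by
    refine (integrableOn_Ioi_of_norm_add_one_le hq₀ hq₁ (g := fun t => f (γ t)) (a := A)
      hcont.continuousOn fun t ht => ?_).congr_fun (fun t ht => ?_) measurableSet_Ioi
    · have h1 := hstep (γ t) (by rw [hfin t (hA₀.trans ht)]; simp; linarith) (hγ t)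
      have h2 : γ (t + 1) = γ t + 1 := by
        rw [hfin t (hA₀.trans ht), hfin (t + 1) (by linarith)]
        push_cast
        ring
      simpa only [h2] using h1
    · simp only
      rw [deriv_eq_one_of_eq_add hfin t (lt_of_le_of_lt hA₀ ht), mul_one]
  have hleft : MeasureTheory.IntegrableOn (fun t => f (γ t) * deriv γ t) (Set.Iio (-A)) := by
    have h0 : MeasureTheory.IntegrableOn (fun t => f (γ (-t))) (Set.Ioi A) := by
      refine integrableOn_Ioi_of_norm_add_one_le hq₀ hq₁ (a := A)
        (hcont.comp continuous_neg).continuousOn fun t ht => ?_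
      have h1 := hstep (γ (-t)) (by
        rw [hs (-t) (by linarith)]; simp; linarith) (hγ _)
      have h2 : γ (-(t + 1)) = γ (-t) + 1 := by
        rw [hs (-t) (by linarith), hs (-(t + 1)) (by linarith)]
        push_cast
        ring
      simpa only [h2] using h1
    have h3 : MeasureTheory.IntegrableOn (fun t => f (γ t)) (Set.Iio (-A)) := by
      have := h0.comp_neg
      simpa using this
    refine h3.neg.congr_fun (fun t ht => ?_) measurableSet_Iio
    simp only [Pi.neg_apply]
    rw [deriv_eq_neg_one_of_eq_sub hs t (lt_of_lt_of_le ht (by linarith))]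
    ring
  have hmid : MeasureTheory.IntegrableOn (fun t => f (γ t) * deriv γ t) (Set.uIcc (-A) A) := by
    have := h.intervalIntegrable_mul_deriv (α := -A) (β := A) hcont.continuousOn
    rwa [intervalIntegrable_iff'] at this
  rw [← MeasureTheory.integrableOn_univ]
  refine ((hleft.union hmid).union hright).mono_set fun t _ => ?_
  simp only [Set.mem_union, Set.mem_Iio, Set.mem_Ioi]
  by_cases h1 : t < -A
  · exact Or.inl (Or.inl h1)
  by_cases h2 : A < t
  · exact Or.inr h2
  · exact Or.inl (Or.inr (Set.Icc_subset_uIcc ⟨not_lt.mp h1, not_lt.mp h2⟩))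

theorem countable (hf : IsGeometricallyDecaying P f) : P.Countable := by
  have : P = ⋃ n : ℕ, P ∩ Metric.ball 0 n := by
    rw [← Set.inter_iUnion, Metric.iUnion_ball_nat, Set.inter_univ]
  rw [this]
  exact Set.countable_iUnion fun n => (hf.finite n).countable

/-- There are vertical lines avoiding `P`, in a sequence of step `1`, along which the integrals of
`f` over a segment of bounded height tend to `0`. -/
theorem exists_vertical_lines (hf : IsGeometricallyDecaying P f) : ∃ X₀ : ℝ,
    (∀ n : ℕ, ∀ w ∈ P, w.re ≠ X₀ + n) ∧ ∀ h₁ h₂ : ℝ,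
      Tendsto (fun n : ℕ => ∫ y in h₁..h₂,
        f (((X₀ + n : ℝ) : ℂ) + y * Complex.I) * Complex.I) atTop (𝓝 0) := by
  obtain ⟨X, q, hq₀, hq₁, hstep⟩ := hf.decay
  have hc : (⋃ n : ℕ, (fun w : ℂ => w.re - n) '' P).Countable :=
    Set.countable_iUnion fun n => hf.countable.image _
  obtain ⟨X₀, hX₀, hX⟩ := (hc.dense_compl ℝ).exists_mem_open isOpen_Ioi ⟨X + 1, lt_add_one X⟩
  have hav : ∀ n : ℕ, ∀ w ∈ P, w.re ≠ X₀ + n := by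
    intro n w hw e
    exact hX₀ (Set.mem_iUnion.mpr ⟨n, w, hw, by simp [e]⟩)
  refine ⟨X₀, hav, fun h₁ h₂ => ?_⟩
  have hline : ∀ n : ℕ, ∀ y : ℝ, (((X₀ + n : ℝ) : ℂ) + y * Complex.I) ∉ P := by
    intro n y hy
    exact hav n _ hy (by simp)
  have hcont : Continuous fun y : ℝ => f (X₀ + y * Complex.I) := by
    refine continuous_iff_continuousAt.mpr fun y => ?_
    refine ContinuousAt.comp (f := fun y : ℝ => (X₀ + y * Complex.I : ℂ)) (g := f)
      (hf.differentiableAt _ ?_).continuousAt (by fun_prop)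
    simpa using hline 0 y
  obtain ⟨C, hC⟩ := (isCompact_uIcc (a := h₁) (b := h₂)).exists_bound_of_continuousOn
    hcont.continuousOn
  have hb : ∀ n : ℕ, ∀ y ∈ Set.uIcc h₁ h₂,
      ‖f (((X₀ + n : ℝ) : ℂ) + y * Complex.I)‖ ≤ C * q ^ n := by
    intro n y hy
    induction n with
    | zero => simpa using hC y hy
    | succ n ih =>
      have := hstep (((X₀ + n : ℝ) : ℂ) + y * Complex.I) (by
        have h1 : X < X₀ := hX
        have h2 : (0 : ℝ) ≤ n := n.cast_nonneg
        simp
        linarith) (hline n y)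
      have e : (((X₀ + (n + 1 : ℕ) : ℝ) : ℂ) + y * Complex.I) =
          ((X₀ + n : ℝ) : ℂ) + y * Complex.I + 1 := by
        push_cast
        ring
      rw [e, pow_succ]
      calc _ ≤ q * ‖f (((X₀ + n : ℝ) : ℂ) + y * Complex.I)‖ := this
        _ ≤ q * (C * q ^ n) := by gcongr
        _ = _ := by ring
  refine squeeze_zero_norm (a := fun n : ℕ => C * q ^ n * |h₂ - h₁|) (fun n => ?_) ?_
  · refine intervalIntegral.norm_integral_le_of_norm_le_const fun y hy => ?_
    rw [norm_mul, Complex.norm_I, mul_one]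
    exact hb n y (Set.uIoc_subset_uIcc hy)
  · have := ((tendsto_pow_atTop_nhds_zero_of_lt_one hq₀.le hq₁).const_mul C).mul_const |h₂ - h₁|
    simpa using this

/-- The integral of a geometrically decaying function along a curve from `+∞` to `+∞` depends only
on the winding numbers of the curve about the poles. -/
theorem integral_eq (hf : IsGeometricallyDecaying P f) {γ₁ γ₂ : ℝ → ℂ}
    (h₁ : IsCurveFromInfinity γ₁) (h₂ : IsCurveFromInfinity γ₂)
    (hw : ∀ w ∈ P, ∃ n : ℤ, HasWindingNumber γ₁ w n ∧ HasWindingNumber γ₂ w n) :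
    ∫ t, f (γ₁ t) * deriv γ₁ t = ∫ t, f (γ₂ t) * deriv γ₂ t := by
  have hγ₁ : ∀ t, γ₁ t ∉ P := fun t ht => by
    obtain ⟨n, hn, -⟩ := hw _ ht
    exact hn.1 t rfl
  have hγ₂ : ∀ t, γ₂ t ∉ P := fun t ht => by
    obtain ⟨n, -, hn⟩ := hw _ ht
    exact hn.1 t rfl
  choose! k hk₁ hk₂ using hw
  obtain ⟨X₀, hav, hlim⟩ := hf.exists_vertical_lines
  obtain ⟨c₁, d₁, T₁, B₁, hs₁, hf₁, hB₁⟩ := h₁.exists_truncation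
  obtain ⟨c₂, d₂, T₂, B₂, hs₂, hf₂, hB₂⟩ := h₂.exists_truncation
  have hX : Tendsto (fun n : ℕ => X₀ + (n : ℝ)) atTop atTop :=
    tendsto_atTop_add_const_left _ _ tendsto_natCast_atTop_atTop
  have hconv : ∀ {γ : ℝ → ℂ}, IsCurveFromInfinity γ → (∀ t, γ t ∉ P) → ∀ c d : ℂ,
      Tendsto (fun n : ℕ => (∫ t in (c.re - (X₀ + n))..(X₀ + n - d.re), f (γ t) * deriv γ t) -
        ∫ y in c.im..d.im, f (((X₀ + n : ℝ) : ℂ) + y * Complex.I) * Complex.I) atTop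
        (𝓝 (∫ t, f (γ t) * deriv γ t)) := by
    intro γ h hγ c d
    have h3 := MeasureTheory.intervalIntegral_tendsto_integral (hf.integrable h hγ)
      (tendsto_atBot_add_const_left _ c.re (tendsto_neg_atTop_atBot.comp hX))
      (tendsto_atTop_add_const_right _ (-d.re) hX)
    have := h3.sub (hlim c.im d.im)
    rw [sub_zero] at this
    exact this
  refine tendsto_nhds_unique (hconv h₁ hγ₁ c₁ d₁) ((hconv h₂ hγ₂ c₂ d₂).congr' ?_)
  filter_upwards [hX.eventually_ge_atTop B₁, hX.eventually_ge_atTop B₂] with n hn₁ hn₂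
  obtain ⟨a₁, b₁, hr₁⟩ := hB₁ _ hn₁
  obtain ⟨a₂, b₂, hr₂⟩ := hB₂ _ hn₂
  set X := X₀ + (n : ℝ) with hXdef
  -- a disc containing both truncated curves and the two vertical segments
  obtain ⟨R₁, hR₁⟩ := (isCompact_uIcc (a := c₁.re - X) (b := X - d₁.re)).exists_bound_of_continuousOn
    h₁.continuous.continuousOn
  obtain ⟨R₂, hR₂⟩ := (isCompact_uIcc (a := c₂.re - X) (b := X - d₂.re)).exists_bound_of_continuousOn
    h₂.continuous.continuousOn
  have hLc : Continuous fun y : ℝ => (X + y * Complex.I : ℂ) := by fun_prop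
  obtain ⟨R₃, hR₃⟩ := (isCompact_uIcc (a := c₁.im) (b := d₁.im)).exists_bound_of_continuousOn
    hLc.continuousOn
  obtain ⟨R₄, hR₄⟩ := (isCompact_uIcc (a := c₂.im) (b := d₂.im)).exists_bound_of_continuousOn
    hLc.continuousOn
  obtain ⟨R, hRR⟩ : ∃ R, R₁ < R ∧ R₂ < R ∧ R₃ < R ∧ R₄ < R :=
    ⟨max (max R₁ R₂) (max R₃ R₄) + 1, by
      refine ⟨?_, ?_, ?_, ?_⟩ <;> refine lt_of_le_of_lt ?_ (lt_add_one _) <;> simp⟩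
  set S := (hf.finite R).toFinset with hS
  have hSP : ∀ w ∈ S, w ∈ P := fun w hw => ((hf.finite R).mem_toFinset.mp hw).1
  have hSd : ∀ s ∈ Metric.ball (0 : ℂ) R, s ∉ S → DifferentiableAt ℂ f s := fun s hs hsS =>
    hf.differentiableAt s fun h => hsS ((hf.finite R).mem_toFinset.mpr ⟨h, hs⟩)
  obtain ⟨ρ, H, hH⟩ := exists_primitive_add_residues R S f hSd
    fun w hw => hf.meromorphicAt w (hSP w hw)
  have e₁ := h₁.closed_integral_eq_sum_residues (k := fun w => k w) (ρ := ρ) (H := H)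
    (fun w hw => ⟨k w, rfl, hk₁ w (hSP w hw)⟩) hs₁ hf₁ a₁ b₁ hr₁ (fun w hw => hav n w (hSP w hw))
    (fun t ht => (hR₁ t ht).trans_lt hRR.1) (fun y hy => (hR₃ y hy).trans_lt hRR.2.2.1)
    (fun s hs hsS => (hSd s hs hsS).continuousAt) hH
  have e₂ := h₂.closed_integral_eq_sum_residues (k := fun w => k w) (ρ := ρ) (H := H)
    (fun w hw => ⟨k w, rfl, hk₂ w (hSP w hw)⟩) hs₂ hf₂ a₂ b₂ hr₂ (fun w hw => hav n w (hSP w hw))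
    (fun t ht => (hR₂ t ht).trans_lt hRR.2.1) (fun y hy => (hR₄ y hy).trans_lt hRR.2.2.2)
    (fun s hs hsS => (hSd s hs hsS).continuousAt) hH
  exact e₂.trans e₁.symm

end IsGeometricallyDecaying

/-! ### Mellin–Barnes integrands -/

/-- The points at which the numerator factors of `meijerIntegrand m n a b` may have a pole. -/
def meijerPoles (m n : ℕ) {p q : ℕ} (a : Fin p → ℂ) (b : Fin q → ℂ) : Set ℂ :=
  {w | ∃ j : Fin q, (j : ℕ) < m ∧ ∃ k : ℕ, w = b j + k} ∪
    {w | ∃ i : Fin p, (i : ℕ) < n ∧ ∃ k : ℕ, w = a i - 1 - k}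

theorem finite_meijerPoles_inter_ball (m n : ℕ) {p q : ℕ} (a : Fin p → ℂ) (b : Fin q → ℂ) (R : ℝ) :
    (meijerPoles m n a b ∩ Metric.ball 0 R).Finite := by
  have key : ∀ ε : ℂ, ‖ε‖ = 1 → ∀ c : ℂ,
      ({w | ∃ k : ℕ, w = c + ε * k} ∩ Metric.ball 0 R).Finite := by
    intro ε hε c
    obtain ⟨N, hN⟩ := exists_nat_gt (R + ‖c‖)
    refine ((Set.finite_Iio N).image fun k : ℕ => c + ε * k).subset ?_
    rintro w ⟨⟨k, rfl⟩, hw⟩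
    refine ⟨k, ?_, rfl⟩
    have h1 : ‖c + ε * k‖ < R := by simpa using hw
    have h2 : ‖ε * (k : ℂ)‖ ≤ ‖c + ε * k‖ + ‖c‖ := by
      have := norm_sub_le (c + ε * k) c
      simpa using this
    rw [norm_mul, hε, one_mul, Complex.norm_natCast] at h2
    have : (k : ℝ) < N := by linarith
    exact_mod_cast this
  rw [meijerPoles, Set.union_inter_distrib_right]
  refine Set.Finite.union ?_ ?_
  · refine (Set.finite_iUnion fun j => key 1 (by simp) (b j)).subset ?_
    rintro w ⟨⟨j, -, k, rfl⟩, hw⟩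
    exact Set.mem_iUnion.mpr ⟨j, ⟨k, by simp⟩, hw⟩
  · refine (Set.finite_iUnion fun i => key (-1) (by simp) (a i - 1)).subset ?_
    rintro w ⟨⟨i, -, k, rfl⟩, hw⟩
    exact Set.mem_iUnion.mpr ⟨i, ⟨k, by ring⟩, hw⟩

theorem meromorphicAt_Gamma_comp {g : ℂ → ℂ} {s : ℂ} (hg : AnalyticAt ℂ g s) :
    MeromorphicAt (fun s => Complex.Gamma (g s)) s := by
  have h1 : AnalyticAt ℂ (fun s => (Complex.Gamma (g s))⁻¹) s :=
    (Complex.differentiable_one_div_Gamma.analyticAt (g s)).comp hg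
  have := h1.meromorphicAt.inv
  simpa [Pi.inv_def] using this

theorem meromorphicAt_meijerIntegrand (m n : ℕ) {p q : ℕ} (a : Fin p → ℂ) (b : Fin q → ℂ) {z : ℂ}
    (hz : z ≠ 0) (s : ℂ) : MeromorphicAt (meijerIntegrand m n a b z) s := by
  unfold meijerIntegrand
  refine ((MeromorphicAt.fun_prod fun j _ => ?_).fun_mul
    (MeromorphicAt.fun_prod fun i _ => ?_)).fun_mul ?_
  · split_ifs
    · exact meromorphicAt_Gamma_comp (s := s) (g := fun s => b j - s) (by fun_prop)
    · exact (meromorphicAt_Gamma_comp (s := s) (g := fun s => 1 - b j + s) (by fun_prop)).inv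
  · split_ifs
    · exact meromorphicAt_Gamma_comp (s := s) (g := fun s => 1 - a i + s) (by fun_prop)
    · exact (meromorphicAt_Gamma_comp (s := s) (g := fun s => a i - s) (by fun_prop)).inv
  · have : Differentiable ℂ fun s : ℂ => z ^ s := differentiable_id.const_cpow (Or.inl hz)
    exact (this.analyticAt s).meromorphicAt

theorem differentiableAt_meijerIntegrand (m n : ℕ) {p q : ℕ} (a : Fin p → ℂ) (b : Fin q → ℂ) {z : ℂ}
    (hz : z ≠ 0) {s : ℂ} (hs : s ∉ meijerPoles m n a b) :
    DifferentiableAt ℂ (meijerIntegrand m n a b z) s := by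
  simp only [meijerPoles, Set.mem_union, Set.mem_ofPred_eq, not_or, not_exists, not_and] at hs
  unfold meijerIntegrand
  refine ((DifferentiableAt.fun_finsetProd fun j _ => ?_).fun_mul
    (DifferentiableAt.fun_finsetProd fun i _ => ?_)).fun_mul ?_
  · split_ifs with h
    · refine (Complex.differentiableAt_Gamma _ fun k hk => hs.1 j h k ?_).fun_comp' s (by fun_prop)
      linear_combination -hk
    · exact (Complex.differentiable_one_div_Gamma _).fun_comp' s (by fun_prop)
  · split_ifs with h
    · refine (Complex.differentiableAt_Gamma _ fun k hk => hs.2 i h k ?_).fun_comp' s (by fun_prop)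
      linear_combination hk
    · exact (Complex.differentiable_one_div_Gamma _).fun_comp' s (by fun_prop)
  · exact differentiableAt_id.const_cpow (Or.inl hz)

/-- The functional equation of the Gamma function, in the norm: there the signs that distinguish the
factors `Γ(· - s)` from the factors `1 / Γ(1 - · + s)` disappear. -/
theorem norm_meijerIntegrand_add_one (m n : ℕ) {p q : ℕ} (a : Fin p → ℂ) (b : Fin q → ℂ) {z : ℂ}
    (hz : z ≠ 0) {s : ℂ} (ha : ∀ i, a i - s - 1 ≠ 0) (hb : ∀ j, b j - s - 1 ≠ 0) :
    ‖meijerIntegrand m n a b z (s + 1)‖ * ∏ j, ‖b j - s - 1‖ =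
      ‖z‖ * (∏ i, ‖a i - s - 1‖) * ‖meijerIntegrand m n a b z s‖ := by
  have key : meijerIntegrand m n a b z (s + 1) *
      (∏ j : Fin q, if (j : ℕ) < m then b j - s - 1 else 1 - b j + s) =
      z * (∏ i : Fin p, if (i : ℕ) < n then 1 - a i + s else a i - s - 1) *
        meijerIntegrand m n a b z s := by
    have e1 : (∏ j : Fin q, if (j : ℕ) < m then Complex.Gamma (b j - s)
        else (Complex.Gamma (1 - b j + s))⁻¹) =
        (∏ j : Fin q, if (j : ℕ) < m then Complex.Gamma (b j - (s + 1))
        else (Complex.Gamma (1 - b j + (s + 1)))⁻¹) *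
        ∏ j : Fin q, if (j : ℕ) < m then b j - s - 1 else 1 - b j + s := by
      rw [← Finset.prod_mul_distrib]
      refine Finset.prod_congr rfl fun j _ => ?_
      split_ifs
      · have := Complex.Gamma_add_one (b j - s - 1) (hb j)
        rw [show b j - s - 1 + 1 = b j - s by ring] at this
        rw [this, show b j - (s + 1) = b j - s - 1 by ring, mul_comm]
      · rw [Complex.one_div_Gamma_eq_self_mul_one_div_Gamma_add_one (1 - b j + s),
          show 1 - b j + (s + 1) = 1 - b j + s + 1 by ring, mul_comm]
    have e2 : (∏ i : Fin p, if (i : ℕ) < n then Complex.Gamma (1 - a i + (s + 1))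
        else (Complex.Gamma (a i - (s + 1)))⁻¹) =
        (∏ i : Fin p, if (i : ℕ) < n then 1 - a i + s else a i - s - 1) *
        ∏ i : Fin p, if (i : ℕ) < n then Complex.Gamma (1 - a i + s)
        else (Complex.Gamma (a i - s))⁻¹ := by
      rw [← Finset.prod_mul_distrib]
      refine Finset.prod_congr rfl fun i _ => ?_
      split_ifs
      · rw [show 1 - a i + (s + 1) = 1 - a i + s + 1 by ring, Complex.Gamma_add_one]
        intro h
        exact ha i (by linear_combination -h)
      · rw [Complex.one_div_Gamma_eq_self_mul_one_div_Gamma_add_one (a i - (s + 1)),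
          show a i - (s + 1) + 1 = a i - s by ring, show a i - (s + 1) = a i - s - 1 by ring]
    unfold meijerIntegrand
    rw [e1, e2, Complex.cpow_add _ _ hz, Complex.cpow_one]
    ring
  have := congrArg norm key
  simp only [norm_mul, norm_prod] at this
  convert this using 2
  · refine Finset.prod_congr rfl fun j _ => ?_
    split_ifs
    · rfl
    · rw [← norm_neg]; congr 1; ring
  · congr 1
    refine Finset.prod_congr rfl fun j _ => ?_
    split_ifs
    · rw [← norm_neg]; congr 1; ring
    · rfl

theorem isGeometricallyDecaying_meijerIntegrand (m n : ℕ) {p : ℕ} (a b : Fin p → ℂ) {z : ℂ}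
    (hz : z ≠ 0) (hz₁ : ‖z‖ < 1) :
    IsGeometricallyDecaying (meijerPoles m n a b) (meijerIntegrand m n a b z) where
  finite := finite_meijerPoles_inter_ball m n a b
  differentiableAt s hs := differentiableAt_meijerIntegrand m n a b hz hs
  meromorphicAt w _ := meromorphicAt_meijerIntegrand m n a b hz w
  decay := by
    -- each of the `p` quotients `|a i - s - 1| / |b i - s - 1|` is at most `1 + ε`
    obtain ⟨ε, hε₀, hε⟩ : ∃ ε > 0, ‖z‖ * (1 + ε) ^ p < 1 := by
      have h1 : Tendsto (fun ε : ℝ => ‖z‖ * (1 + ε) ^ p) (𝓝[>] 0) (𝓝 (‖z‖ * (1 + 0) ^ p)) :=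
        Tendsto.mono_left (Continuous.tendsto (by fun_prop) 0) nhdsWithin_le_nhds
      have h2 := h1.eventually_lt_const (u := 1) (by simpa using hz₁)
      obtain ⟨ε, h3, h4⟩ := (h2.and self_mem_nhdsWithin).exists
      exact ⟨ε, h4, h3⟩
    obtain ⟨A, hA⟩ : ∃ A, ∀ i, (a i).re < A - 1 ∧ (b i).re + ‖a i - b i‖ / ε < A - 1 := by
      obtain ⟨A, hA⟩ := (Set.finite_range fun i =>
        max (a i).re ((b i).re + ‖a i - b i‖ / ε)).bddAbove
      refine ⟨A + 2, fun i => ?_⟩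
      have := max_le_iff.mp (hA (Set.mem_range_self i))
      constructor <;> linarith [this.1, this.2]
    refine ⟨A, ‖z‖ * (1 + ε) ^ p, by positivity, hε, fun s hs _ => ?_⟩
    have ha : ∀ i, a i - s - 1 ≠ 0 := fun i h => by
      have := congrArg Complex.re h
      simp at this
      linarith [(hA i).1]
    have hbn : ∀ i, ‖a i - b i‖ / ε < ‖b i - s - 1‖ := fun i => by
      have h1 := Complex.abs_re_le_norm (b i - s - 1)
      have h2 := neg_abs_le (b i - s - 1).re
      simp only [Complex.sub_re, Complex.one_re] at h1 h2
      linarith [(hA i).2]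
    have hb : ∀ i, 0 < ‖b i - s - 1‖ := fun i => lt_of_le_of_lt (by positivity) (hbn i)
    have h1 := norm_meijerIntegrand_add_one m n a b hz ha fun i => norm_pos_iff.mp (hb i)
    have h2 : ∏ i, ‖a i - s - 1‖ ≤ (1 + ε) ^ p * ∏ i, ‖b i - s - 1‖ := by
      rw [show (1 + ε) ^ p = ∏ _i : Fin p, (1 + ε) by simp, ← Finset.prod_mul_distrib]
      refine Finset.prod_le_prod (fun i _ => norm_nonneg _) fun i _ => ?_
      have h3 := norm_add_le (a i - b i) (b i - s - 1)
      rw [show a i - b i + (b i - s - 1) = a i - s - 1 by ring] at h3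
      have h4 := (div_lt_iff₀ hε₀).mp (hbn i)
      linarith
    have h5 : 0 < ∏ j, ‖b j - s - 1‖ := Finset.prod_pos fun i _ => hb i
    refine le_of_mul_le_mul_right ?_ h5
    rw [h1]
    calc ‖z‖ * (∏ i, ‖a i - s - 1‖) * ‖meijerIntegrand m n a b z s‖
        ≤ ‖z‖ * ((1 + ε) ^ p * ∏ i, ‖b i - s - 1‖) * ‖meijerIntegrand m n a b z s‖ := by gcongr
      _ = _ := by ring

/-! ### Meijer's function as the integral over one loop -/

theorem IsMeijerLoop.isCurveFromInfinity {m n p q : ℕ} {a : Fin p → ℂ} {b : Fin q → ℂ} {γ : ℝ → ℂ}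
    (h : IsMeijerLoop m n a b γ) : IsCurveFromInfinity γ :=
  ⟨h.lipschitz, h.differentiable, h.start, h.finish⟩

theorem IsMeijerLoop.notMem_meijerPoles {m n p q : ℕ} {a : Fin p → ℂ} {b : Fin q → ℂ} {γ : ℝ → ℂ}
    (h : IsMeijerLoop m n a b γ) (t : ℝ) : γ t ∉ meijerPoles m n a b := by
  rintro (⟨j, hj, k, hk⟩ | ⟨i, hi, k, hk⟩)
  · exact (h.encircles j hj k).1 t hk
  · exact (h.excludes i hi k).1 t hk

/-- The loop condition prescribes the winding number about every point of `meijerPoles m n a b`, so all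
loops give the same integral. -/
theorem IsMeijerLoop.hasMeijerG {m n p : ℕ} {a b : Fin p → ℂ} {γ : ℝ → ℂ}
    (h : IsMeijerLoop m n a b γ) {z : ℂ} (hz : z ≠ 0) (hz₁ : ‖z‖ < 1) :
    HasMeijerG m n a b z
      ((2 * Real.pi * Complex.I)⁻¹ * ∫ t : ℝ, meijerIntegrand m n a b z (γ t) * deriv γ t) := by
  have hd := isGeometricallyDecaying_meijerIntegrand m n a b hz hz₁
  refine ⟨⟨γ, h⟩, fun γ' h' => ⟨hd.integrable h'.isCurveFromInfinity h'.notMem_meijerPoles, ?_⟩⟩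
  rw [hd.integral_eq h'.isCurveFromInfinity h.isCurveFromInfinity]
  rintro w (⟨j, hj, k, rfl⟩ | ⟨i, hi, k, rfl⟩)
  · exact ⟨-1, h'.encircles j hj k, h.encircles j hj k⟩
  · exact ⟨0, h'.excludes i hi k, h.excludes i hi k⟩

theorem HasMeijerG.meijerG_eq {m n p q : ℕ} {a : Fin p → ℂ} {b : Fin q → ℂ} {z v : ℂ}
    (h : HasMeijerG m n a b z v) : meijerG m n a b z = v := by
  have hex : ∃ v, HasMeijerG m n a b z v := ⟨v, h⟩
  rw [meijerG, dif_pos hex]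
  obtain ⟨γ, hγ⟩ := h.1
  rw [← ((Classical.choose_spec hex).2 γ hγ).2, (h.2 γ hγ).2]

/-! ### Hairpin contours -/

/-- The boundary of the half-strip `Re s > c`, `|Im s| < r`, run through clockwise. -/
noncomputable def hairpin (c r t : ℝ) : ℂ :=
  ((c + max (|t| - r) 0 : ℝ) : ℂ) + ((max (-r) (min t r) : ℝ) : ℂ) * Complex.I

section hairpin

variable {c r : ℝ}

theorem hairpin_of_le (hr : 0 < r) {t : ℝ} (ht : t ≤ -r) :
    hairpin c r t = c - r - r * Complex.I - t := by
  rw [hairpin, abs_of_nonpos (by linarith), max_eq_left (by linarith), min_eq_left (by linarith),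
    max_eq_left ht]
  push_cast
  ring

theorem hairpin_of_ge (hr : 0 < r) {t : ℝ} (ht : r ≤ t) :
    hairpin c r t = c - r + r * Complex.I + t := by
  rw [hairpin, abs_of_nonneg (by linarith), max_eq_left (by linarith), min_eq_right ht,
    max_eq_right (by linarith)]
  push_cast
  ring

theorem hairpin_of_abs_le {t : ℝ} (ht : |t| ≤ r) : hairpin c r t = c + t * Complex.I := by
  have := abs_le.mp ht
  rw [hairpin, max_eq_right (by linarith), min_eq_left this.2, max_eq_right this.1]
  simp

theorem hairpin_re_ge (t : ℝ) : c ≤ (hairpin c r t).re := by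
  simp [hairpin]

theorem hairpin_re_eq_or (hr : 0 < r) (t : ℝ) :
    (hairpin c r t).re = c ∨ |(hairpin c r t).im| = r := by
  rcases le_or_gt |t| r with h | h
  · left
    rw [hairpin_of_abs_le h]
    simp
  · right
    rcases lt_abs.mp h with h | h
    · rw [hairpin_of_ge hr h.le]
      simp [abs_of_pos hr]
    · rw [hairpin_of_le hr (by linarith)]
      simp [abs_of_pos hr]

theorem isCurveFromInfinity_hairpin (hr : 0 < r) : IsCurveFromInfinity (hairpin c r) where
  lipschitz := by
    refine ⟨2, LipschitzWith.of_dist_le_mul fun s t => ?_⟩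
    rw [dist_eq_norm, Real.dist_eq]
    refine (Complex.norm_le_abs_re_add_abs_im _).trans ?_
    have h1 : |max (|s| - r) 0 - max (|t| - r) 0| ≤ |s - t| := by
      refine (abs_max_sub_max_le_abs _ _ _).trans ?_
      simpa using abs_abs_sub_abs_le_abs_sub s t
    have h2 : |max (-r) (min s r) - max (-r) (min t r)| ≤ |s - t| := by
      rw [max_comm, max_comm (-r)]
      refine (abs_max_sub_max_le_abs _ _ _).trans ?_
      refine (abs_min_sub_min_le_max _ _ _ _).trans ?_
      simp
    simp only [hairpin, Complex.sub_re, Complex.sub_im, Complex.add_re, Complex.add_im,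
      Complex.ofReal_re, Complex.ofReal_im, Complex.mul_re, Complex.mul_im, Complex.I_re,
      Complex.I_im, mul_zero, mul_one, sub_zero, add_zero, zero_add, add_sub_add_left_eq_sub]
    norm_num
    linarith
  differentiable := by
    refine (Set.toFinite {-r, r}).subset fun t ht => ?_
    by_contra hne
    simp only [Set.mem_insert_iff, Set.mem_singleton_iff, not_or] at hne
    apply ht
    have hd : DifferentiableAt ℝ (fun t : ℝ => (t : ℂ)) t := Complex.ofRealCLM.differentiableAt
    rcases lt_or_gt_of_ne hne.1 with h | h
    · have : hairpin c r =ᶠ[𝓝 t] fun t => c - r - r * Complex.I - t := by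
        filter_upwards [gt_mem_nhds h] with u hu using hairpin_of_le hr (le_of_lt hu)
      exact this.differentiableAt_iff.mpr (hd.const_sub _)
    rcases lt_or_gt_of_ne hne.2 with h' | h'
    · have : hairpin c r =ᶠ[𝓝 t] fun t => c + t * Complex.I := by
        filter_upwards [gt_mem_nhds h', lt_mem_nhds h] with u hu hu'
          using hairpin_of_abs_le (abs_le.mpr ⟨le_of_lt hu', le_of_lt hu⟩)
      exact this.differentiableAt_iff.mpr ((hd.mul_const _).const_add _)
    · have : hairpin c r =ᶠ[𝓝 t] fun t => c - r + r * Complex.I + t := by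
        filter_upwards [lt_mem_nhds h'] with u hu using hairpin_of_ge hr (le_of_lt hu)
      exact this.differentiableAt_iff.mpr (hd.const_add _)
  start := ⟨c - r - r * Complex.I, -r, fun _ ht => hairpin_of_le hr ht⟩
  finish := ⟨c - r + r * Complex.I, r, fun _ ht => hairpin_of_ge hr ht⟩

theorem hairpin_ne_of_im_eq_zero (hr : 0 < r) {w : ℂ} (hw : w.im = 0) (hwc : w.re ≠ c) (t : ℝ) :
    hairpin c r t ≠ w := by
  intro h
  rcases hairpin_re_eq_or (c := c) hr t with h1 | h1
  · exact hwc (by rw [← h, h1])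
  · rw [h, hw, abs_zero] at h1
    exact hr.ne h1

theorem hasWindingNumber_hairpin_of_re_lt (hr : 0 < r) {w : ℂ} (hw : w.im = 0) (hwc : w.re < c) :
    HasWindingNumber (hairpin c r) w 0 := by
  have h := isCurveFromInfinity_hairpin (c := c) hr
  have hne := hairpin_ne_of_im_eq_zero hr hw hwc.ne
  refine ⟨hne, ?_⟩
  have hcont : Continuous fun t => (hairpin c r t - w)⁻¹ :=
    (h.continuous.sub continuous_const).inv₀ fun t => sub_ne_zero.mpr (hne t)
  have h1 : ∀ T : ℝ, ∫ t in (-T)..T, deriv (hairpin c r) t / (hairpin c r t - w) =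
      Complex.log (hairpin c r T - w) - Complex.log (hairpin c r (-T) - w) := by
    intro T
    simp only [div_eq_inv_mul]
    -- the curve stays in `Re s ≥ c > Re w`
    refine h.integral_comp_mul_deriv (L := fun s => Complex.log (s - w))
      (l := fun s => (s - w)⁻¹) (fun t _ => ?_) hcont.continuousOn
    have hsl : hairpin c r t - w ∈ Complex.slitPlane := by
      left
      simpa using hwc.trans_le (hairpin_re_ge t)
    simpa using ((hasDerivAt_id (hairpin c r t)).sub_const w).clog hsl
  have h2 := ((tendsto_log_add_sub_log_add (c - r + r * Complex.I - w)
    (c - r - r * Complex.I - w)).const_mul (2 * Real.pi * Complex.I)⁻¹)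
  rw [mul_zero] at h2
  simp only [Int.cast_zero]
  refine h2.congr' ?_
  filter_upwards [eventually_ge_atTop r] with T hT
  rw [h1, hairpin_of_ge hr hT, hairpin_of_le hr (by linarith)]
  push_cast
  congr 3 <;> ring_nf

theorem log_of_im_pos {x : ℂ} (hx : 0 < x.im) :
    Complex.log x = Complex.log (-x) + Real.pi * Complex.I := by
  rw [Complex.log, Complex.log, Complex.arg_neg_eq_arg_sub_pi_of_im_pos hx, norm_neg]
  push_cast
  ring

theorem log_of_im_neg {x : ℂ} (hx : x.im < 0) :
    Complex.log x = Complex.log (-x) - Real.pi * Complex.I := by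
  rw [Complex.log, Complex.log, Complex.arg_neg_eq_arg_add_pi_of_im_neg hx, norm_neg]
  push_cast
  ring

theorem hasWindingNumber_hairpin_of_lt_re (hr : 0 < r) {w : ℂ} (hw : w.im = 0) (hwc : c < w.re) :
    HasWindingNumber (hairpin c r) w (-1) := by
  have h := isCurveFromInfinity_hairpin (c := c) hr
  have hne := hairpin_ne_of_im_eq_zero hr hw hwc.ne'
  refine ⟨hne, ?_⟩
  have hcont : Continuous fun t => (hairpin c r t - w)⁻¹ :=
    (h.continuous.sub continuous_const).inv₀ fun t => sub_ne_zero.mpr (hne t)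
  -- the curve avoids `[w, ∞)`, so `log (w - s)` is a primitive along all of it
  have h1 : ∀ T : ℝ, ∫ t in (-T)..T, deriv (hairpin c r) t / (hairpin c r t - w) =
      Complex.log (w - hairpin c r T) - Complex.log (w - hairpin c r (-T)) := by
    intro T
    simp only [div_eq_inv_mul]
    refine h.integral_comp_mul_deriv (L := fun s => Complex.log (w - s))
      (l := fun s => (s - w)⁻¹) (fun t _ => ?_) hcont.continuousOn
    have hsl : w - hairpin c r t ∈ Complex.slitPlane := by
      rcases hairpin_re_eq_or (c := c) hr t with h1 | h1
      · left
        simpa [h1] using hwc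
      · right
        intro h2
        simp only [Complex.sub_im, hw, zero_sub, neg_eq_zero] at h2
        rw [h2, abs_zero] at h1
        exact hr.ne h1
    refine (((hasDerivAt_id (hairpin c r t)).const_sub w).clog hsl).congr_deriv ?_
    rw [← neg_sub w, inv_neg, id, neg_div, one_div]
  have h2 := (((tendsto_log_add_sub_log_add (c - r + r * Complex.I - w)
    (c - r - r * Complex.I - w)).sub_const (2 * Real.pi * Complex.I)).const_mul
      (2 * Real.pi * Complex.I)⁻¹)
  rw [zero_sub, mul_neg, inv_mul_cancel₀ Complex.two_pi_I_ne_zero] at h2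
  simp only [Int.cast_neg, Int.cast_one]
  refine h2.congr' ?_
  filter_upwards [eventually_ge_atTop r] with T hT
  rw [h1, hairpin_of_ge hr hT, hairpin_of_le hr (by linarith), log_of_im_neg (x := w - _) (by
    simp [hw, hr]), log_of_im_pos (x := w - _) (by simp [hw, hr])]
  push_cast
  rw [show -(w - (c - r + r * Complex.I + T)) = c - r + r * Complex.I - w + T by ring,
    show -(w - (c - r - r * Complex.I - -T)) = c - r - r * Complex.I - w + T by ring]
  ring

end hairpin

/-! ### Insertion of circles -/

/-- The curve `γ` interrupted at time `t₀` by one positive turn around the circle with centre `w₀`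
and radius `r`, for a curve with `γ t₀ = w₀ - i r`. The formula adds the displacements of the three
parts, so that it needs no case distinction. -/
noncomputable def insertCircle (γ : ℝ → ℂ) (t₀ : ℝ) (w₀ : ℂ) (r t : ℝ) : ℂ :=
  γ (min t t₀) + γ (max (t - 2 * Real.pi) t₀) - 2 * γ t₀ +
    circleMap w₀ r (max (min (t - t₀) (2 * Real.pi)) 0 - Real.pi / 2)

section insertCircle

variable {γ : ℝ → ℂ} {t₀ r : ℝ} {w₀ : ℂ}

theorem insertCircle_of_le (h₀ : γ t₀ = w₀ - r * Complex.I) {t : ℝ} (ht : t ≤ t₀) :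
    insertCircle γ t₀ w₀ r t = γ t := by
  have := Real.pi_pos
  rw [insertCircle, min_eq_left ht, max_eq_right (by linarith), max_eq_right
    ((min_le_left _ _).trans (by linarith)), zero_sub, ← neg_div, circleMap_neg_pi_div_two,
    ← h₀]
  ring

theorem insertCircle_of_mem {t : ℝ} (ht : t₀ ≤ t)
    (ht' : t ≤ t₀ + 2 * Real.pi) :
    insertCircle γ t₀ w₀ r t = circleMap w₀ r (t - t₀ - Real.pi / 2) := by
  rw [insertCircle, min_eq_right ht, max_eq_right (by linarith), min_eq_left (by linarith),
    max_eq_left (by linarith)]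
  ring

theorem insertCircle_of_ge (h₀ : γ t₀ = w₀ - r * Complex.I) {t : ℝ}
    (ht : t₀ + 2 * Real.pi ≤ t) :
    insertCircle γ t₀ w₀ r t = γ (t - 2 * Real.pi) := by
  have hpi := Real.pi_pos
  rw [insertCircle, min_eq_right (by linarith), max_eq_left (by linarith),
    min_eq_right (by linarith), max_eq_left (by linarith), sub_eq_add_neg (2 * Real.pi), add_comm
    (2 * Real.pi), periodic_circleMap w₀ r, ← neg_div, circleMap_neg_pi_div_two, ← h₀]
  ring

theorem range_subset_range_insertCircle (h₀ : γ t₀ = w₀ - r * Complex.I) :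
    Set.range γ ⊆ Set.range (insertCircle γ t₀ w₀ r) := by
  rintro _ ⟨t, rfl⟩
  rcases le_total t t₀ with h | h
  · exact ⟨t, insertCircle_of_le h₀ h⟩
  · refine ⟨t + 2 * Real.pi, ?_⟩
    rw [insertCircle_of_ge h₀ (by linarith)]
    ring_nf

theorem insertCircle_mem (hr : 0 < r) (h₀ : γ t₀ = w₀ - r * Complex.I) (t : ℝ) :
    insertCircle γ t₀ w₀ r t ∈ Set.range γ ∪ Metric.sphere w₀ r := by
  rcases le_total t t₀ with h | h
  · exact Or.inl ⟨t, (insertCircle_of_le h₀ h).symm⟩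
  rcases le_total t (t₀ + 2 * Real.pi) with h' | h'
  · rw [insertCircle_of_mem h h']
    exact Or.inr (circleMap_mem_sphere _ hr.le _)
  · exact Or.inl ⟨t - 2 * Real.pi, (insertCircle_of_ge h₀ h').symm⟩

theorem deriv_insertCircle_of_lt (h₀ : γ t₀ = w₀ - r * Complex.I) {t : ℝ} (ht : t < t₀) :
    deriv (insertCircle γ t₀ w₀ r) t = deriv γ t := by
  refine Filter.EventuallyEq.deriv_eq ?_
  filter_upwards [gt_mem_nhds ht] with u hu using insertCircle_of_le h₀ (le_of_lt hu)

theorem deriv_insertCircle_of_mem {t : ℝ} (ht : t₀ < t)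
    (ht' : t < t₀ + 2 * Real.pi) :
    deriv (insertCircle γ t₀ w₀ r) t = deriv (circleMap w₀ r) (t - t₀ - Real.pi / 2) := by
  have : insertCircle γ t₀ w₀ r =ᶠ[𝓝 t] fun t => circleMap w₀ r (t - (t₀ + Real.pi / 2)) := by
    filter_upwards [gt_mem_nhds ht', lt_mem_nhds ht] with u hu hu'
    rw [insertCircle_of_mem (le_of_lt hu') (le_of_lt hu), sub_sub]
  rw [this.deriv_eq, deriv_comp_sub_const, sub_sub]

theorem deriv_insertCircle_of_gt (h₀ : γ t₀ = w₀ - r * Complex.I) {t : ℝ}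
    (ht : t₀ + 2 * Real.pi < t) :
    deriv (insertCircle γ t₀ w₀ r) t = deriv γ (t - 2 * Real.pi) := by
  have : insertCircle γ t₀ w₀ r =ᶠ[𝓝 t] fun t => γ (t - 2 * Real.pi) := by
    filter_upwards [lt_mem_nhds ht] with u hu using insertCircle_of_ge h₀ (le_of_lt hu)
  rw [this.deriv_eq, deriv_comp_sub_const]

theorem isCurveFromInfinity_insertCircle (h : IsCurveFromInfinity γ)
    (h₀ : γ t₀ = w₀ - r * Complex.I) : IsCurveFromInfinity (insertCircle γ t₀ w₀ r) where
  lipschitz := by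
    obtain ⟨K, hK⟩ := h.lipschitz
    have hc : LipschitzWith (Real.nnabs r) (circleMap w₀ r) := lipschitzWith_circleMap w₀ r
    have hid : LipschitzWith 1 fun t : ℝ => t := LipschitzWith.id
    refine ⟨_, (((hK.comp (hid.min_const t₀)).add (hK.comp
      ((hid.sub (LipschitzWith.const (2 * Real.pi))).max_const t₀))).sub
        (LipschitzWith.const (2 * γ t₀))).add (hc.comp (((((hid.sub (LipschitzWith.const t₀)).min_const
          (2 * Real.pi)).max_const 0).sub (LipschitzWith.const (Real.pi / 2)))))⟩
  differentiable := by
    refine ((h.differentiable.union (h.differentiable.image fun t => t + 2 * Real.pi)).union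
      (Set.toFinite {t₀, t₀ + 2 * Real.pi})).subset fun t ht => ?_
    by_contra hne
    simp only [Set.mem_union, Set.mem_insert_iff, Set.mem_singleton_iff, not_or] at hne
    obtain ⟨⟨h1, h2⟩, h3, h4⟩ := hne
    apply ht
    rcases lt_or_gt_of_ne h3 with h5 | h5
    · have : insertCircle γ t₀ w₀ r =ᶠ[𝓝 t] γ := by
        filter_upwards [gt_mem_nhds h5] with u hu using insertCircle_of_le h₀ (le_of_lt hu)
      exact this.differentiableAt_iff.mpr (not_not.mp h1)
    rcases lt_or_gt_of_ne h4 with h6 | h6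
    · have : insertCircle γ t₀ w₀ r =ᶠ[𝓝 t] fun t => circleMap w₀ r (t - t₀ - Real.pi / 2) := by
        filter_upwards [gt_mem_nhds h6, lt_mem_nhds h5] with u hu hu'
          using insertCircle_of_mem (le_of_lt hu') (le_of_lt hu)
      refine this.differentiableAt_iff.mpr ?_
      exact (differentiable_circleMap w₀ r _).comp t (by fun_prop)
    · have : insertCircle γ t₀ w₀ r =ᶠ[𝓝 t] fun t => γ (t - 2 * Real.pi) := by
        filter_upwards [lt_mem_nhds h6] with u hu using insertCircle_of_ge h₀ (le_of_lt hu)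
      refine this.differentiableAt_iff.mpr ?_
      have h7 : DifferentiableAt ℝ γ (t - 2 * Real.pi) := by
        by_contra h7
        exact h2 ⟨_, h7, by ring⟩
      exact h7.comp t (by fun_prop)
  start := by
    obtain ⟨c, T, hs⟩ := h.start
    refine ⟨c, min T t₀, fun t ht => ?_⟩
    rw [insertCircle_of_le h₀ (ht.trans (min_le_right _ _)), hs t (ht.trans (min_le_left _ _))]
  finish := by
    obtain ⟨c, T, hf⟩ := h.finish
    refine ⟨c - 2 * Real.pi, max T t₀ + 2 * Real.pi, fun t ht => ?_⟩
    have h1 := le_max_left T t₀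
    have h2 := le_max_right T t₀
    rw [insertCircle_of_ge h₀ (by linarith), hf _ (by linarith)]
    push_cast
    ring

theorem intervalIntegral_insertCircle (h : IsCurveFromInfinity γ)
    (h₀ : γ t₀ = w₀ - r * Complex.I) {f : ℂ → ℂ} (hf : Continuous fun t => f (γ t))
    (hf' : Continuous fun t => f (insertCircle γ t₀ w₀ r t)) {α β : ℝ} (hα : α ≤ t₀) (hβ : t₀ ≤ β) :
    ∫ t in α..(β + 2 * Real.pi), f (insertCircle γ t₀ w₀ r t) * deriv (insertCircle γ t₀ w₀ r) t =
      (∫ t in α..β, f (γ t) * deriv γ t) + circleIntegral f w₀ r := by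
  have hpi := Real.pi_pos
  have h' := isCurveFromInfinity_insertCircle h h₀
  have hint : ∀ a b, IntervalIntegrable (fun t => f (γ t) * deriv γ t) MeasureTheory.volume a b :=
    fun a b => h.intervalIntegrable_mul_deriv hf.continuousOn
  have hint' : ∀ a b, IntervalIntegrable
      (fun t => f (insertCircle γ t₀ w₀ r t) * deriv (insertCircle γ t₀ w₀ r) t)
      MeasureTheory.volume a b :=
    fun a b => h'.intervalIntegrable_mul_deriv hf'.continuousOn
  have e1 : ∫ t in α..t₀, f (insertCircle γ t₀ w₀ r t) * deriv (insertCircle γ t₀ w₀ r) t =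
      ∫ t in α..t₀, f (γ t) * deriv γ t := by
    refine intervalIntegral.integral_congr_Ioo_of_le hα fun t ht => ?_
    rw [insertCircle_of_le h₀ ht.2.le, deriv_insertCircle_of_lt h₀ ht.2]
  have e2 : ∫ t in t₀..(t₀ + 2 * Real.pi),
      f (insertCircle γ t₀ w₀ r t) * deriv (insertCircle γ t₀ w₀ r) t = circleIntegral f w₀ r := by
    have hper : Function.Periodic (fun θ : ℝ => deriv (circleMap w₀ r) θ • f (circleMap w₀ r θ))
        (2 * Real.pi) := by
      intro θ
      simp only [deriv_circleMap, periodic_circleMap w₀ r θ, periodic_circleMap 0 r θ]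
    calc _ = ∫ t in t₀..(t₀ + 2 * Real.pi), (fun θ : ℝ => deriv (circleMap w₀ r) θ •
          f (circleMap w₀ r θ)) (t - (t₀ + Real.pi / 2)) := by
          refine intervalIntegral.integral_congr_Ioo_of_le (by linarith) fun t ht => ?_
          simp only
          rw [insertCircle_of_mem ht.1.le ht.2.le, deriv_insertCircle_of_mem ht.1 ht.2,
            sub_sub, smul_eq_mul, mul_comm]
      _ = ∫ θ in (-(Real.pi / 2))..(-(Real.pi / 2) + 2 * Real.pi),
          deriv (circleMap w₀ r) θ • f (circleMap w₀ r θ) := by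
          rw [intervalIntegral.integral_comp_sub_right (fun θ : ℝ => deriv (circleMap w₀ r) θ •
            f (circleMap w₀ r θ))]
          congr 1 <;> ring
      _ = _ := by
          rw [hper.intervalIntegral_add_eq _ 0, zero_add, circleIntegral]
  have e3 : ∫ t in (t₀ + 2 * Real.pi)..(β + 2 * Real.pi),
      f (insertCircle γ t₀ w₀ r t) * deriv (insertCircle γ t₀ w₀ r) t =
      ∫ t in t₀..β, f (γ t) * deriv γ t := by
    calc _ = ∫ t in (t₀ + 2 * Real.pi)..(β + 2 * Real.pi),
          (fun t => f (γ t) * deriv γ t) (t - 2 * Real.pi) := by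
          refine intervalIntegral.integral_congr_Ioo_of_le (by linarith) fun t ht => ?_
          simp only
          rw [insertCircle_of_ge h₀ ht.1.le, deriv_insertCircle_of_gt h₀ ht.1]
      _ = _ := by
          rw [intervalIntegral.integral_comp_sub_right (fun t => f (γ t) * deriv γ t)]
          simp
  rw [← intervalIntegral.integral_add_adjacent_intervals (hint' α (t₀ + 2 * Real.pi)) (hint' _ _),
    ← intervalIntegral.integral_add_adjacent_intervals (hint' α t₀) (hint' _ _), e1, e2, e3,
    ← intervalIntegral.integral_add_adjacent_intervals (hint α t₀) (hint _ β)]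
  ring

theorem integral_insertCircle (h : IsCurveFromInfinity γ)
    (h₀ : γ t₀ = w₀ - r * Complex.I) {f : ℂ → ℂ} (hf : Continuous fun t => f (γ t))
    (hf' : Continuous fun t => f (insertCircle γ t₀ w₀ r t))
    (hi : MeasureTheory.Integrable fun t => f (γ t) * deriv γ t)
    (hi' : MeasureTheory.Integrable fun t =>
      f (insertCircle γ t₀ w₀ r t) * deriv (insertCircle γ t₀ w₀ r) t) :
    ∫ t, f (insertCircle γ t₀ w₀ r t) * deriv (insertCircle γ t₀ w₀ r) t =
      (∫ t, f (γ t) * deriv γ t) + circleIntegral f w₀ r := by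
  have l1 := (MeasureTheory.intervalIntegral_tendsto_integral hi tendsto_neg_atTop_atBot
    tendsto_id).add_const (circleIntegral f w₀ r)
  have l2 := MeasureTheory.intervalIntegral_tendsto_integral hi' tendsto_neg_atTop_atBot
    (tendsto_atTop_add_const_right atTop (2 * Real.pi) tendsto_id)
  refine tendsto_nhds_unique l2 (l1.congr' ?_)
  filter_upwards [eventually_ge_atTop t₀, eventually_ge_atTop (-t₀)] with T h1 h2
  exact (intervalIntegral_insertCircle h h₀ hf hf' (by linarith) h1).symm

/-- Shifting the upper end of the interval of integration by a fixed amount does not affect winding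
numbers. A circle inserted into the curve delays its last part by `2π`. -/
theorem IsCurveFromInfinity.tendsto_integral_inv_sub_tail (h : IsCurveFromInfinity γ) (w : ℂ)
    (d : ℝ) : Tendsto (fun T => ∫ t in T..(T + d), (γ t - w)⁻¹ * deriv γ t) atTop (𝓝 0) := by
  obtain ⟨K, hK⟩ := h.exists_norm_deriv_le
  obtain ⟨c, T₀, hf⟩ := h.finish
  have hlim : Tendsto (fun T : ℝ => (T - |d| + (c - w).re)⁻¹ * K * |d|) atTop (𝓝 0) := by
    have : Tendsto (fun T : ℝ => T - |d| + (c - w).re) atTop atTop :=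
      tendsto_atTop_add_const_right _ _ (tendsto_atTop_add_const_right _ _ tendsto_id)
    simpa using (this.inv_tendsto_atTop.mul_const K).mul_const |d|
  refine squeeze_zero_norm' ?_ hlim
  filter_upwards [eventually_ge_atTop (T₀ + |d|), eventually_gt_atTop (|d| - (c - w).re)]
    with T h1 h2
  have := intervalIntegral.norm_integral_le_of_norm_le_const (a := T) (b := T + d)
    (f := fun t => (γ t - w)⁻¹ * deriv γ t) (C := (T - |d| + (c - w).re)⁻¹ * K) (fun t ht => by
      have ht' : T - |d| ≤ t := by
        have h3 := (Set.uIoc_subset_uIcc ht).1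
        refine le_trans (le_min (by linarith [abs_nonneg d]) ?_) h3
        linarith [neg_abs_le d]
      rw [norm_mul, norm_inv]
      have h4 : T - |d| + (c - w).re ≤ ‖γ t - w‖ := by
        rw [hf t (by linarith)]
        refine le_trans ?_ (Complex.re_le_norm _)
        simp
        linarith
      have h5 : 0 < T - |d| + (c - w).re := by linarith
      exact mul_le_mul (inv_anti₀ h5 h4) (hK t) (norm_nonneg _) (inv_nonneg.mpr h5.le))
  simpa using this

theorem hasWindingNumber_insertCircle (h : IsCurveFromInfinity γ) (hr : 0 < r)
    (h₀ : γ t₀ = w₀ - r * Complex.I) {w : ℂ} {k l : ℤ} (hk : HasWindingNumber γ w k)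
    (hw : w ∉ Metric.sphere w₀ r)
    (hl : circleIntegral (fun s => (s - w)⁻¹) w₀ r = 2 * Real.pi * Complex.I * l) :
    HasWindingNumber (insertCircle γ t₀ w₀ r) w (k + l) := by
  have h' := isCurveFromInfinity_insertCircle h h₀
  have hne : ∀ t, insertCircle γ t₀ w₀ r t ≠ w := by
    intro t ht
    rcases insertCircle_mem hr h₀ t with ⟨u, hu⟩ | hu
    · exact hk.1 u (hu.trans ht)
    · exact hw (ht ▸ hu)
  refine ⟨hne, ?_⟩
  have hf : Continuous fun t => (γ t - w)⁻¹ :=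
    (h.continuous.sub continuous_const).inv₀ fun t => sub_ne_zero.mpr (hk.1 t)
  have hf' : Continuous fun t => (insertCircle γ t₀ w₀ r t - w)⁻¹ :=
    (h'.continuous.sub continuous_const).inv₀ fun t => sub_ne_zero.mpr (hne t)
  have l1 := hk.2
  have l2 := (h'.tendsto_integral_inv_sub_tail w (2 * Real.pi)).const_mul
    (2 * Real.pi * Complex.I)⁻¹
  have l3 := (l1.add_const (l : ℂ)).sub l2
  simp only [mul_zero, sub_zero] at l3
  push_cast
  refine l3.congr' ?_
  filter_upwards [eventually_ge_atTop t₀, eventually_ge_atTop (-t₀)] with T h1 h2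
  have e := intervalIntegral_insertCircle (f := fun s => (s - w)⁻¹) h h₀ hf hf'
    (α := -T) (β := T) (by linarith) h1
  rw [← intervalIntegral.integral_add_adjacent_intervals (b := T)
    (h'.intervalIntegrable_mul_deriv hf'.continuousOn)
    (h'.intervalIntegrable_mul_deriv hf'.continuousOn), hl] at e
  simp only [div_eq_inv_mul]
  have h0 := Complex.two_pi_I_ne_zero
  have e' := eq_sub_of_add_eq e
  rw [e', mul_sub, mul_add, inv_mul_cancel_left₀ h0]

end insertCircle

/-- Circles with centres on the axis of a hairpin and radius equal to its half-width touch its lower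
edge, and can be inserted there. -/
theorem exists_hairpin_with_circles {c r : ℝ} (hr : 0 < r) (S : Finset ℂ)
    (hS : ∀ v ∈ S, v.im = 0 ∧ c ≤ v.re) :
    ∃ γ : ℝ → ℂ, IsCurveFromInfinity γ ∧ Set.range (hairpin c r) ⊆ Set.range γ ∧
      (∀ w : ℂ, w.im = 0 → w.re ≠ c → (∀ v ∈ S, dist w v ≠ r) →
        HasWindingNumber γ w
          ((if c < w.re then -1 else 0) + ∑ v ∈ S, if dist w v < r then 1 else 0)) ∧
      ∀ (P : Set ℂ) (f : ℂ → ℂ), IsGeometricallyDecaying P f →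
        (∀ w ∈ P, w.im = 0 ∧ w.re ≠ c ∧ ∀ v ∈ S, dist w v ≠ r) →
        ∫ t, f (γ t) * deriv γ t =
          (∫ t, f (hairpin c r t) * deriv (hairpin c r) t) + ∑ v ∈ S, circleIntegral f v r := by
  classical
  induction S using Finset.induction_on with
  | empty =>
    refine ⟨hairpin c r, isCurveFromInfinity_hairpin hr, subset_rfl, fun w h1 h2 _ => ?_, by simp⟩
    split_ifs with h
    · simpa using hasWindingNumber_hairpin_of_lt_re hr h1 h
    · simpa using hasWindingNumber_hairpin_of_re_lt hr h1 (lt_of_le_of_ne (not_lt.mp h) h2)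
  | insert v S hv ih =>
    obtain ⟨γ, hγ, hrange, hwind, hint⟩ := ih fun u hu => hS u (Finset.mem_insert_of_mem hu)
    obtain ⟨hv₀, hvc⟩ := hS v (Finset.mem_insert_self _ _)
    obtain ⟨t₀, h₀⟩ : ∃ t₀, γ t₀ = v - r * Complex.I := by
      refine hrange ⟨c - r - v.re, ?_⟩
      rw [hairpin_of_le hr (by linarith)]
      apply Complex.ext <;> simp [hv₀]
    have hcurve := isCurveFromInfinity_insertCircle hγ h₀
    have hwind' : ∀ w : ℂ, w.im = 0 → w.re ≠ c → (∀ u ∈ insert v S, dist w u ≠ r) →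
        HasWindingNumber (insertCircle γ t₀ v r) w
          ((if c < w.re then -1 else 0) + ∑ u ∈ insert v S, if dist w u < r then 1 else 0) := by
      intro w h1 h2 h3
      have h4 := hwind w h1 h2 fun u hu => h3 u (Finset.mem_insert_of_mem hu)
      rw [Finset.sum_insert hv, add_comm (ite _ _ _) (∑ _ ∈ S, _), ← add_assoc]
      refine hasWindingNumber_insertCircle hγ hr h₀ h4 (h3 v (Finset.mem_insert_self _ _)) ?_
      split_ifs with h5
      · rw [circleIntegral.integral_sub_inv_of_mem_ball h5]
        simp
      · have h6 : ∀ s ∈ Metric.closedBall v r, s - w ≠ 0 := fun s hs h => by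
          rw [sub_eq_zero] at h
          rw [h, Metric.mem_closedBall] at hs
          exact h5 (lt_of_le_of_ne hs (h3 v (Finset.mem_insert_self _ _)))
        rw [Complex.circleIntegral_eq_zero_of_differentiable_on_off_countable hr.le
          Set.countable_empty]
        · simp
        · exact ContinuousOn.inv₀ (by fun_prop) h6
        · intro s hs
          exact DifferentiableAt.fun_inv (by fun_prop) (h6 s (Metric.ball_subset_closedBall hs.1))
    refine ⟨insertCircle γ t₀ v r, hcurve, hrange.trans (range_subset_range_insertCircle h₀),
      hwind', fun P f hf hP => ?_⟩
    have hne : ∀ t, γ t ∉ P := fun t ht => by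
      obtain ⟨h1, h2, h3⟩ := hP _ ht
      exact (hwind _ h1 h2 fun u hu => h3 u (Finset.mem_insert_of_mem hu)).1 t rfl
    have hne' : ∀ t, insertCircle γ t₀ v r t ∉ P := fun t ht => by
      obtain ⟨h1, h2, h3⟩ := hP _ ht
      exact (hwind' _ h1 h2 h3).1 t rfl
    have hc : Continuous fun t => f (γ t) := continuous_iff_continuousAt.mpr fun t =>
      (hf.differentiableAt _ (hne t)).continuousAt.comp hγ.continuous.continuousAt
    have hc' : Continuous fun t => f (insertCircle γ t₀ v r t) :=
      continuous_iff_continuousAt.mpr fun t =>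
        (hf.differentiableAt _ (hne' t)).continuousAt.comp hcurve.continuous.continuousAt
    rw [integral_insertCircle hγ h₀ hc hc' (hf.integrable hγ hne) (hf.integrable hcurve hne'),
      hint P f hf fun w hw => ⟨(hP w hw).1, (hP w hw).2.1, fun u hu =>
        (hP w hw).2.2 u (Finset.mem_insert_of_mem hu)⟩, Finset.sum_insert hv]
    ring

/-! ### Growth of quotients of Gamma functions -/

theorem norm_betaIntegral_le_one {u v : ℂ} (hu : 1 ≤ u.re) (hv : 1 ≤ v.re) :
    ‖Complex.betaIntegral u v‖ ≤ 1 := by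
  rw [Complex.betaIntegral]
  have := intervalIntegral.norm_integral_le_of_norm_le_const (a := 0) (b := 1) (C := 1)
    (f := fun x : ℝ => (x : ℂ) ^ (u - 1) * (1 - (x : ℂ)) ^ (v - 1)) (fun x hx => by
      rw [Set.uIoc_of_le zero_le_one] at hx
      rcases eq_or_lt_of_le hx.2 with rfl | h1
      · by_cases hv1 : v - 1 = 0
        · simp [hv1]
        · simp [Complex.zero_cpow hv1]
      have e : (1 - (x : ℂ)) = ((1 - x : ℝ) : ℂ) := by push_cast; ring
      rw [e, norm_mul, Complex.norm_cpow_eq_rpow_re_of_pos hx.1,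
        Complex.norm_cpow_eq_rpow_re_of_pos (by linarith)]
      refine mul_le_one₀ (Real.rpow_le_one hx.1.le hx.2 (by simpa using hu))
        (by have : 0 ≤ 1 - x := by linarith
            positivity)
        (Real.rpow_le_one (by linarith) (by linarith [hx.1]) (by simpa using hv)))
  simpa using this

/-- On a right half-plane the quotient `Γ(α + s) / Γ(β + s)` is a Beta integral if `β ≥ α + 1`, and
differs from one by a polynomial factor otherwise. -/
theorem exists_norm_Gamma_mul_inv_Gamma_le_right (α β : ℝ) : ∃ (C : ℝ) (N : ℕ), 0 ≤ C ∧
    ∀ s : ℂ, 1 ≤ α + s.re →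
      ‖Complex.Gamma (α + s) * (Complex.Gamma (β + s))⁻¹‖ ≤ C * (1 + ‖s‖) ^ N := by
  obtain ⟨n, hn⟩ := exists_nat_ge (α + 1 - β)
  induction n generalizing β with
  | zero =>
    have hβ : 1 ≤ β - α := by
      simp only [Nat.cast_zero] at hn
      linarith
    refine ⟨‖(Complex.Gamma ((β - α : ℝ) : ℂ))⁻¹‖, 0, norm_nonneg _, fun s hs => ?_⟩
    have h1 := Complex.Gamma_mul_Gamma_eq_betaIntegral (s := α + s) (t := ((β - α : ℝ) : ℂ))
      (by simp; linarith) (by rw [Complex.ofReal_re]; linarith)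
    have e : (α : ℂ) + s + ((β - α : ℝ) : ℂ) = β + s := by push_cast; ring
    rw [e] at h1
    have h2 : Complex.Gamma (β + s) ≠ 0 := Complex.Gamma_ne_zero_of_re_pos (by simp; linarith)
    have h3 : Complex.Gamma ((β - α : ℝ) : ℂ) ≠ 0 :=
      Complex.Gamma_ne_zero_of_re_pos (by rw [Complex.ofReal_re]; linarith)
    have h4 : Complex.Gamma (α + s) * (Complex.Gamma (β + s))⁻¹ =
        (Complex.Gamma ((β - α : ℝ) : ℂ))⁻¹ * Complex.betaIntegral (α + s) ((β - α : ℝ) : ℂ) := by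
      field_simp
      linear_combination h1
    rw [h4, norm_mul, pow_zero, mul_one]
    exact mul_le_of_le_one_right (norm_nonneg _)
      (norm_betaIntegral_le_one (by simpa using hs) (by rwa [Complex.ofReal_re]))
  | succ n ih =>
    obtain ⟨C, N, hC, h⟩ := ih (β + 1) (by push_cast at hn; linarith)
    refine ⟨C * (1 + |β|), N + 1, by positivity, fun s hs => ?_⟩
    have h1 := h s hs
    rw [Complex.one_div_Gamma_eq_self_mul_one_div_Gamma_add_one (β + s)]
    have e : (β : ℂ) + s + 1 = ((β + 1 : ℝ) : ℂ) + s := by push_cast; ring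
    have h2 : ‖(β : ℂ) + s‖ ≤ (1 + |β|) * (1 + ‖s‖) := by
      refine (norm_add_le _ _).trans ?_
      rw [Complex.norm_real, Real.norm_eq_abs]
      nlinarith [abs_nonneg β, norm_nonneg s]
    rw [e, mul_left_comm, norm_mul]
    calc _ ≤ ((1 + |β|) * (1 + ‖s‖)) * (C * (1 + ‖s‖) ^ N) := by gcongr
      _ = _ := by ring

/-- Reduction to `α ≥ 1`: as `|α + s| ≥ |Im s| ≥ 1`, replacing `Γ(α + s)` by
`Γ(α + 1 + s) = (α + s) Γ(α + s)` can only increase the quotient. -/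
theorem exists_norm_Gamma_mul_inv_Gamma_le_of_re_nonneg (α β : ℝ) : ∃ (C : ℝ) (N : ℕ), 0 ≤ C ∧
    ∀ s : ℂ, 0 ≤ s.re → 1 ≤ |s.im| →
      ‖Complex.Gamma (α + s) * (Complex.Gamma (β + s))⁻¹‖ ≤ C * (1 + ‖s‖) ^ N := by
  obtain ⟨n, hn⟩ := exists_nat_ge (1 - α)
  induction n generalizing α with
  | zero =>
    simp only [Nat.cast_zero] at hn
    obtain ⟨C, N, hC, h⟩ := exists_norm_Gamma_mul_inv_Gamma_le_right α β
    exact ⟨C, N, hC, fun s hs _ => h s (by linarith)⟩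
  | succ n ih =>
    obtain ⟨C, N, hC, h⟩ := ih (α + 1) (by push_cast at hn; linarith)
    refine ⟨C, N, hC, fun s hs hs' => le_trans ?_ (h s hs hs')⟩
    have h1 : 1 ≤ ‖(α : ℂ) + s‖ := by
      refine hs'.trans ?_
      have := Complex.abs_im_le_norm ((α : ℂ) + s)
      simpa using this
    have h2 : (α : ℂ) + s ≠ 0 := fun h0 => by
      rw [h0, norm_zero] at h1
      linarith
    have e : ((α + 1 : ℝ) : ℂ) + s = α + s + 1 := by push_cast; ring
    rw [norm_mul, norm_mul, e, Complex.Gamma_add_one _ h2, norm_mul]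
    refine mul_le_mul_of_nonneg_right ?_ (norm_nonneg _)
    exact le_mul_of_one_le_left (norm_nonneg _) h1

theorem norm_sin_le (w : ℂ) : ‖Complex.sin w‖ ≤ Real.exp |w.im| := by
  rw [Complex.sin, norm_div, norm_mul, Complex.norm_I, mul_one, Complex.norm_ofNat,
    div_le_iff₀ two_pos]
  refine (norm_sub_le _ _).trans ?_
  rw [Complex.norm_exp, Complex.norm_exp]
  have h1 : Real.exp (-w * Complex.I).re ≤ Real.exp |w.im| :=
    Real.exp_le_exp.mpr (by simpa using le_abs_self _)
  have h2 : Real.exp (w * Complex.I).re ≤ Real.exp |w.im| :=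
    Real.exp_le_exp.mpr (by simpa using neg_le_abs _)
  linarith

theorem le_norm_sin {w : ℂ} (hw : 1 ≤ |w.im|) : Real.exp |w.im| / 4 ≤ ‖Complex.sin w‖ := by
  rw [Complex.sin, norm_div, norm_mul, Complex.norm_I, mul_one, Complex.norm_ofNat,
    le_div_iff₀ two_pos]
  have h1 : Real.exp (-|w.im|) ≤ Real.exp |w.im| / 2 := by
    rw [Real.exp_neg, inv_eq_one_div, div_le_div_iff₀ (Real.exp_pos _) two_pos]
    nlinarith [Real.add_one_le_exp |w.im|]
  have h2 : ‖Complex.exp (-w * Complex.I)‖ = Real.exp w.im := by simp [Complex.norm_exp]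
  have h3 : ‖Complex.exp (w * Complex.I)‖ = Real.exp (-w.im) := by simp [Complex.norm_exp]
  rcases abs_cases w.im with ⟨h, _⟩ | ⟨h, _⟩
  · have := norm_sub_norm_le (Complex.exp (-w * Complex.I)) (Complex.exp (w * Complex.I))
    rw [h2, h3] at this
    rw [h] at h1 ⊢
    linarith
  · have := norm_sub_norm_le (Complex.exp (w * Complex.I)) (Complex.exp (-w * Complex.I))
    rw [h2, h3, norm_sub_rev] at this
    rw [h, neg_neg] at h1
    rw [h]
    linarith

/-- Away from the real axis the quotient `Γ(α + s) / Γ(β + s)` grows at most like a power of `s`; in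
the left half-plane this follows by reflection. -/
theorem exists_norm_Gamma_mul_inv_Gamma_le (α β : ℝ) : ∃ (C : ℝ) (N : ℕ), 0 ≤ C ∧
    ∀ s : ℂ, 1 ≤ |s.im| →
      ‖Complex.Gamma (α + s) * (Complex.Gamma (β + s))⁻¹‖ ≤ C * (1 + ‖s‖) ^ N := by
  obtain ⟨C₁, N₁, hC₁, h₁⟩ := exists_norm_Gamma_mul_inv_Gamma_le_of_re_nonneg α β
  obtain ⟨C₂, N₂, hC₂, h₂⟩ := exists_norm_Gamma_mul_inv_Gamma_le_of_re_nonneg (1 - β) (1 - α)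
  refine ⟨C₁ + 4 * C₂, N₁ + N₂, by positivity, fun s hs => ?_⟩
  have hone : 1 ≤ 1 + ‖s‖ := by linarith [norm_nonneg s]
  have hp1 : (1 + ‖s‖) ^ N₁ ≤ (1 + ‖s‖) ^ (N₁ + N₂) := pow_le_pow_right₀ hone (by omega)
  have hp2 : (1 + ‖s‖) ^ N₂ ≤ (1 + ‖s‖) ^ (N₁ + N₂) := pow_le_pow_right₀ hone (by omega)
  have hp0 : 0 ≤ (1 + ‖s‖) ^ (N₁ + N₂) := by positivity
  rcases le_total 0 s.re with h | h
  · refine (h₁ s h hs).trans ?_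
    nlinarith [mul_le_mul_of_nonneg_left hp1 hC₁, mul_nonneg hC₂ hp0]
  · have h3 := h₂ (-s) (by simpa using h) (by simpa using hs)
    rw [norm_neg] at h3
    have him : ∀ x : ℝ, (Real.pi * ((x : ℂ) + s)).im = Real.pi * s.im := by intro x; simp
    have hpi : 1 ≤ |Real.pi * s.im| := by
      rw [abs_mul, abs_of_pos Real.pi_pos]
      nlinarith [Real.pi_gt_three]
    have hα := le_norm_sin (w := Real.pi * ((α : ℂ) + s)) (by rwa [him])
    have hβ := norm_sin_le (Real.pi * ((β : ℂ) + s))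
    rw [him] at hα hβ
    have hsα : Complex.sin (Real.pi * ((α : ℂ) + s)) ≠ 0 := fun h0 => by
      rw [h0, norm_zero] at hα
      linarith [Real.exp_pos |Real.pi * s.im|]
    have hsβ : Complex.sin (Real.pi * ((β : ℂ) + s)) ≠ 0 := fun h0 => by
      have := le_norm_sin (w := Real.pi * ((β : ℂ) + s)) (by rwa [him])
      rw [h0, norm_zero] at this
      linarith [Real.exp_pos |(Real.pi * ((β : ℂ) + s)).im|]
    have rα := Complex.Gamma_mul_Gamma_one_sub ((α : ℂ) + s)
    have rβ := Complex.Gamma_mul_Gamma_one_sub ((β : ℂ) + s)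
    have hpi0 : (Real.pi : ℂ) ≠ 0 := by exact_mod_cast Real.pi_ne_zero
    have gα : Complex.Gamma (1 - ((α : ℂ) + s)) ≠ 0 := fun h0 => by
      rw [h0, mul_zero] at rα
      exact div_ne_zero hpi0 hsα rα.symm
    have gβ : Complex.Gamma ((β : ℂ) + s) ≠ 0 := fun h0 => by
      rw [h0, zero_mul] at rβ
      exact div_ne_zero hpi0 hsβ rβ.symm
    have key : Complex.Gamma (α + s) * (Complex.Gamma (β + s))⁻¹ =
        Complex.Gamma (((1 - β : ℝ) : ℂ) + -s) * (Complex.Gamma (((1 - α : ℝ) : ℂ) + -s))⁻¹ *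
          (Complex.sin (Real.pi * ((β : ℂ) + s)) / Complex.sin (Real.pi * ((α : ℂ) + s))) := by
      have e1 : ((1 - β : ℝ) : ℂ) + -s = 1 - ((β : ℂ) + s) := by push_cast; ring
      have e2 : ((1 - α : ℝ) : ℂ) + -s = 1 - ((α : ℂ) + s) := by push_cast; ring
      rw [e1, e2]
      rw [eq_div_iff hsα] at rα
      rw [eq_div_iff hsβ] at rβ
      generalize Complex.sin (Real.pi * ((α : ℂ) + s)) = σ at rα hsα ⊢
      generalize Complex.sin (Real.pi * ((β : ℂ) + s)) = τ at rβ hsβ ⊢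
      field_simp
      linear_combination rα - rβ
    rw [key, norm_mul, norm_div]
    have hq : ‖Complex.sin (Real.pi * ((β : ℂ) + s))‖ / ‖Complex.sin (Real.pi * ((α : ℂ) + s))‖ ≤
        4 := by
      rw [div_le_iff₀ (norm_pos_iff.mpr hsα)]
      linarith
    calc _ ≤ C₂ * (1 + ‖s‖) ^ N₂ * 4 := by gcongr
      _ ≤ _ := by nlinarith [mul_le_mul_of_nonneg_left hp2 hC₂, mul_nonneg hC₁ hp0]

theorem exists_one_add_pow_le_exp (N : ℕ) {ε : ℝ} (hε : 0 < ε) :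
    ∃ C : ℝ, 0 ≤ C ∧ ∀ x : ℝ, 0 ≤ x → (1 + x) ^ N ≤ C * Real.exp (ε * x) := by
  set η := ε / (N + 1) with hη
  have hη0 : 0 < η := by positivity
  refine ⟨(1 + 1 / η) ^ N, by positivity, fun x hx => ?_⟩
  have h1 : 1 + x ≤ (1 + 1 / η) * Real.exp (η * x) := by
    have h2 := Real.add_one_le_exp (η * x)
    have h3 : (1 + 1 / η) * (η * x + 1) ≤ (1 + 1 / η) * Real.exp (η * x) := by gcongr
    refine le_trans ?_ h3
    have h4 : (1 + 1 / η) * (η * x + 1) = 1 + x + η * x + 1 / η := by field_simp; ring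
    rw [h4]
    have : 0 < 1 / η := by positivity
    nlinarith
  calc (1 + x) ^ N ≤ ((1 + 1 / η) * Real.exp (η * x)) ^ N := by gcongr
    _ = (1 + 1 / η) ^ N * Real.exp (N * (η * x)) := by rw [mul_pow, ← Real.exp_nat_mul]
    _ ≤ _ := by
      have h5 : N * (η * x) ≤ ε * x := by
        have h6 : ε = (N + 1) * η := by rw [hη]; field_simp
        rw [h6]
        nlinarith [mul_nonneg hη0.le hx]
      gcongr

/-! ### The kernel of the Barnes integral -/

/-- The factor `Γ(s) ∏ Γ(a_i - s) / ∏ Γ(b_j - s)` of the integrand in Barnes's integral for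
`ₚ₊₁Fₚ(a; b; ·)`. -/
noncomputable def barnesKernel {p : ℕ} (a : Fin (p + 1) → ℂ) (b : Fin p → ℂ) (s : ℂ) : ℂ :=
  Complex.Gamma s * (∏ i, Complex.Gamma (a i - s)) * ∏ j, (Complex.Gamma (b j - s))⁻¹

/-- Up to a power of `s`, hence up to factors `exp (ε |Im s|)` and `exp (l |Re s|)`, the kernel decays
like `1 / sin (π s)`. -/
theorem exists_norm_barnesKernel_le {p : ℕ} (a : Fin (p + 1) → ℝ) (b : Fin p → ℝ) {δ l : ℝ}
    (hδ : δ < Real.pi) (hl : 0 < l) : ∃ C : ℝ, 0 ≤ C ∧ ∀ s : ℂ, 1 ≤ |s.im| →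
      ‖barnesKernel (fun i => (a i : ℂ)) (fun j => (b j : ℂ)) s‖ ≤
        C * Real.exp (-δ * |s.im|) * Real.exp (l * |s.re|) := by
  -- the `p + 1` upper parameters are paired with `1` and the lower parameters; by reflection
  -- `Γ(s) = π / (sin (π s) Γ(1 - s))`, which supplies the denominator for `1`
  choose C N hC h using fun i : Fin (p + 1) =>
    exists_norm_Gamma_mul_inv_Gamma_le (a i) (Fin.cons (α := fun _ => ℝ) 1 b i)
  obtain ⟨A, hA, hA'⟩ := exists_one_add_pow_le_exp (∑ i, N i) (sub_pos.mpr hδ)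
  obtain ⟨B, hB, hB'⟩ := exists_one_add_pow_le_exp (∑ i, N i) hl
  have hCp : 0 ≤ ∏ i, C i := Finset.prod_nonneg fun i _ => hC i
  refine ⟨4 * Real.pi * (∏ i, C i) * A * B, by positivity, fun s hs => ?_⟩
  have hpi := Real.pi_pos
  have hpis : 1 ≤ |(Real.pi * s).im| := by
    simp only [Complex.im_ofReal_mul]
    rw [abs_mul, abs_of_pos Real.pi_pos]
    nlinarith [Real.pi_gt_three]
  have hsin := le_norm_sin hpis
  have hG : Complex.Gamma (1 - s) ≠ 0 := by
    refine Complex.Gamma_ne_zero fun m hm => ?_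
    have := congrArg Complex.im hm
    simp at this
    rw [this, abs_zero] at hs
    linarith
  have key : barnesKernel (fun i => (a i : ℂ)) (fun j => (b j : ℂ)) s =
      (Real.pi / Complex.sin (Real.pi * s)) *
      ∏ i, (Complex.Gamma (a i + -s) *
        (Complex.Gamma ((Fin.cons (α := fun _ => ℝ) 1 b i : ℝ) + -s))⁻¹) := by
    rw [← Complex.Gamma_mul_Gamma_one_sub, barnesKernel, Finset.prod_mul_distrib,
      Fin.prod_univ_succ (fun i => (Complex.Gamma ((Fin.cons (α := fun _ => ℝ) 1 b i : ℝ) + -s))⁻¹)]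
    simp only [Fin.cons_zero, Fin.cons_succ, Complex.ofReal_one, ← sub_eq_add_neg]
    field_simp
  have hprod : ‖∏ i, (Complex.Gamma (a i + -s) *
      (Complex.Gamma ((Fin.cons (α := fun _ => ℝ) 1 b i : ℝ) + -s))⁻¹)‖ ≤
      (∏ i, C i) * (1 + ‖s‖) ^ ∑ i, N i := by
    rw [norm_prod, ← Finset.prod_pow_eq_pow_sum, ← Finset.prod_mul_distrib]
    refine Finset.prod_le_prod (fun i _ => norm_nonneg _) fun i _ => ?_
    simpa using h i (-s) (by simpa using hs)
  have hpoly : (1 + ‖s‖) ^ ∑ i, N i ≤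
      (A * Real.exp ((Real.pi - δ) * |s.im|)) * (B * Real.exp (l * |s.re|)) := by
    refine le_trans ?_ (mul_le_mul (hA' _ (abs_nonneg _)) (hB' _ (abs_nonneg _)) (by positivity)
      (by positivity))
    rw [← mul_pow]
    gcongr
    have := Complex.norm_le_abs_re_add_abs_im s
    nlinarith [abs_nonneg s.re, abs_nonneg s.im]
  have hpre : ‖Real.pi / Complex.sin (Real.pi * s)‖ ≤ 4 * Real.pi * Real.exp (-Real.pi * |s.im|) := by
    simp only [Complex.im_ofReal_mul] at hsin
    rw [abs_mul, abs_of_pos hpi] at hsin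
    rw [norm_div, Complex.norm_real, Real.norm_eq_abs, abs_of_pos hpi, neg_mul, Real.exp_neg]
    rw [div_le_iff₀ (lt_of_lt_of_le (by positivity) hsin)]
    calc Real.pi = 4 * Real.pi * (Real.exp (Real.pi * |s.im|))⁻¹ *
          (Real.exp (Real.pi * |s.im|) / 4) := by field_simp
      _ ≤ _ := by gcongr
  rw [key, norm_mul]
  calc _ ≤ (4 * Real.pi * Real.exp (-Real.pi * |s.im|)) * ((∏ i, C i) *
        ((A * Real.exp ((Real.pi - δ) * |s.im|)) * (B * Real.exp (l * |s.re|)))) :=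
        mul_le_mul hpre (hprod.trans (by gcongr)) (norm_nonneg _) (by positivity)
    _ = 4 * Real.pi * (∏ i, C i) * A * B *
        (Real.exp (-Real.pi * |s.im|) * Real.exp ((Real.pi - δ) * |s.im|)) *
          Real.exp (l * |s.re|) := by ring
    _ = _ := by
      rw [← Real.exp_add]
      ring_nf

/-! ### Integrals along vertical lines -/

theorem integrable_exp_neg_mul_abs {δ : ℝ} (hδ : 0 < δ) :
    MeasureTheory.Integrable fun t : ℝ => Real.exp (-δ * |t|) := by
  rw [← MeasureTheory.integrableOn_univ, ← Set.Iic_union_Ioi (a := (0 : ℝ))]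
  refine MeasureTheory.IntegrableOn.union ?_ ?_
  · refine (integrableOn_exp_mul_Iic hδ 0).congr_fun (fun t ht => ?_) measurableSet_Iic
    simp only
    rw [abs_of_nonpos ht]
    ring_nf
  · refine (integrableOn_exp_mul_Ioi (neg_lt_zero.mpr hδ) 0).congr_fun (fun t ht => ?_)
      measurableSet_Ioi
    simp only
    rw [abs_of_pos ht]

theorem exists_norm_le_mul_exp_of_abs_ge {g : ℝ → ℂ} (hg : Continuous g) {C δ : ℝ}
    (h : ∀ t : ℝ, 1 ≤ |t| → ‖g t‖ ≤ C * Real.exp (-δ * |t|)) :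
    ∃ C', 0 ≤ C' ∧ ∀ t : ℝ, ‖g t‖ ≤ C' * Real.exp (-δ * |t|) := by
  obtain ⟨B, hB⟩ := (isCompact_Icc (a := (-1 : ℝ)) (b := 1)).exists_bound_of_continuousOn
    (f := fun t => ‖g t‖ * Real.exp (δ * |t|)) (by fun_prop)
  refine ⟨max (max B C) 0, le_max_right _ _, fun t => ?_⟩
  rcases le_total 1 |t| with h1 | h1
  · refine (h t h1).trans ?_
    gcongr
    exact (le_max_right _ _).trans (le_max_left _ _)
  · have h2 := (le_abs_self _).trans (hB t (abs_le.mp h1))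
    rw [neg_mul, Real.exp_neg, ← div_eq_mul_inv, le_div_iff₀ (Real.exp_pos _)]
    exact h2.trans ((le_max_left _ _).trans (le_max_left _ _))

/-- If `f` decays exponentially in the half-plane `Re s ≥ c`, both as `Re s` and as `|Im s|` grow, the
hairpin contours can be opened to the line `Re s = c`. -/
theorem integral_hairpin_eq_integral_vertical {P : Set ℂ} {f : ℂ → ℂ}
    (hf : IsGeometricallyDecaying P f) {c r C δ l : ℝ} (hr : 0 < r)
    (hP : ∀ w ∈ P, w.im = 0 ∧ w.re ≠ c) (hδ : 0 < δ) (hl : 0 < l)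
    (hb : ∀ s : ℂ, c ≤ s.re → 1 ≤ |s.im| →
      ‖f s‖ ≤ C * Real.exp (-δ * |s.im|) * Real.exp (-l * s.re)) :
    ∫ t, f (hairpin c r t) * deriv (hairpin c r) t = Complex.I * ∫ y : ℝ, f (c + y * Complex.I) := by
  have hconst : ∀ R, 0 < R → ∫ t, f (hairpin c R t) * deriv (hairpin c R) t =
      ∫ t, f (hairpin c r t) * deriv (hairpin c r) t := by
    intro R hR
    refine hf.integral_eq (isCurveFromInfinity_hairpin hR) (isCurveFromInfinity_hairpin hr) ?_
    intro w hw
    obtain ⟨h1, h2⟩ := hP w hw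
    rcases lt_or_gt_of_ne h2 with h3 | h3
    · exact ⟨0, hasWindingNumber_hairpin_of_re_lt hR h1 h3,
        hasWindingNumber_hairpin_of_re_lt hr h1 h3⟩
    · exact ⟨-1, hasWindingNumber_hairpin_of_lt_re hR h1 h3,
        hasWindingNumber_hairpin_of_lt_re hr h1 h3⟩
  have hint : ∀ R, 0 < R →
      MeasureTheory.Integrable fun t => f (hairpin c R t) * deriv (hairpin c R) t := by
    intro R hR
    refine hf.integrable (isCurveFromInfinity_hairpin hR) fun t ht => ?_
    obtain ⟨h1, h2⟩ := hP _ ht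
    exact hairpin_ne_of_im_eq_zero hR h1 h2 t rfl
  have hvc : Continuous fun y : ℝ => f (c + y * Complex.I) := by
    refine continuous_iff_continuousAt.mpr fun y => ?_
    refine ContinuousAt.comp (f := fun y : ℝ => (c + y * Complex.I : ℂ)) (g := f)
      (hf.differentiableAt _ fun h => (hP _ h).2 (by simp)).continuousAt (by fun_prop)
  have hvi : MeasureTheory.Integrable fun y : ℝ => f (c + y * Complex.I) := by
    obtain ⟨C', -, hC'⟩ := exists_norm_le_mul_exp_of_abs_ge hvc (C := C * Real.exp (-l * c)) (δ := δ)
      (fun t ht => by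
        refine (hb _ (by simp) (by simpa using ht)).trans (le_of_eq ?_)
        simp
        ring)
    exact ((integrable_exp_neg_mul_abs hδ).const_mul C').mono' hvc.aestronglyMeasurable
      (Eventually.of_forall hC')
  have hlim : Tendsto (fun R : ℝ => ∫ y in (-R)..R, f (c + y * Complex.I)) atTop
      (𝓝 (∫ y : ℝ, f (c + y * Complex.I))) :=
    MeasureTheory.intervalIntegral_tendsto_integral hvi tendsto_neg_atTop_atBot tendsto_id
  -- the horizontal edges contribute at most `2 D exp (-δ R)`
  set D := C * Real.exp (-l * c) / l with hD
  have hbound : ∀ R, 1 ≤ R → ‖(∫ t, f (hairpin c r t) * deriv (hairpin c r) t) -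
      Complex.I * ∫ y in (-R)..R, f (c + y * Complex.I)‖ ≤ 2 * D * Real.exp (-δ * R) := by
    intro R hR
    have hR0 : 0 < R := by linarith
    have e1 : ∫ t in (-R)..R, f (hairpin c R t) * deriv (hairpin c R) t =
        Complex.I * ∫ y in (-R)..R, f (c + y * Complex.I) := by
      rw [← intervalIntegral.integral_const_mul]
      refine intervalIntegral.integral_congr_Ioo_of_le (by linarith) fun t ht => ?_
      have h1 : hairpin c R =ᶠ[𝓝 t] fun t => c + t * Complex.I := by
        filter_upwards [gt_mem_nhds ht.2, lt_mem_nhds ht.1] with u hu hu'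
          using hairpin_of_abs_le (abs_le.mpr ⟨le_of_lt hu', le_of_lt hu⟩)
      have h2 : HasDerivAt (fun t : ℝ => (c + t * Complex.I : ℂ)) Complex.I t := by
        simpa using ((Complex.ofRealCLM.hasDerivAt (x := t)).mul_const Complex.I).const_add (c : ℂ)
      rw [h1.deriv_eq, h2.deriv, h1.eq_of_nhds, mul_comm]
    have e2 : ‖∫ t in Set.Ioi R, f (hairpin c R t) * deriv (hairpin c R) t‖ ≤
        D * Real.exp (-δ * R) := by
      have h1 : ∫ t in Set.Ioi R, C * Real.exp (-δ * R) * Real.exp (-l * (c - R)) *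
          Real.exp (-l * t) = D * Real.exp (-δ * R) := by
        rw [MeasureTheory.integral_const_mul, integral_exp_mul_Ioi (neg_lt_zero.mpr hl), hD,
          show -l * c = -l * (c - R) + -l * R by ring, Real.exp_add]
        field_simp
      rw [← h1]
      refine MeasureTheory.norm_integral_le_of_norm_le
        ((integrableOn_exp_mul_Ioi (neg_lt_zero.mpr hl) R).const_mul _) ?_
      refine (MeasureTheory.ae_restrict_iff' measurableSet_Ioi).mpr (Eventually.of_forall
        fun t ht => ?_)
      have ht' : R < t := ht
      rw [deriv_eq_one_of_eq_add (fun t ht => hairpin_of_ge hR0 ht) t ht', mul_one,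
        hairpin_of_ge hR0 ht'.le]
      refine (hb _ (by simp; linarith) (by simpa [abs_of_pos hR0] using hR)).trans (le_of_eq ?_)
      simp [abs_of_pos hR0]
      rw [mul_assoc (C * _), ← Real.exp_add]
      ring_nf
    have e3 : ‖∫ t in Set.Iic (-R), f (hairpin c R t) * deriv (hairpin c R) t‖ ≤
        D * Real.exp (-δ * R) := by
      have h1 : ∫ t in Set.Iio (-R), C * Real.exp (-δ * R) * Real.exp (-l * (c - R)) *
          Real.exp (l * t) = D * Real.exp (-δ * R) := by
        rw [← MeasureTheory.integral_Iic_eq_integral_Iio, MeasureTheory.integral_const_mul,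
          integral_exp_mul_Iic hl, hD,
          show -l * c = -l * (c - R) + l * -R by ring, Real.exp_add]
        field_simp
      rw [← h1, MeasureTheory.integral_Iic_eq_integral_Iio]
      refine MeasureTheory.norm_integral_le_of_norm_le
        (((integrableOn_exp_mul_Iic hl (-R)).mono_set Set.Iio_subset_Iic_self).const_mul _) ?_
      refine (MeasureTheory.ae_restrict_iff' measurableSet_Iio).mpr (Eventually.of_forall
        fun t ht => ?_)
      have ht' : t < -R := ht
      rw [deriv_eq_neg_one_of_eq_sub (fun t ht => hairpin_of_le hR0 ht) t ht', mul_neg_one, norm_neg,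
        hairpin_of_le hR0 ht'.le]
      refine (hb _ (by simp; linarith) (by simpa [abs_of_pos hR0] using hR)).trans (le_of_eq ?_)
      simp [abs_of_pos hR0]
      rw [mul_assoc (C * _), ← Real.exp_add]
      ring_nf
    rw [← hconst R hR0, ← intervalIntegral.integral_Iic_add_Ioi (b := -R) (hint R hR0).integrableOn
      (hint R hR0).integrableOn, ← intervalIntegral.integral_interval_add_Ioi (b := R)
      (hint R hR0).integrableOn (hint R hR0).integrableOn, e1]
    calc _ = ‖(∫ t in Set.Iic (-R), f (hairpin c R t) * deriv (hairpin c R) t) +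
          ∫ t in Set.Ioi R, f (hairpin c R t) * deriv (hairpin c R) t‖ := by congr 1; ring
      _ ≤ _ := (norm_add_le _ _).trans (by linarith)
  have hz : Tendsto (fun R : ℝ => 2 * D * Real.exp (-δ * R)) atTop (𝓝 0) := by
    have h1 : Tendsto (fun R : ℝ => -δ * R) atTop atBot :=
      tendsto_id.const_mul_atTop_of_neg (neg_lt_zero.mpr hδ)
    simpa using (Real.tendsto_exp_atBot.comp h1).const_mul (2 * D)
  have h3 : Tendsto (fun R : ℝ => (∫ t, f (hairpin c r t) * deriv (hairpin c r) t) -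
      Complex.I * ∫ y in (-R)..R, f (c + y * Complex.I)) atTop (𝓝 0) :=
    squeeze_zero_norm' ((eventually_ge_atTop 1).mono hbound) hz
  have h4 := (hlim.const_mul Complex.I).const_sub (∫ t, f (hairpin c r t) * deriv (hairpin c r) t)
  exact sub_eq_zero.mp (tendsto_nhds_unique h4 h3)

/-- A Fourier–Laplace integral `∫ g(t) exp (-(c + i t) L) dt` is holomorphic in the strip in which it
converges. -/
theorem differentiableAt_integral_mul_exp {g : ℝ → ℂ} (hg : Continuous g) (c : ℝ) {a : ℝ}
    (hb : ∀ δ < a, ∃ C, 0 ≤ C ∧ ∀ t : ℝ, ‖g t‖ ≤ C * Real.exp (-δ * |t|)) {L₀ : ℂ}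
    (hL₀ : |L₀.im| < a) :
    DifferentiableAt ℂ (fun L : ℂ => ∫ t : ℝ, g t * Complex.exp (-(c + t * Complex.I) * L)) L₀ := by
  obtain ⟨η, hη₁, hη₂⟩ := exists_between hL₀
  obtain ⟨δ, hδ₁, hδ₂⟩ := exists_between hη₂
  obtain ⟨C, hC, hgC⟩ := hb δ hδ₂
  obtain ⟨A, hA, hA'⟩ := exists_one_add_pow_le_exp 1 (ε := (δ - η) / 2) (by linarith)
  have hs : {L : ℂ | |L.im| < η} ∩ Metric.ball 0 (‖L₀‖ + 1) ∈ 𝓝 L₀ := by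
    refine IsOpen.mem_nhds (IsOpen.inter ?_ Metric.isOpen_ball) ⟨hη₁, by simp⟩
    exact isOpen_lt (by fun_prop) continuous_const
  have hexp : ∀ (L : ℂ) (t : ℝ), |L.im| ≤ η → ‖L‖ ≤ ‖L₀‖ + 1 →
      ‖Complex.exp (-(c + t * Complex.I) * L)‖ ≤
        Real.exp (|c| * (‖L₀‖ + 1)) * Real.exp (η * |t|) := by
    intro L t h1 h2
    rw [Complex.norm_exp, ← Real.exp_add]
    refine Real.exp_le_exp.mpr ?_
    have h3 : (-(c + t * Complex.I) * L).re = -c * L.re + t * L.im := by simp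
    rw [h3]
    have h4 : -c * L.re ≤ |c| * (‖L₀‖ + 1) := by
      refine (le_abs_self _).trans ?_
      rw [abs_mul, abs_neg]
      gcongr
      exact (Complex.abs_re_le_norm L).trans h2
    have h5 : t * L.im ≤ η * |t| := by
      refine (le_abs_self _).trans ?_
      rw [abs_mul, mul_comm]
      gcongr
    linarith
  have hcexp : ∀ L : ℂ, Continuous fun t : ℝ => Complex.exp (-(c + t * Complex.I) * L) :=
    fun L => by fun_prop
  refine (hasDerivAt_integral_of_dominated_loc_of_deriv_le
    (F := fun L t => g t * Complex.exp (-(c + t * Complex.I) * L))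
    (F' := fun L t => g t * (Complex.exp (-(c + t * Complex.I) * L) * -(c + t * Complex.I)))
    (bound := fun t => C * A * Real.exp (|c| * (‖L₀‖ + 1)) * (1 + |c|) *
      Real.exp (-((δ - η) / 2) * |t|)) hs ?_ ?_ ?_ ?_ ?_ ?_).2.differentiableAt
  · exact Eventually.of_forall fun L => (hg.mul (hcexp L)).aestronglyMeasurable
  · refine ((integrable_exp_neg_mul_abs (δ := δ - η) (by linarith)).const_mul
      (C * Real.exp (|c| * (‖L₀‖ + 1)))).mono' (hg.mul (hcexp L₀)).aestronglyMeasurable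
      (Eventually.of_forall fun t => ?_)
    rw [norm_mul]
    calc _ ≤ (C * Real.exp (-δ * |t|)) * (Real.exp (|c| * (‖L₀‖ + 1)) * Real.exp (η * |t|)) :=
          mul_le_mul (hgC t) (hexp L₀ t hη₁.le (by linarith)) (norm_nonneg _) (by positivity)
      _ = C * Real.exp (|c| * (‖L₀‖ + 1)) * (Real.exp (-δ * |t|) * Real.exp (η * |t|)) := by ring
      _ = _ := by rw [← Real.exp_add]; ring_nf
  · exact (hg.mul ((hcexp L₀).mul (by fun_prop))).aestronglyMeasurable
  · refine Eventually.of_forall fun t L hL => ?_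
    have h1 := hexp L t (le_of_lt hL.1) (le_of_lt (by simpa using hL.2))
    have h2 : ‖-((c : ℂ) + t * Complex.I)‖ ≤ (1 + |c|) * (A * Real.exp ((δ - η) / 2 * |t|)) := by
      rw [norm_neg]
      refine (norm_add_le _ _).trans ?_
      have := hA' |t| (abs_nonneg t)
      simp only [pow_one] at this
      simp only [norm_mul, Complex.norm_real, Complex.norm_I, mul_one, Real.norm_eq_abs]
      nlinarith [abs_nonneg c, abs_nonneg t]
    rw [norm_mul, norm_mul]
    calc _ ≤ (C * Real.exp (-δ * |t|)) * ((Real.exp (|c| * (‖L₀‖ + 1)) * Real.exp (η * |t|)) *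
          ((1 + |c|) * (A * Real.exp ((δ - η) / 2 * |t|)))) :=
          mul_le_mul (hgC t) (mul_le_mul h1 h2 (norm_nonneg _) (by positivity)) (by positivity)
            (by positivity)
      _ = C * A * Real.exp (|c| * (‖L₀‖ + 1)) * (1 + |c|) *
          (Real.exp (-δ * |t|) * Real.exp (η * |t|) * Real.exp ((δ - η) / 2 * |t|)) := by ring
      _ = _ := by rw [← Real.exp_add, ← Real.exp_add]; ring_nf
  · exact (integrable_exp_neg_mul_abs (by linarith)).const_mul _
  · refine Eventually.of_forall fun t L _ => ?_
    refine HasDerivAt.const_mul _ ?_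
    have := ((hasDerivAt_id L).const_mul (-((c : ℂ) + t * Complex.I))).cexp
    simpa using this

/-! ### Residues of the Gamma function -/

/-- Near `-n` the Gamma function is a simple pole times `E(s) = Γ(s + n + 1) / (s (s + 1) ⋯ (s + n - 1))`. -/
theorem exists_Gamma_eq_inv_mul (n : ℕ) : ∃ E : ℂ → ℂ,
    (∀ s : ℂ, ‖s + n‖ < 1 → DifferentiableAt ℂ E s) ∧ E (-n) = (-1) ^ n / n.factorial ∧
      ∀ s : ℂ, ‖s + n‖ < 1 → s ≠ -n → Complex.Gamma s = (s + n)⁻¹ * E s := by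
  have hasc : ∀ s : ℂ, ‖s + n‖ < 1 → (ascPochhammer ℂ n).eval s ≠ 0 := by
    intro s hs h
    obtain ⟨k, hk, hks⟩ := (ascPochhammer_eval_eq_zero_iff n s).mp h
    have h1 : s + n = ((n - k : ℕ) : ℂ) := by
      rw [Nat.cast_sub hk.le, hks]
      ring
    rw [h1, Complex.norm_natCast] at hs
    have : (1 : ℝ) ≤ (n - k : ℕ) := by exact_mod_cast (by omega : 1 ≤ n - k)
    linarith
  have hre : ∀ s : ℂ, ‖s + n‖ < 1 → 0 < (s + n + 1).re := by
    intro s hs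
    have := (abs_lt.mp ((Complex.abs_re_le_norm _).trans_lt hs)).1
    simp only [Complex.add_re, Complex.one_re] at this ⊢
    linarith
  refine ⟨fun s => Complex.Gamma (s + n + 1) / (ascPochhammer ℂ n).eval s, fun s hs => ?_, ?_,
    fun s hs hne => ?_⟩
  · refine DifferentiableAt.fun_div ?_ (Polynomial.differentiableAt _) (hasc s hs)
    refine (Complex.differentiableAt_Gamma _ fun m hm => ?_).fun_comp' s (by fun_prop)
    have := hre s hs
    rw [hm] at this
    simp at this
    linarith [m.cast_nonneg (α := ℝ)]
  · simp only
    rw [ascPochhammer_eval_neg_eq_descPochhammer, descPochhammer_eval_eq_descFactorial,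
      Nat.descFactorial_self]
    have h1 : ((-1 : ℂ) ^ n) * (-1) ^ n = 1 := by rw [← mul_pow]; simp
    have h2 : (n.factorial : ℂ) ≠ 0 := by exact_mod_cast n.factorial_ne_zero
    have h3 : (-1 : ℂ) ^ n ≠ 0 := pow_ne_zero _ (by norm_num)
    simp only [neg_add_cancel, zero_add, Complex.Gamma_one]
    field_simp
    linear_combination -h1
  · have h0 : s + n ≠ 0 := fun h => hne (eq_neg_of_add_eq_zero_left h)
    have h1 : ∀ k : ℕ, s ≠ -k := by
      intro k hk
      rcases lt_trichotomy k n with h | h | h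
      · exact hasc s hs ((ascPochhammer_eval_eq_zero_iff n s).mpr ⟨k, h, by rw [hk]; ring⟩)
      · exact hne (by rw [hk, h])
      · have := hre s hs
        rw [hk] at this
        simp at this
        have h2 : (n : ℝ) + 1 ≤ k := by exact_mod_cast h
        linarith
    have h2 := Complex.Gamma_add_nat_div_Gamma_eq (n := n + 1) s h1
    rw [div_eq_iff (Complex.Gamma_ne_zero h1), ascPochhammer_succ_eval] at h2
    push_cast at h2
    simp only
    rw [show s + (n : ℂ) + 1 = s + (n + 1) by ring, h2]
    have h3 := hasc s hs
    field_simp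

theorem circleIntegral_Gamma_mul (n : ℕ) {r : ℝ} (hr : 0 < r) (hr₁ : r < 1) {h : ℂ → ℂ}
    (hh : ∀ s ∈ Metric.closedBall (-(n : ℂ)) r, DifferentiableAt ℂ h s) :
    circleIntegral (fun s => Complex.Gamma s * h s) (-n) r =
      2 * Real.pi * Complex.I * ((-1) ^ n / n.factorial * h (-n)) := by
  obtain ⟨E, hE, hEn, hΓ⟩ := exists_Gamma_eq_inv_mul n
  have hball : ∀ s ∈ Metric.closedBall (-(n : ℂ)) r, ‖s + n‖ < 1 := by
    intro s hs
    rw [mem_closedBall_iff_norm, sub_neg_eq_add] at hs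
    exact hs.trans_lt hr₁
  have hd : ∀ s ∈ Metric.closedBall (-(n : ℂ)) r, DifferentiableAt ℂ (fun s => E s * h s) s :=
    fun s hs => (hE s (hball s hs)).mul (hh s hs)
  have h1 := Complex.circleIntegral_sub_inv_smul_of_differentiable_on_off_countable
    Set.countable_empty (Metric.mem_ball_self (x := -(n : ℂ)) hr)
    (fun s hs => (hd s hs).continuousAt.continuousWithinAt)
    (fun s hs => hd s (Metric.ball_subset_closedBall hs.1))
  rw [hEn, smul_eq_mul] at h1
  rw [← h1]
  refine circleIntegral.integral_congr hr.le fun s hs => ?_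
  have hne : s ≠ -n := fun h0 => by
    rw [h0, mem_sphere_iff_norm, sub_self, norm_zero] at hs
    exact hr.ne hs
  simp only [smul_eq_mul, sub_neg_eq_add]
  rw [hΓ s (hball s (Metric.sphere_subset_closedBall hs)) hne, mul_assoc]

theorem circleIntegral_Gamma_neg_mul (n : ℕ) {r : ℝ} (hr : 0 < r) (hr₁ : r < 1) {h : ℂ → ℂ}
    (hh : ∀ s ∈ Metric.closedBall (n : ℂ) r, DifferentiableAt ℂ h s) :
    circleIntegral (fun s => Complex.Gamma (-s) * h s) n r =
      -(2 * Real.pi * Complex.I * ((-1) ^ n / n.factorial * h n)) := by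
  obtain ⟨E, hE, hEn, hΓ⟩ := exists_Gamma_eq_inv_mul n
  have hball : ∀ s ∈ Metric.closedBall (n : ℂ) r, ‖-s + n‖ < 1 := by
    intro s hs
    rw [mem_closedBall_iff_norm, norm_sub_rev] at hs
    rw [neg_add_eq_sub]
    exact hs.trans_lt hr₁
  have hd : ∀ s ∈ Metric.closedBall (n : ℂ) r, DifferentiableAt ℂ (fun s => -(E (-s) * h s)) s :=
    fun s hs => (((hE (-s) (hball s hs)).fun_comp' s (by fun_prop)).mul (hh s hs)).neg
  have h1 := Complex.circleIntegral_sub_inv_smul_of_differentiable_on_off_countable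
    Set.countable_empty (Metric.mem_ball_self (x := (n : ℂ)) hr)
    (fun s hs => (hd s hs).continuousAt.continuousWithinAt)
    (fun s hs => hd s (Metric.ball_subset_closedBall hs.1))
  rw [hEn, smul_eq_mul, mul_neg] at h1
  rw [← h1]
  refine circleIntegral.integral_congr hr.le fun s hs => ?_
  have hne : s ≠ n := fun h0 => by
    rw [h0, mem_sphere_iff_norm, sub_self, norm_zero] at hs
    exact hr.ne hs
  have hne' : s - n ≠ 0 := sub_ne_zero.mpr hne
  simp only [smul_eq_mul]
  rw [hΓ (-s) (hball s (Metric.sphere_subset_closedBall hs)) (fun h => hne (neg_injective h)),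
    show -s + (n : ℂ) = -(s - n) by ring, inv_neg]
  ring

/-! ### Barnes's integrand as a Mellin–Barnes integrand -/

theorem meijerIntegrand_eq_barnesKernel {p : ℕ} (a : Fin (p + 1) → ℂ) (b : Fin p → ℂ) (z s : ℂ) :
    meijerIntegrand (p + 1) 1 (Matrix.vecCons 1 b) a z s = barnesKernel a b s * z ^ s := by
  have h1 : (∏ j : Fin (p + 1), if (j : ℕ) < p + 1 then Complex.Gamma (a j - s)
      else (Complex.Gamma (1 - a j + s))⁻¹) = ∏ j, Complex.Gamma (a j - s) :=
    Finset.prod_congr rfl fun j _ => if_pos j.2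
  have h2 : (∏ i : Fin (p + 1), if (i : ℕ) < 1
      then Complex.Gamma (1 - Matrix.vecCons (1 : ℂ) b i + s)
      else (Complex.Gamma (Matrix.vecCons (1 : ℂ) b i - s))⁻¹) =
      Complex.Gamma s * ∏ j, (Complex.Gamma (b j - s))⁻¹ := by
    rw [Fin.prod_univ_succ]
    simp
  rw [meijerIntegrand, h1, h2, barnesKernel]
  ring

/-- After the reflection `s ↦ -s` the poles of `Γ(s)` lie to the right and those of the `Γ(aᵢ - s)` to the
left, and the integrand is again of Mellin–Barnes type. -/
theorem meijerIntegrand_eq_barnesKernel_neg {p : ℕ} (a : Fin (p + 1) → ℂ) (b : Fin p → ℂ)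
    (z s : ℂ) : meijerIntegrand 1 (p + 1) (fun i => 1 - a i)
      (Matrix.vecCons 0 fun j => 1 - b j) z s = barnesKernel a b (-s) * z ^ s := by
  have h1 : (∏ i : Fin (p + 1), if (i : ℕ) < p + 1 then Complex.Gamma (1 - (1 - a i) + s)
      else (Complex.Gamma (1 - a i - s))⁻¹) = ∏ i, Complex.Gamma (a i - -s) :=
    Finset.prod_congr rfl fun j _ => by
      rw [if_pos j.2]
      congr 1
      ring
  have h2 : (∏ j : Fin (p + 1), if (j : ℕ) < 1
      then Complex.Gamma (Matrix.vecCons (0 : ℂ) (fun j => 1 - b j) j - s)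
      else (Complex.Gamma (1 - Matrix.vecCons (0 : ℂ) (fun j => 1 - b j) j + s))⁻¹) =
      Complex.Gamma (-s) * ∏ j, (Complex.Gamma (b j - -s))⁻¹ := by
    rw [Fin.prod_univ_succ]
    simp
  rw [meijerIntegrand, h1, h2, barnesKernel]
  ring

/-! ### Barnes's integral inside the unit disc -/

theorem tendsto_integral_hairpin_add_nat {P : Set ℂ} {f : ℂ → ℂ} (hf : IsGeometricallyDecaying P f)
    {c r : ℝ} (hr : 0 < r) (hP : ∀ (n : ℕ) (t : ℝ), hairpin (c + n) r t ∉ P) :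
    Tendsto (fun n : ℕ => ∫ t, f (hairpin (c + n) r t) * deriv (hairpin (c + n) r) t) atTop
      (𝓝 0) := by
  obtain ⟨X, q, hq₀, hq₁, hstep⟩ := hf.decay
  set A : ℕ → ℝ := fun n => ∫ t, ‖f (hairpin (c + n) r t) * deriv (hairpin (c + n) r) t‖ with hA
  have hint : ∀ n : ℕ, MeasureTheory.Integrable fun t =>
      f (hairpin (c + n) r t) * deriv (hairpin (c + n) r) t := fun n =>
    hf.integrable (isCurveFromInfinity_hairpin hr) (hP n)
  have hsucc : ∀ n : ℕ, hairpin (c + (n + 1 : ℕ)) r = fun t => hairpin (c + n) r t + 1 := by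
    intro n
    funext t
    simp only [hairpin]
    push_cast
    ring
  obtain ⟨N, hN⟩ := exists_nat_ge (X - c)
  have hAq : ∀ m : ℕ, A (N + m + 1) ≤ q * A (N + m) := by
    intro m
    simp only [hA]
    rw [← MeasureTheory.integral_const_mul]
    refine MeasureTheory.integral_mono (hint _).norm ((hint _).norm.const_mul q) fun t => ?_
    simp only
    rw [hsucc, deriv_add_const, norm_mul, norm_mul, ← mul_assoc]
    refine mul_le_mul_of_nonneg_right ?_ (norm_nonneg _)
    refine hstep _ ?_ (hP _ t)
    refine le_trans ?_ (hairpin_re_ge t)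
    push_cast
    linarith [m.cast_nonneg (α := ℝ)]
  have hAm : ∀ m : ℕ, A (m + N) ≤ A N * q ^ m := by
    intro m
    induction m with
    | zero => simp
    | succ m ih =>
      have := hAq m
      rw [show m + 1 + N = N + m + 1 by omega]
      rw [add_comm m N] at ih
      calc _ ≤ q * A (N + m) := this
        _ ≤ q * (A N * q ^ m) := by gcongr
        _ = _ := by ring
  rw [← tendsto_add_atTop_iff_nat N]
  refine squeeze_zero_norm (fun m => (MeasureTheory.norm_integral_le_integral_norm _).trans (hAm m)) ?_
  simpa using (tendsto_pow_atTop_nhds_zero_of_lt_one hq₀.le hq₁).const_mul (A N)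

/-- A kernel growing more slowly than `exp (-δ |Im s| + l |Re s|)` for all `δ < π` and `l > 0` decays
exponentially in right half-planes after multiplication by `w ^ s`. -/
theorem exists_norm_mul_cpow_le {κ : ℂ → ℂ}
    (hκ : ∀ δ < Real.pi, ∀ l > 0, ∃ C : ℝ, 0 ≤ C ∧ ∀ s : ℂ, 1 ≤ |s.im| →
      ‖κ s‖ ≤ C * Real.exp (-δ * |s.im|) * Real.exp (l * |s.re|))
    {w : ℂ} (hw₀ : w ≠ 0) (hw₁ : ‖w‖ < 1) (hw : |w.arg| < Real.pi) (c : ℝ) :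
    ∃ C δ l : ℝ, 0 < δ ∧ 0 < l ∧ ∀ s : ℂ, c ≤ s.re → 1 ≤ |s.im| →
      ‖κ s * w ^ s‖ ≤ C * Real.exp (-δ * |s.im|) * Real.exp (-l * s.re) := by
  obtain ⟨δ, hδ₁, hδ₂⟩ := exists_between hw
  have hlog : Real.log ‖w‖ < 0 := Real.log_neg (norm_pos_iff.mpr hw₀) hw₁
  set l := -Real.log ‖w‖ / 2 with hl
  have hl₀ : 0 < l := by rw [hl]; linarith
  obtain ⟨C, hC, h⟩ := hκ δ hδ₂ l hl₀
  refine ⟨C * Real.exp (2 * l * |c|), δ - |w.arg|, l, by linarith, hl₀, fun s hs hs' => ?_⟩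
  have h1 : ‖w ^ s‖ ≤ Real.exp (-(2 * l) * s.re) * Real.exp (|w.arg| * |s.im|) := by
    rw [Complex.norm_cpow_of_ne_zero hw₀, div_eq_mul_inv, ← Real.exp_neg,
      Real.rpow_def_of_pos (norm_pos_iff.mpr hw₀)]
    have e : Real.log ‖w‖ = -(2 * l) := by rw [hl]; ring
    rw [e]
    gcongr
    rw [← abs_mul]
    exact neg_le_abs _
  have h2 : |s.re| ≤ s.re + 2 * |c| := by
    rcases abs_cases s.re with ⟨h, _⟩ | ⟨h, _⟩
    · linarith [abs_nonneg c]
    · linarith [neg_abs_le c]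
  rw [norm_mul]
  calc _ ≤ (C * Real.exp (-δ * |s.im|) * Real.exp (l * |s.re|)) *
        (Real.exp (-(2 * l) * s.re) * Real.exp (|w.arg| * |s.im|)) := by
        gcongr
        exact h s hs'
    _ ≤ (C * Real.exp (-δ * |s.im|) * Real.exp (l * (s.re + 2 * |c|))) *
        (Real.exp (-(2 * l) * s.re) * Real.exp (|w.arg| * |s.im|)) := by gcongr
    _ = C * ((Real.exp (-δ * |s.im|) * Real.exp (l * (s.re + 2 * |c|))) *
        (Real.exp (-(2 * l) * s.re) * Real.exp (|w.arg| * |s.im|))) := by ring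
    _ = C * (Real.exp (2 * l * |c|) * Real.exp (-(δ - |w.arg|) * |s.im|) *
        Real.exp (-l * s.re)) := by
        simp only [← Real.exp_add]
        ring_nf
    _ = _ := by ring

/-- The coefficient of `zⁿ` in the series of `ₚ₊₁Fₚ(a; b; z)`. -/
noncomputable def hypergeometricCoeff {p : ℕ} (a : Fin (p + 1) → ℂ) (b : Fin p → ℂ) (n : ℕ) : ℂ :=
  (∏ i, (ascPochhammer ℂ n).eval (a i)) /
    ((∏ j, (ascPochhammer ℂ n).eval (b j)) * (n.factorial : ℂ))

/-- Barnes's integral over the line `Re s = c`, without its factor `(2π)⁻¹`, as a function of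
`L = log (-z)`. -/
noncomputable def barnesIntegral {p : ℕ} (a : Fin (p + 1) → ℂ) (b : Fin p → ℂ) (c : ℝ) (L : ℂ) : ℂ :=
  ∫ t : ℝ, barnesKernel a b (c + t * Complex.I) * Complex.exp (-(c + t * Complex.I) * L)

theorem Gamma_add_nat_of_ne {z : ℂ} (hz : ∀ k : ℕ, z ≠ -k) (n : ℕ) :
    Complex.Gamma (z + n) = (ascPochhammer ℂ n).eval z * Complex.Gamma z := by
  rw [← Complex.Gamma_add_nat_div_Gamma_eq z hz, div_mul_cancel₀ _ (Complex.Gamma_ne_zero hz)]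

theorem prod_Gamma_add_nat {p : ℕ} {a : Fin (p + 1) → ℂ} {b : Fin p → ℂ}
    (ha : ∀ i, ∀ k : ℕ, a i ≠ -k) (hb : ∀ j, ∀ k : ℕ, b j ≠ -k) (n : ℕ) :
    (n.factorial : ℂ)⁻¹ * ((∏ i, Complex.Gamma (a i + n)) * ∏ j, (Complex.Gamma (b j + n))⁻¹) =
      (∏ i, Complex.Gamma (a i)) / (∏ j, Complex.Gamma (b j)) * hypergeometricCoeff a b n := by
  rw [hypergeometricCoeff, Finset.prod_congr rfl fun i _ => Gamma_add_nat_of_ne (ha i) n,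
    Finset.prod_inv_distrib, Finset.prod_congr rfl fun j _ => Gamma_add_nat_of_ne (hb j) n,
    Finset.prod_mul_distrib, Finset.prod_mul_distrib]
  simp only [div_eq_mul_inv, mul_inv]
  ring

theorem ofReal_ne_neg_nat {x : ℝ} (h : ∀ k : ℕ, x ≠ -(k : ℝ)) (k : ℕ) : (x : ℂ) ≠ -k := by
  exact_mod_cast h k

section real

variable {p : ℕ} {a : Fin (p + 1) → ℝ} {b : Fin p → ℝ}

theorem barnesKernel_bound (a : Fin (p + 1) → ℝ) (b : Fin p → ℝ) : ∀ δ < Real.pi, ∀ l > 0,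
    ∃ C : ℝ, 0 ≤ C ∧ ∀ s : ℂ, 1 ≤ |s.im| →
      ‖barnesKernel (fun i => (a i : ℂ)) (fun j => (b j : ℂ)) s‖ ≤
        C * Real.exp (-δ * |s.im|) * Real.exp (l * |s.re|) :=
  fun _ hδ _ hl => exists_norm_barnesKernel_le a b hδ hl

theorem hairpin_notMem {P : Set ℂ} {c r : ℝ} (hr : 0 < r) (hP : ∀ w ∈ P, w.im = 0 ∧ w.re ≠ c)
    (t : ℝ) : hairpin c r t ∉ P := fun h =>
  hairpin_ne_of_im_eq_zero hr (hP _ h).1 (hP _ h).2 t rfl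

/-- Closing Barnes's integral to the left, where its poles are simple and lie at `-n`, `n ≥ M`, gives
the tail of the hypergeometric series. The line `Re s = 1/2 - M` lies between two poles of `Γ(s)`. The
proof works with `-s` in place of `s`, so that the contours run to `+∞`: moving a hairpin from
`Re s = n - 1/2` to `Re s = n + 1/2` releases the residue at `n`. -/
theorem tendsto_sum_hypergeometricCoeff (ha : ∀ i, ∀ k : ℕ, a i ≠ -(k : ℝ))
    (hb : ∀ j, ∀ k : ℕ, b j ≠ -(k : ℝ)) {M : ℕ} (hM : ∀ i, 1 / 2 - (M : ℝ) < a i) {z : ℂ}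
    (hz₁ : ‖z‖ < 1) (hz : -z ∈ Complex.slitPlane) :
    Tendsto (fun N => ∑ n ∈ Finset.Ico M N,
        hypergeometricCoeff (fun i => (a i : ℂ)) (fun j => (b j : ℂ)) n * z ^ n) atTop
      (𝓝 ((∏ j, Complex.Gamma (b j)) / (∏ i, Complex.Gamma (a i)) / (2 * Real.pi) *
        barnesIntegral (fun i => (a i : ℂ)) (fun j => (b j : ℂ)) (1 / 2 - M)
          (Complex.log (-z)))) := by
  set A : Fin (p + 1) → ℂ := fun i => (a i : ℂ) with hA
  set B : Fin p → ℂ := fun j => (b j : ℂ) with hB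
  have hz0 : -z ≠ 0 := Complex.slitPlane_ne_zero hz
  have hΓa : (∏ i, Complex.Gamma (a i)) ≠ 0 :=
    Finset.prod_ne_zero_iff.mpr fun i _ => Complex.Gamma_ne_zero (ofReal_ne_neg_nat (ha i))
  have hΓb : (∏ j, Complex.Gamma (b j)) ≠ 0 :=
    Finset.prod_ne_zero_iff.mpr fun j _ => Complex.Gamma_ne_zero (ofReal_ne_neg_nat (hb j))
  set f : ℂ → ℂ := fun s => barnesKernel A B (-s) * (-z) ^ s with hf
  set P := meijerPoles 1 (p + 1) (fun i => 1 - A i) (Matrix.vecCons 0 fun j => 1 - B j) with hP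
  have hdec : IsGeometricallyDecaying P f := by
    have := isGeometricallyDecaying_meijerIntegrand 1 (p + 1) (fun i => 1 - A i)
      (Matrix.vecCons 0 fun j => 1 - B j) hz0 (by simpa using hz₁)
    have e : meijerIntegrand 1 (p + 1) (fun i => 1 - A i) (Matrix.vecCons 0 fun j => 1 - B j) (-z) =
        f := funext fun s => meijerIntegrand_eq_barnesKernel_neg A B (-z) s
    rwa [e] at this
  have hPmem : ∀ w ∈ P, (∃ k : ℕ, w = k) ∨ ∃ x : ℝ, w = x ∧ x < M - 1 / 2 := by
    rintro w (⟨j, hj, k, rfl⟩ | ⟨i, -, k, rfl⟩)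
    · left
      refine ⟨k, ?_⟩
      have : j = 0 := by
        apply Fin.ext
        simpa using hj
      simp [this]
    · right
      refine ⟨-(a i) - k, by simp [hA], ?_⟩
      have := hM i
      linarith [k.cast_nonneg (α := ℝ)]
  -- the lines `Re s = n - 1/2` and the circles of radius `1/4` about `n` miss the poles
  have hPline : ∀ n : ℕ, M ≤ n → ∀ w ∈ P, w.im = 0 ∧ w.re ≠ n - 1 / 2 := by
    intro n hn w hw
    have hn' : (M : ℝ) ≤ n := by exact_mod_cast hn
    rcases hPmem w hw with ⟨k, rfl⟩ | ⟨x, rfl, hx⟩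
    · refine ⟨by simp, fun h => ?_⟩
      simp only [Complex.natCast_re] at h
      have h2 : (2 * k + 1 : ℝ) = 2 * n := by linarith
      have h3 : 2 * k + 1 = 2 * n := by exact_mod_cast h2
      omega
    · refine ⟨by simp, ?_⟩
      simp only [Complex.ofReal_re]
      exact (by linarith : x < n - 1 / 2).ne
  set h : ℕ → ℂ := fun n => ∫ t, f (hairpin (n - 1 / 2) (1 / 4) t) *
    deriv (hairpin (n - 1 / 2) (1 / 4)) t with hh
  have hstep : ∀ n : ℕ, M ≤ n → h (n + 1) = h n + circleIntegral f n (1 / 4) := by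
    intro n hn
    have hn' : (M : ℝ) ≤ n := by exact_mod_cast hn
    have hdist : ∀ w ∈ P, dist w n ≠ 1 / 4 := by
      intro w hw
      rcases hPmem w hw with ⟨k, rfl⟩ | ⟨x, rfl, hx⟩
      · rcases eq_or_ne k n with rfl | hkn
        · norm_num
        · have h1 : 1 ≤ dist (k : ℂ) n := by
            have : 1 ≤ dist k n := Nat.pairwise_one_le_dist hkn
            rw [Nat.dist_eq] at this
            rw [Complex.dist_eq, ← Complex.ofReal_natCast, ← Complex.ofReal_natCast,
              ← Complex.ofReal_sub, Complex.norm_real]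
            exact this
          intro h2
          linarith
      · intro h2
        rw [Complex.dist_eq, ← Complex.ofReal_natCast, ← Complex.ofReal_sub, Complex.norm_real,
          Real.norm_eq_abs, abs_of_neg (by linarith)] at h2
        linarith
    obtain ⟨γ, hγ, -, hwind, hint⟩ := exists_hairpin_with_circles (c := n - 1 / 2) (r := 1 / 4)
      (by norm_num) {(n : ℂ)} (by simp)
    have h1 := hint P f hdec fun w hw => ⟨(hPline n hn w hw).1, (hPline n hn w hw).2, by
      simpa using hdist w hw⟩
    rw [Finset.sum_singleton] at h1
    simp only [hh]
    rw [← h1]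
    have e : ((n + 1 : ℕ) : ℝ) - 1 / 2 = n + 1 / 2 := by push_cast; ring
    rw [e]
    refine (hdec.integral_eq hγ (isCurveFromInfinity_hairpin (by norm_num)) fun w hw => ?_).symm
    have h2 := hwind w (hPline n hn w hw).1 (hPline n hn w hw).2 (by simpa using hdist w hw)
    rw [Finset.sum_singleton] at h2
    have h3 := hPline (n + 1) (by omega) w hw
    rw [e] at h3
    refine ⟨_, h2, ?_⟩
    rcases hPmem w hw with ⟨k, rfl⟩ | ⟨x, rfl, hx⟩
    · rcases lt_trichotomy k n with hk | rfl | hk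
      · have h4 : (k : ℝ) + 1 ≤ n := by exact_mod_cast hk
        rw [if_neg (by simp; linarith), if_neg (by
          rw [Complex.dist_eq, ← Complex.ofReal_natCast, ← Complex.ofReal_natCast,
            ← Complex.ofReal_sub, Complex.norm_real, Real.norm_eq_abs, abs_of_neg (by linarith)]
          linarith)]
        exact hasWindingNumber_hairpin_of_re_lt (by norm_num) h3.1 (by simp; linarith)
      · rw [if_pos (by simp), if_pos (by simp)]
        exact hasWindingNumber_hairpin_of_re_lt (by norm_num) h3.1 (by simp)
      · have h4 : (n : ℝ) + 1 ≤ k := by exact_mod_cast hk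
        rw [if_pos (by simp; linarith), if_neg (by
          rw [Complex.dist_eq, ← Complex.ofReal_natCast, ← Complex.ofReal_natCast,
            ← Complex.ofReal_sub, Complex.norm_real, Real.norm_eq_abs, abs_of_pos (by linarith)]
          linarith)]
        exact hasWindingNumber_hairpin_of_lt_re (by norm_num) h3.1 (by simp; linarith)
    · rw [if_neg (by simp; linarith), if_neg (by
        rw [Complex.dist_eq, ← Complex.ofReal_natCast, ← Complex.ofReal_sub, Complex.norm_real,
          Real.norm_eq_abs, abs_of_neg (by linarith)]
        linarith)]
      exact hasWindingNumber_hairpin_of_re_lt (by norm_num) h3.1 (by simp; linarith)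
  have hcircle : ∀ n : ℕ, M ≤ n → circleIntegral f n (1 / 4) = -(2 * Real.pi * Complex.I *
      ((∏ i, Complex.Gamma (a i)) / (∏ j, Complex.Gamma (b j)) *
        (hypergeometricCoeff A B n * z ^ n))) := by
    intro n hn
    have hn' : (M : ℝ) ≤ n := by exact_mod_cast hn
    have h1 := circleIntegral_Gamma_neg_mul n (r := 1 / 4) (by norm_num) (by norm_num)
      (h := fun s => (∏ i, Complex.Gamma (A i - -s)) * (∏ j, (Complex.Gamma (B j - -s))⁻¹) *
        (-z) ^ s) (by
      intro s hs
      have hs' : n - 1 / 4 ≤ s.re := by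
        rw [mem_closedBall_iff_norm] at hs
        have := (abs_le.mp ((Complex.abs_re_le_norm _).trans hs)).1
        simp only [Complex.sub_re, Complex.natCast_re] at this
        linarith
      refine ((DifferentiableAt.fun_finsetProd fun i _ => ?_).fun_mul
        (DifferentiableAt.fun_finsetProd fun j _ => ?_)).fun_mul ?_
      · refine (Complex.differentiableAt_Gamma _ fun m hm => ?_).fun_comp' s (by fun_prop)
        have h2 := congrArg Complex.re hm
        simp [hA] at h2
        linarith [m.cast_nonneg (α := ℝ), hM i]
      · exact (Complex.differentiable_one_div_Gamma _).fun_comp' s (by fun_prop)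
      · exact differentiableAt_id.const_cpow (Or.inl hz0))
    have h2 : f = fun s => Complex.Gamma (-s) * ((∏ i, Complex.Gamma (A i - -s)) *
        (∏ j, (Complex.Gamma (B j - -s))⁻¹) * (-z) ^ s) := by
      funext s
      rw [hf]
      simp only [barnesKernel]
      ring
    rw [h2, h1]
    have h3 := prod_Gamma_add_nat (a := A) (b := B) (fun i => ofReal_ne_neg_nat (ha i))
      (fun j => ofReal_ne_neg_nat (hb j)) n
    have h4 : ((-1 : ℂ) ^ n) * (-z) ^ n = z ^ n := by rw [← mul_pow]; simp
    simp only [sub_neg_eq_add, Complex.cpow_natCast]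
    rw [← mul_assoc (_ / _) (hypergeometricCoeff A B n) (z ^ n), ← h3, ← h4]
    ring
  have hzero : Tendsto (fun N : ℕ => h N) atTop (𝓝 0) := by
    have h1 := tendsto_integral_hairpin_add_nat hdec (c := M - 1 / 2) (r := 1 / 4) (by norm_num)
      fun n t => hairpin_notMem (by norm_num) (fun w hw => by
        have := hPline (n + M) (by omega) w hw
        refine ⟨this.1, fun h2 => this.2 ?_⟩
        rw [h2]
        push_cast
        ring) t
    rw [← tendsto_add_atTop_iff_nat M]
    refine h1.congr fun n => ?_
    simp only [hh]
    have e : (M : ℝ) - 1 / 2 + n = ((n + M : ℕ) : ℝ) - 1 / 2 := by push_cast; ring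
    rw [e]
  have hvert : h M = Complex.I * barnesIntegral A B (1 / 2 - M) (Complex.log (-z)) := by
    obtain ⟨C, δ, l, hδ, hl, hbd⟩ := exists_norm_mul_cpow_le
      (κ := fun s => barnesKernel A B (-s)) (fun δ hδ l hl => by
        obtain ⟨C, hC, h1⟩ := barnesKernel_bound a b δ hδ l hl
        exact ⟨C, hC, fun s hs => by simpa using h1 (-s) (by simpa using hs)⟩) hz0
      (by simpa using hz₁) (by
        rw [abs_lt]
        exact ⟨Complex.neg_pi_lt_arg _, lt_of_le_of_ne (Complex.arg_le_pi _)
          (Complex.slitPlane_arg_ne_pi hz)⟩) (M - 1 / 2)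
    simp only [hh]
    rw [integral_hairpin_eq_integral_vertical hdec (by norm_num) (hPline M le_rfl) hδ hl hbd,
      barnesIntegral, ← MeasureTheory.integral_neg_eq_self]
    congr 1
    refine MeasureTheory.integral_congr_ae (Eventually.of_forall fun t => ?_)
    simp only [hf]
    rw [Complex.cpow_def_of_ne_zero hz0]
    push_cast
    congr 2
    · ring
    · ring
  have hsum : ∀ N, M ≤ N → ∑ n ∈ Finset.Ico M N, hypergeometricCoeff A B n * z ^ n =
      (∏ j, Complex.Gamma (b j)) / (∏ i, Complex.Gamma (a i)) / (2 * Real.pi * Complex.I) *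
        (h M - h N) := by
    intro N hN
    induction N, hN using Nat.le_induction with
    | base => simp
    | succ N hN ih =>
      rw [Finset.sum_Ico_succ_top hN, ih, hstep N hN, hcircle N hN]
      have := Real.pi_ne_zero
      have hpi : (Real.pi : ℂ) ≠ 0 := by exact_mod_cast this
      field_simp
      ring
  have hlim := ((hzero.const_sub (h M)).const_mul
    ((∏ j, Complex.Gamma (b j)) / (∏ i, Complex.Gamma (a i)) / (2 * Real.pi * Complex.I)))
  rw [sub_zero, hvert] at hlim
  have hval : (∏ j, Complex.Gamma (b j)) / (∏ i, Complex.Gamma (a i)) / (2 * Real.pi * Complex.I) *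
      (Complex.I * barnesIntegral A B (1 / 2 - M) (Complex.log (-z))) =
      (∏ j, Complex.Gamma (b j)) / (∏ i, Complex.Gamma (a i)) / (2 * Real.pi) *
        barnesIntegral A B (1 / 2 - M) (Complex.log (-z)) := by
    have hpi : (Real.pi : ℂ) ≠ 0 := by exact_mod_cast Real.pi_ne_zero
    field_simp
  rw [hval] at hlim
  refine hlim.congr' ?_
  filter_upwards [eventually_ge_atTop M] with N hN
  rw [← hvert]
  exact (hsum N hN).symm

end real

/-! ### Barnes's integral outside the unit disc -/

section real

variable {p : ℕ} {a : Fin (p + 1) → ℝ} {b : Fin p → ℝ}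

theorem exists_nat_half_sub_lt (a : Fin (p + 1) → ℝ) : ∃ M : ℕ, ∀ i, 1 / 2 - (M : ℝ) < a i := by
  obtain ⟨A, hA⟩ := (Set.finite_range fun i => 1 / 2 - a i).bddAbove
  obtain ⟨M, hM⟩ := exists_nat_gt A
  exact ⟨M, fun i => by linarith [hA (Set.mem_range_self i)]⟩

/-- Circles of this radius about the poles of `Γ(s)` enclose no pole of the `Γ(aᵢ - s)` and do not meet
each other. -/
theorem exists_radius (ha : ∀ i, ∀ k : ℕ, a i ≠ -(k : ℝ)) :
    ∃ r : ℝ, 0 < r ∧ r < 1 / 2 ∧ ∀ i, ∀ k : ℕ, r < |a i + k| := by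
  have h1 : ∀ i, ∀ᶠ r : ℝ in 𝓝[>] 0, ∀ k : ℕ, r < |a i + k| := by
    intro i
    have h2 : -(a i) ∈ (Set.range ((↑) : ℕ → ℝ))ᶜ := by
      rintro ⟨k, hk⟩
      exact ha i k (by linarith)
    obtain ⟨ε, hε, h3⟩ := Metric.isOpen_iff.mp
      Nat.isClosedEmbedding_coe_real.isClosed_range.isOpen_compl _ h2
    have h4 : ∀ᶠ r : ℝ in 𝓝[>] 0, r < ε := nhdsWithin_le_nhds (gt_mem_nhds hε)
    filter_upwards [h4] with r hr k
    by_contra h5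
    refine h3 (a := (k : ℝ)) ?_ ⟨k, rfl⟩
    rw [Metric.mem_ball, Real.dist_eq, sub_neg_eq_add, add_comm]
    linarith
  have h2 : ∀ᶠ r : ℝ in 𝓝[>] 0, r < 1 / 2 := nhdsWithin_le_nhds (gt_mem_nhds (by norm_num))
  obtain ⟨r, ⟨h3, h4⟩, h5⟩ := (((eventually_all.mpr h1).and h2).and self_mem_nhdsWithin).exists
  exact ⟨r, h5, h4, h3⟩

theorem mem_meijerPoles_barnes {a : Fin (p + 1) → ℂ} {b : Fin p → ℂ} {w : ℂ}
    (hw : w ∈ meijerPoles (p + 1) 1 (Matrix.vecCons 1 b) a) :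
    (∃ i, ∃ k : ℕ, w = a i + k) ∨ ∃ k : ℕ, w = -k := by
  rcases hw with ⟨j, -, k, rfl⟩ | ⟨i, hi, k, rfl⟩
  · exact Or.inl ⟨j, k, rfl⟩
  · right
    refine ⟨k, ?_⟩
    have : i = 0 := by
      apply Fin.ext
      simpa using hi
    simp [this]

theorem dist_ofReal (x y : ℝ) : dist (x : ℂ) y = |x - y| := by
  rw [Complex.dist_eq, ← Complex.ofReal_sub, Complex.norm_real, Real.norm_eq_abs]

theorem dist_neg_nat_neg_nat (k l : ℕ) :
    dist (-(k : ℂ)) (-(l : ℂ)) = |(l : ℝ) - k| := by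
  have := dist_ofReal (-k) (-l)
  push_cast at this
  rw [this]
  congr 1
  ring

/-- A loop separating the poles of `∏ Γ(a_i - s)` from those of `Γ(s)`: a hairpin together with positive
turns around those poles of `Γ(s)` that lie inside the hairpin. The integral over the hairpin is
Barnes's integral and the turns add the first terms of the hypergeometric series. -/
theorem exists_barnesLoop (ha : ∀ i, ∀ k : ℕ, a i ≠ -(k : ℝ)) (hb : ∀ j, ∀ k : ℕ, b j ≠ -(k : ℝ))
    {M : ℕ} (hM : ∀ i, 1 / 2 - (M : ℝ) < a i) : ∃ γ : ℝ → ℂ,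
    IsMeijerLoop (p + 1) 1 (Matrix.vecCons 1 fun j => (b j : ℂ)) (fun i => (a i : ℂ)) γ ∧
    ∀ z : ℂ, 1 < ‖z‖ → -z ∈ Complex.slitPlane →
      (∏ j, Complex.Gamma (b j)) / (∏ i, Complex.Gamma (a i)) / (2 * Real.pi * Complex.I) *
        ∫ t, barnesKernel (fun i => (a i : ℂ)) (fun j => (b j : ℂ)) (γ t) *
          (-z)⁻¹ ^ (γ t) * deriv γ t =
      (∑ n ∈ Finset.range M,
        hypergeometricCoeff (fun i => (a i : ℂ)) (fun j => (b j : ℂ)) n * z ^ n) +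
      (∏ j, Complex.Gamma (b j)) / (∏ i, Complex.Gamma (a i)) / (2 * Real.pi) *
        barnesIntegral (fun i => (a i : ℂ)) (fun j => (b j : ℂ)) (1 / 2 - M) (Complex.log (-z)) := by
  set A : Fin (p + 1) → ℂ := fun i => (a i : ℂ) with hA
  set B : Fin p → ℂ := fun j => (b j : ℂ) with hB
  set P := meijerPoles (p + 1) 1 (Matrix.vecCons 1 B) A with hP
  obtain ⟨r, hr₀, hr₁, hra⟩ := exists_radius ha
  set c : ℝ := 1 / 2 - M with hc
  set S : Finset ℂ := (Finset.range M).image fun k : ℕ => -(k : ℂ) with hS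
  have hinj : Function.Injective fun k : ℕ => -(k : ℂ) :=
    neg_injective.comp Nat.cast_injective
  have hSmem : ∀ v ∈ S, ∃ k : ℕ, k < M ∧ v = -k := by
    intro v hv
    obtain ⟨k, hk, rfl⟩ := Finset.mem_image.mp hv
    exact ⟨k, Finset.mem_range.mp hk, rfl⟩
  have hSc : ∀ v ∈ S, v.im = 0 ∧ c ≤ v.re := by
    intro v hv
    obtain ⟨k, hk, rfl⟩ := hSmem v hv
    refine ⟨by simp, ?_⟩
    have : (k : ℝ) + 1 ≤ M := by exact_mod_cast hk
    simp only [Complex.neg_re, Complex.natCast_re, hc]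
    linarith
  -- distances between the poles of the two kinds
  have hda : ∀ i, ∀ k l : ℕ, r < dist (A i + k) (-(l : ℂ)) := by
    intro i k l
    have := hra i (k + l)
    have e := dist_ofReal (a i + k) (-l)
    push_cast at e this
    simp only [hA]
    rw [e, sub_neg_eq_add, add_assoc]
    exact this
  have hdn : ∀ k l : ℕ, k ≠ l → r < dist (-(k : ℂ)) (-(l : ℂ)) := by
    intro k l hkl
    rw [dist_neg_nat_neg_nat]
    have : 1 ≤ dist l k := Nat.pairwise_one_le_dist hkl.symm
    rw [Nat.dist_eq] at this
    linarith
  have hPc : ∀ w ∈ P, w.im = 0 ∧ w.re ≠ c ∧ ∀ v ∈ S, dist w v ≠ r := by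
    intro w hw
    rcases mem_meijerPoles_barnes hw with ⟨i, k, rfl⟩ | ⟨k, rfl⟩
    · refine ⟨by simp [hA], ?_, fun v hv => ?_⟩
      · have := hM i
        simp only [hA, Complex.add_re, Complex.ofReal_re, Complex.natCast_re]
        exact (by linarith [k.cast_nonneg (α := ℝ)] : c < a i + k).ne'
      · obtain ⟨l, -, rfl⟩ := hSmem v hv
        exact (hda i k l).ne'
    · refine ⟨by simp, fun h => ?_, fun v hv => ?_⟩
      · simp only [Complex.neg_re, Complex.natCast_re, hc] at h
        have h2 : (2 * k + 1 : ℝ) = 2 * M := by linarith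
        have h3 : 2 * k + 1 = 2 * M := by exact_mod_cast h2
        omega
      · obtain ⟨l, -, rfl⟩ := hSmem v hv
        rcases eq_or_ne k l with rfl | hkl
        · rw [dist_self]
          exact hr₀.ne
        · exact (hdn k l hkl).ne'
  obtain ⟨γ, hγ, -, hwind, hint⟩ := exists_hairpin_with_circles hr₀ S hSc
  have hloop : IsMeijerLoop (p + 1) 1 (Matrix.vecCons 1 B) A γ := by
    refine ⟨hγ.lipschitz, hγ.differentiable, hγ.start, hγ.finish, fun i hi k => ?_,
      fun j hj k => ?_⟩
    · have hw : A i + k ∈ P := Or.inl ⟨i, hi, k, rfl⟩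
      have h1 := hwind _ (hPc _ hw).1 (hPc _ hw).2.1 (hPc _ hw).2.2
      rw [if_pos (by
        have := hM i
        simp only [hA, Complex.add_re, Complex.ofReal_re, Complex.natCast_re]
        linarith [k.cast_nonneg (α := ℝ)]), Finset.sum_eq_zero fun v hv => by
          obtain ⟨l, -, rfl⟩ := hSmem v hv
          exact if_neg (hda i k l).not_gt] at h1
      simpa using h1
    · have hj0 : j = 0 := by
        apply Fin.ext
        simpa using hj
      have hw : Matrix.vecCons 1 B j - 1 - k ∈ P := Or.inr ⟨j, hj, k, rfl⟩
      have e : Matrix.vecCons 1 B j - 1 - k = -(k : ℂ) := by simp [hj0]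
      rw [e] at hw ⊢
      have h1 := hwind _ (hPc _ hw).1 (hPc _ hw).2.1 (hPc _ hw).2.2
      rw [hS, Finset.sum_image hinj.injOn] at h1
      simp only [Complex.neg_re, Complex.natCast_re] at h1
      by_cases hk : k < M
      · have hk' : (k : ℝ) + 1 ≤ M := by exact_mod_cast hk
        rw [if_pos (by rw [hc]; linarith), Finset.sum_eq_single_of_mem k (Finset.mem_range.mpr hk)
          fun l _ hl => if_neg (hdn k l hl.symm).not_gt, if_pos (by rwa [dist_self])] at h1
        simpa using h1
      · have hk' : (M : ℝ) ≤ k := by exact_mod_cast not_lt.mp hk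
        rw [if_neg (by rw [hc]; linarith), Finset.sum_eq_zero fun l hl => if_neg
          (hdn k l (by have := Finset.mem_range.mp hl; omega)).not_gt] at h1
        simpa using h1
  refine ⟨γ, hloop, fun z hz₁ hz => ?_⟩
  have hz0 : -z ≠ 0 := Complex.slitPlane_ne_zero hz
  have hw0 : (-z)⁻¹ ≠ 0 := inv_ne_zero hz0
  have hw1 : ‖(-z)⁻¹‖ < 1 := by
    rw [norm_inv, norm_neg]
    exact inv_lt_one_of_one_lt₀ hz₁
  have harg : (-z).arg ≠ Real.pi := Complex.slitPlane_arg_ne_pi hz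
  have hΓa : (∏ i, Complex.Gamma (a i)) ≠ 0 :=
    Finset.prod_ne_zero_iff.mpr fun i _ => Complex.Gamma_ne_zero (ofReal_ne_neg_nat (ha i))
  have hΓb : (∏ j, Complex.Gamma (b j)) ≠ 0 :=
    Finset.prod_ne_zero_iff.mpr fun j _ => Complex.Gamma_ne_zero (ofReal_ne_neg_nat (hb j))
  set f : ℂ → ℂ := fun s => barnesKernel A B s * (-z)⁻¹ ^ s with hf
  have hdec : IsGeometricallyDecaying P f := by
    have := isGeometricallyDecaying_meijerIntegrand (p + 1) 1 (Matrix.vecCons 1 B) A hw0 hw1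
    have e : meijerIntegrand (p + 1) 1 (Matrix.vecCons 1 B) A (-z)⁻¹ = f :=
      funext fun s => meijerIntegrand_eq_barnesKernel A B (-z)⁻¹ s
    rwa [e] at this
  have hvert : ∫ t, f (hairpin c r t) * deriv (hairpin c r) t =
      Complex.I * barnesIntegral A B c (Complex.log (-z)) := by
    obtain ⟨C, δ, l, hδ, hl, hbd⟩ := exists_norm_mul_cpow_le (barnesKernel_bound a b) hw0 hw1 (by
      rw [Complex.abs_arg_inv, abs_lt]
      exact ⟨Complex.neg_pi_lt_arg _, lt_of_le_of_ne (Complex.arg_le_pi _) harg⟩) c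
    rw [integral_hairpin_eq_integral_vertical hdec hr₀ (fun w hw => ⟨(hPc w hw).1, (hPc w hw).2.1⟩)
      hδ hl hbd, barnesIntegral]
    congr 1
    refine MeasureTheory.integral_congr_ae (Eventually.of_forall fun t => ?_)
    simp only [hf]
    rw [Complex.cpow_def_of_ne_zero hw0, Complex.log_inv _ harg]
    congr 2
    ring
  have hcircle : ∀ k : ℕ, circleIntegral f (-k) r = 2 * Real.pi * Complex.I *
      ((∏ i, Complex.Gamma (a i)) / (∏ j, Complex.Gamma (b j)) *
        (hypergeometricCoeff A B k * z ^ k)) := by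
    intro k
    have h1 := circleIntegral_Gamma_mul k hr₀ (by linarith)
      (h := fun s => (∏ i, Complex.Gamma (A i - s)) * (∏ j, (Complex.Gamma (B j - s))⁻¹) *
        (-z)⁻¹ ^ s) (by
      intro s hs
      refine ((DifferentiableAt.fun_finsetProd fun i _ => ?_).fun_mul
        (DifferentiableAt.fun_finsetProd fun j _ => ?_)).fun_mul ?_
      · refine (Complex.differentiableAt_Gamma _ fun m hm => ?_).fun_comp' s (by fun_prop)
        have h2 : s = A i + m := by linear_combination -hm
        rw [Metric.mem_closedBall, h2] at hs
        linarith [hda i m k]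
      · exact (Complex.differentiable_one_div_Gamma _).fun_comp' s (by fun_prop)
      · exact differentiableAt_id.const_cpow (Or.inl hw0))
    have h2 : f = fun s => Complex.Gamma s * ((∏ i, Complex.Gamma (A i - s)) *
        (∏ j, (Complex.Gamma (B j - s))⁻¹) * (-z)⁻¹ ^ s) := by
      funext s
      rw [hf]
      simp only [barnesKernel]
      ring
    rw [h2, h1]
    have h3 := prod_Gamma_add_nat (a := A) (b := B) (fun i => ofReal_ne_neg_nat (ha i))
      (fun j => ofReal_ne_neg_nat (hb j)) k
    have h4 : ((-1 : ℂ) ^ k) * (-z) ^ k = z ^ k := by rw [← mul_pow]; simp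
    have h5 : (-z)⁻¹ ^ (-(k : ℂ)) = (-z) ^ k := by
      rw [Complex.cpow_neg, Complex.cpow_natCast, inv_pow, inv_inv]
    simp only [sub_neg_eq_add]
    rw [h5, ← mul_assoc (_ / _) (hypergeometricCoeff A B k) (z ^ k), ← h3, ← h4]
    ring
  have hmain := hint P f hdec hPc
  rw [hvert, hS, Finset.sum_image hinj.injOn, Finset.sum_congr rfl fun k _ => hcircle k,
    ← Finset.mul_sum, ← Finset.mul_sum] at hmain
  have hpi : (Real.pi : ℂ) ≠ 0 := by exact_mod_cast Real.pi_ne_zero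
  rw [hmain]
  field_simp
  ring

end real

/-! ### The analytic continuation of the hypergeometric series -/

theorem isOpen_cutPlane : IsOpen cutPlane :=
  (Complex.isometry_ofReal.isClosedEmbedding.isClosedMap _ isClosed_Ici).isOpen_compl

theorem zero_mem_cutPlane : (0 : ℂ) ∈ cutPlane := by
  rintro ⟨r, hr, hr0⟩
  have : r = 0 := by exact_mod_cast hr0
  rw [this, Set.mem_Ici] at hr
  linarith

theorem mem_cutPlane_of_im_ne_zero {z : ℂ} (hz : z.im ≠ 0) : z ∈ cutPlane := by
  rintro ⟨r, -, rfl⟩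
  exact hz (Complex.ofReal_im r)

theorem neg_mem_slitPlane_of_mem_cutPlane {z : ℂ} (hz : z ∈ cutPlane) (hz₁ : 1 ≤ ‖z‖) :
    -z ∈ Complex.slitPlane := by
  rw [Complex.mem_slitPlane_iff]
  by_contra! h
  have him : z.im = 0 := by simpa using h.2
  have hre : 0 ≤ z.re := by simpa using h.1
  have he : z = (z.re : ℂ) := Complex.ext rfl (by simpa using him)
  refine hz ⟨z.re, ?_, he.symm⟩
  rw [he, Complex.norm_real, Real.norm_of_nonneg hre] at hz₁
  exact hz₁

theorem isPreconnected_cutPlane : IsPreconnected cutPlane := by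
  have h : StarConvex ℝ 0 cutPlane := by
    rw [starConvex_zero_iff]
    rintro z hz t ht₀ ht₁ ⟨r, hr, hrz⟩
    rw [Set.mem_Ici] at hr
    have ht : 0 < t := by
      rcases ht₀.eq_or_lt with rfl | h
      · rw [zero_smul] at hrz
        have : r = 0 := by exact_mod_cast hrz
        linarith
      · exact h
    refine hz ⟨r / t, ?_, ?_⟩
    · rw [Set.mem_Ici, le_div_iff₀ ht]
      linarith
    · have htc : (t : ℂ) ≠ 0 := by exact_mod_cast ht.ne'
      rw [Complex.real_smul] at hrz
      push_cast
      rw [hrz]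
      field_simp
  exact (h.isPathConnected zero_mem_cutPlane).isConnected.isPreconnected

theorem IsHypergeometricContinuation.eqOn {p : ℕ} {a : Fin (p + 1) → ℂ} {b : Fin p → ℂ} {f g : ℂ → ℂ}
    (hf : IsHypergeometricContinuation a b f) (hg : IsHypergeometricContinuation a b g) :
    Set.EqOn f g cutPlane := by
  refine hf.1.eqOn_of_preconnected_of_eventuallyEq hg.1 isPreconnected_cutPlane zero_mem_cutPlane ?_
  filter_upwards [Metric.ball_mem_nhds (0 : ℂ) one_pos] with z hz
  have hz' : ‖z‖ < 1 := by simpa using hz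
  exact (hf.2 z hz').unique (hg.2 z hz')

theorem IsHypergeometricContinuation.hypergeometric_eqOn {p : ℕ} {a : Fin (p + 1) → ℂ} {b : Fin p → ℂ}
    {f : ℂ → ℂ} (hf : IsHypergeometricContinuation a b f) :
    Set.EqOn (hypergeometric a b) f cutPlane := by
  have hex : ∃ f, IsHypergeometricContinuation a b f := ⟨f, hf⟩
  rw [hypergeometric, dif_pos hex]
  exact hex.choose_spec.eqOn hf

/-- Since `(a)ₙ₊₁ = (a)ₙ (a + n)`, the ratio of consecutive coefficients tends to `1`. -/
theorem summable_hypergeometricCoeff {p : ℕ} (a : Fin (p + 1) → ℂ) (b : Fin p → ℂ) {z : ℂ}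
    (hz : ‖z‖ < 1) : Summable fun n => hypergeometricCoeff a b n * z ^ n := by
  set R : ℕ → ℂ := fun n => ((a 0 + n) / (1 + n)) * ∏ j : Fin p, (a j.succ + n) / (b j + n) with hR
  have hstep : ∀ n, hypergeometricCoeff a b (n + 1) = R n * hypergeometricCoeff a b n := by
    intro n
    simp only [hypergeometricCoeff, hR, ascPochhammer_succ_eval, Finset.prod_mul_distrib,
      Nat.factorial_succ, Finset.prod_div_distrib]
    rw [Fin.prod_univ_succ (fun i => a i + (n : ℂ))]
    push_cast
    rw [add_comm (n : ℂ) 1]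
    simp only [div_eq_mul_inv, mul_inv]
    ring
  have hfac : ∀ u v : ℂ, Tendsto (fun n : ℕ => (u + n) / (v + n)) atTop (𝓝 1) := by
    intro u v
    simpa using tendsto_add_mul_div_add_mul_atTop_nhds u v (1 : ℂ) (one_ne_zero (α := ℂ))
  have hlim : Tendsto (fun n => ‖R n * z‖) atTop (𝓝 ‖z‖) := by
    have h1 : Tendsto R atTop (𝓝 1) := by
      have h2 := (hfac (a 0) 1).mul
        (tendsto_finsetProd (Finset.univ : Finset (Fin p)) fun j _ => hfac (a j.succ) (b j))
      rwa [Finset.prod_const_one, one_mul] at h2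
    simpa using (h1.mul_const z).norm
  obtain ⟨q, hq₁, hq₂⟩ := exists_between hz
  refine summable_of_ratio_norm_eventually_le hq₂ ?_
  filter_upwards [hlim.eventually (gt_mem_nhds hq₁)] with n hn
  rw [hstep, pow_succ, show R n * hypergeometricCoeff a b n * (z ^ n * z) =
    R n * z * (hypergeometricCoeff a b n * z ^ n) by ring, norm_mul]
  gcongr

theorem differentiableAt_tsum_hypergeometricCoeff {p : ℕ} (a : Fin (p + 1) → ℂ) (b : Fin p → ℂ) {z : ℂ}
    (hz : ‖z‖ < 1) :
    DifferentiableAt ℂ (fun z => ∑' n, hypergeometricCoeff a b n * z ^ n) z := by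
  obtain ⟨r, hr₁, hr₂⟩ := exists_between hz
  have hr₀ : 0 ≤ r := (norm_nonneg z).trans hr₁.le
  have h : DifferentiableOn ℂ (fun z => ∑' n, hypergeometricCoeff a b n * z ^ n)
      (Metric.ball 0 r) := by
    refine Complex.differentiableOn_tsum_of_summable_norm
      (summable_hypergeometricCoeff a b (z := (r : ℂ)) (by
        rwa [Complex.norm_real, Real.norm_of_nonneg hr₀])).norm (fun n => by fun_prop)
      Metric.isOpen_ball fun n w hw => ?_
    rw [norm_mul, norm_mul, norm_pow, norm_pow, Complex.norm_real, Real.norm_of_nonneg hr₀]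
    have hw' : ‖w‖ ≤ r := (by simpa using hw : ‖w‖ < r).le
    gcongr
  exact h.differentiableAt (Metric.isOpen_ball.mem_nhds (by simpa using hr₁))

section real

variable {p : ℕ} {a : Fin (p + 1) → ℝ} {b : Fin p → ℝ}

theorem differentiableAt_barnesIntegral {M : ℕ} (hM : ∀ i, 1 / 2 - (M : ℝ) < a i) {L : ℂ}
    (hL : |L.im| < Real.pi) :
    DifferentiableAt ℂ (barnesIntegral (fun i => (a i : ℂ)) (fun j => (b j : ℂ)) (1 / 2 - M)) L := by
  have hg : Continuous fun t : ℝ => barnesKernel (fun i => (a i : ℂ)) (fun j => (b j : ℂ))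
      (((1 / 2 - M : ℝ) : ℂ) + t * Complex.I) := by
    rw [continuous_iff_continuousAt]
    intro t
    set s : ℂ := ((1 / 2 - M : ℝ) : ℂ) + t * Complex.I with hs
    have hsre : s.re = 1 / 2 - M := by simp [hs]
    have h1 : DifferentiableAt ℂ (barnesKernel (fun i => (a i : ℂ)) (fun j => (b j : ℂ))) s := by
      refine ((Complex.differentiableAt_Gamma _ fun m hm => ?_).fun_mul
        (DifferentiableAt.fun_finsetProd fun i _ => ?_)).fun_mul
        (DifferentiableAt.fun_finsetProd fun j _ => ?_)
      · have h2 := congrArg Complex.re hm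
        rw [hsre, Complex.neg_re, Complex.natCast_re] at h2
        have h3 : (2 * m + 1 : ℝ) = 2 * M := by linarith
        have h4 : 2 * m + 1 = 2 * M := by exact_mod_cast h3
        omega
      · refine (Complex.differentiableAt_Gamma _ fun m hm => ?_).fun_comp' s (by fun_prop)
        have h2 := congrArg Complex.re hm
        rw [Complex.sub_re, hsre, Complex.neg_re, Complex.natCast_re, Complex.ofReal_re] at h2
        linarith [m.cast_nonneg (α := ℝ), hM i]
      · exact (Complex.differentiable_one_div_Gamma _).fun_comp' s (by fun_prop)
    exact h1.continuousAt.comp (f := fun t : ℝ => ((1 / 2 - M : ℝ) : ℂ) + t * Complex.I)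
      (by fun_prop)
  refine differentiableAt_integral_mul_exp hg _ (fun δ hδ => ?_) hL
  obtain ⟨C, hC, h⟩ := barnesKernel_bound a b δ hδ 1 one_pos
  refine exists_norm_le_mul_exp_of_abs_ge hg (C := C * Real.exp |(1 / 2 - M : ℝ)|) fun t ht => ?_
  have := h (((1 / 2 - M : ℝ) : ℂ) + t * Complex.I) (by simpa using ht)
  refine this.trans (le_of_eq ?_)
  simp
  ring

/-- Barnes's integral, together with the first `M` terms of the series, continues the
hypergeometric series. -/
theorem exists_isHypergeometricContinuation (ha : ∀ i, ∀ k : ℕ, a i ≠ -(k : ℝ))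
    (hb : ∀ j, ∀ k : ℕ, b j ≠ -(k : ℝ)) {M : ℕ} (hM : ∀ i, 1 / 2 - (M : ℝ) < a i) :
    ∃ f, IsHypergeometricContinuation (fun i => (a i : ℂ)) (fun j => (b j : ℂ)) f ∧
      ∀ z : ℂ, 1 < ‖z‖ → f z = (∑ n ∈ Finset.range M,
        hypergeometricCoeff (fun i => (a i : ℂ)) (fun j => (b j : ℂ)) n * z ^ n) +
      (∏ j, Complex.Gamma (b j)) / (∏ i, Complex.Gamma (a i)) / (2 * Real.pi) *
        barnesIntegral (fun i => (a i : ℂ)) (fun j => (b j : ℂ)) (1 / 2 - M)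
          (Complex.log (-z)) := by
  classical
  set A : Fin (p + 1) → ℂ := fun i => (a i : ℂ) with hA
  set B : Fin p → ℂ := fun j => (b j : ℂ) with hB
  set G : ℂ → ℂ := fun z => (∑ n ∈ Finset.range M, hypergeometricCoeff A B n * z ^ n) +
      (∏ j, Complex.Gamma (b j)) / (∏ i, Complex.Gamma (a i)) / (2 * Real.pi) *
        barnesIntegral A B (1 / 2 - M) (Complex.log (-z)) with hG
  have hGd : ∀ z, -z ∈ Complex.slitPlane → DifferentiableAt ℂ G z := by
    intro z hz
    have h1 : DifferentiableAt ℂ (fun z : ℂ => Complex.log (-z)) z :=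
      differentiableAt_id.neg.clog hz
    have h2 : |(Complex.log (-z)).im| < Real.pi := by
      rw [Complex.log_im, abs_lt]
      exact ⟨Complex.neg_pi_lt_arg _, lt_of_le_of_ne (Complex.arg_le_pi _)
        (Complex.slitPlane_arg_ne_pi hz)⟩
    have h3 := (differentiableAt_barnesIntegral (b := b) hM h2).fun_comp' z h1
    exact DifferentiableAt.fun_add (by fun_prop) (h3.const_mul _)
  have hGs : ∀ z, ‖z‖ < 1 → -z ∈ Complex.slitPlane →
      ∑' n, hypergeometricCoeff A B n * z ^ n = G z := by
    intro z hz₁ hz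
    have h1 := (summable_hypergeometricCoeff A B hz₁).hasSum.tendsto_sum_nat
    refine tendsto_nhds_unique h1 ?_
    refine ((tendsto_sum_hypergeometricCoeff ha hb hM hz₁ hz).const_add
      (∑ n ∈ Finset.range M, hypergeometricCoeff A B n * z ^ n)).congr' ?_
    filter_upwards [eventually_ge_atTop M] with N hN
    rw [← Finset.sum_range_add_sum_Ico _ hN]
  set f : ℂ → ℂ := fun z => if ‖z‖ < 1 then ∑' n, hypergeometricCoeff A B n * z ^ n else G z with hf
  refine ⟨f, ⟨?_, fun z hz => ?_⟩, fun z hz => if_neg hz.not_gt⟩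
  · refine DifferentiableOn.analyticOnNhd (fun z hz => DifferentiableAt.differentiableWithinAt ?_)
      isOpen_cutPlane
    rcases lt_or_ge ‖z‖ 1 with h | h
    · refine (differentiableAt_tsum_hypergeometricCoeff A B h).congr_of_eventuallyEq ?_
      filter_upwards [continuous_norm.continuousAt.eventually (gt_mem_nhds h)] with w hw
      exact if_pos hw
    · have hz' := neg_mem_slitPlane_of_mem_cutPlane hz h
      refine (hGd z hz').congr_of_eventuallyEq ?_
      filter_upwards [continuous_neg.continuousAt.eventually
        (Complex.isOpen_slitPlane.mem_nhds hz')] with w hw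
      rcases lt_or_ge ‖w‖ 1 with h' | h'
      · rw [hf]
        exact (if_pos h').trans (hGs w h' hw)
      · exact if_neg h'.not_gt
  · have h1 : f z = ∑' n, hypergeometricCoeff A B n * z ^ n := if_pos hz
    rw [h1]
    exact (summable_hypergeometricCoeff A B hz).hasSum

end real

/-- If an upper parameter is a nonpositive integer, the series is a polynomial. -/
theorem isHypergeometricContinuation_of_eq_neg_nat {p : ℕ} {a : Fin (p + 1) → ℂ} (b : Fin p → ℂ)
    {i : Fin (p + 1)} {k : ℕ} (ha : a i = -k) : IsHypergeometricContinuation a b fun z =>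
      ∑ n ∈ Finset.range (k + 1), hypergeometricCoeff a b n * z ^ n := by
  refine ⟨DifferentiableOn.analyticOnNhd (by fun_prop) isOpen_cutPlane, fun z _ => ?_⟩
  refine hasSum_sum_of_ne_finset_zero (f := fun n => hypergeometricCoeff a b n * z ^ n) fun n hn => ?_
  have h1 : (ascPochhammer ℂ n).eval (a i) = 0 := by
    rw [ha]
    exact ascPochhammer_eval_neg_coe_nat_of_lt (by simpa using hn)
  rw [hypergeometricCoeff, Finset.prod_eq_zero (Finset.mem_univ i) h1, zero_div, zero_mul]

/-! ### Boundary values on the cut -/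

namespace IsCurveFromInfinity

variable {γ : ℝ → ℂ}

/-- A curve from `+∞` to `+∞` lies in a half-strip. -/
theorem exists_bound (h : IsCurveFromInfinity γ) :
    ∃ C : ℝ, 0 ≤ C ∧ ∀ t, |(γ t).im| ≤ C ∧ -C ≤ (γ t).re := by
  obtain ⟨c₁, T₁, hs⟩ := h.start
  obtain ⟨c₂, T₂, hf⟩ := h.finish
  obtain ⟨B, hB⟩ := (isCompact_Icc (a := T₁) (b := T₂)).exists_bound_of_continuousOn
    h.continuous.continuousOn
  refine ⟨|B| + (‖c₁‖ + |T₁|) + (‖c₂‖ + |T₂|), by positivity, fun t => ?_⟩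
  have hB' := abs_nonneg B
  have h1 := norm_nonneg c₁
  have h2 := norm_nonneg c₂
  have h3 := Complex.abs_re_le_norm c₁
  have h4 := Complex.abs_re_le_norm c₂
  have h5 := Complex.abs_im_le_norm c₁
  have h6 := Complex.abs_im_le_norm c₂
  rw [abs_le] at h3 h4
  rcases le_or_gt t T₁ with ht₁ | ht₁
  · rw [hs t ht₁]
    simp only [Complex.sub_im, Complex.ofReal_im, sub_zero, Complex.sub_re, Complex.ofReal_re]
    constructor
    · linarith [abs_nonneg T₁, abs_nonneg T₂]
    · linarith [le_abs_self T₁, abs_nonneg T₂]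
  rcases le_or_gt T₂ t with ht₂ | ht₂
  · rw [hf t ht₂]
    simp only [Complex.add_im, Complex.ofReal_im, add_zero, Complex.add_re, Complex.ofReal_re]
    constructor
    · linarith [abs_nonneg T₁, abs_nonneg T₂]
    · linarith [neg_abs_le T₂, abs_nonneg T₁]
  have h7 := (hB t ⟨ht₁.le, ht₂.le⟩).trans (le_abs_self B)
  have h8 := Complex.abs_im_le_norm (γ t)
  have h9 := abs_le.mp (Complex.abs_re_le_norm (γ t))
  constructor
  · linarith [abs_nonneg T₁, abs_nonneg T₂]
  · linarith [abs_nonneg T₁, abs_nonneg T₂]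

/-- The imaginary part of `γ` is bounded and its real part is bounded below, so that `exp (-γ L)` is
dominated by `exp (-ρ γ)` for `L` in bounded sets with `ρ ≤ Re L`. -/
theorem continuousAt_integral_mul_exp (h : IsCurveFromInfinity γ) {g : ℝ → ℂ}
    (hg : ∀ ρ : ℝ, 0 < ρ → MeasureTheory.Integrable fun t => g t * Complex.exp (-γ t * ρ)) {L₀ : ℂ}
    (hL₀ : 0 < L₀.re) :
    ContinuousAt (fun L : ℂ => ∫ t, g t * Complex.exp (-γ t * L)) L₀ := by
  obtain ⟨C, hC, hγ⟩ := h.exists_bound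
  set ρ := L₀.re / 2 with hρ
  have hρ₀ : 0 < ρ := by rw [hρ]; linarith
  have hsplit : ∀ L t, g t * Complex.exp (-γ t * L) =
      (g t * Complex.exp (-γ t * ρ)) * Complex.exp (-γ t * (L - ρ)) := by
    intro L t
    rw [mul_assoc, ← Complex.exp_add]
    ring_nf
  have h1 : ∀ᶠ L : ℂ in 𝓝 L₀, ρ < L.re :=
    Complex.continuous_re.continuousAt.eventually (lt_mem_nhds (by rw [hρ]; linarith))
  have h2 : ∀ᶠ L : ℂ in 𝓝 L₀, ‖L‖ < ‖L₀‖ + 1 :=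
    continuous_norm.continuousAt.eventually (gt_mem_nhds (by linarith))
  have e : (fun L : ℂ => ∫ t, g t * Complex.exp (-γ t * L)) = fun L =>
      ∫ t, (g t * Complex.exp (-γ t * ρ)) * Complex.exp (-γ t * (L - ρ)) :=
    funext fun L => MeasureTheory.integral_congr_ae (Eventually.of_forall (hsplit L))
  rw [e]
  refine MeasureTheory.continuousAt_of_dominated
    (bound := fun t => ‖g t * Complex.exp (-γ t * ρ)‖ *
      Real.exp (C * (‖L₀‖ + 1) + C * (‖L₀‖ + 1))) ?_ ?_ ((hg ρ hρ₀).norm.mul_const _) ?_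
  · refine Eventually.of_forall fun L => (hg ρ hρ₀).aestronglyMeasurable.mul ?_
    have := h.continuous
    exact Continuous.aestronglyMeasurable (by fun_prop)
  · filter_upwards [h1, h2] with L hL₁ hL₂
    refine Eventually.of_forall fun t => ?_
    rw [norm_mul]
    refine mul_le_mul_of_nonneg_left ?_ (norm_nonneg _)
    rw [Complex.norm_exp]
    refine Real.exp_le_exp.mpr ?_
    simp only [Complex.mul_re, Complex.neg_re, Complex.neg_im, Complex.sub_re, Complex.sub_im,
      Complex.ofReal_re, Complex.ofReal_im, sub_zero]
    have h3 := abs_le.mp ((Complex.abs_re_le_norm L).trans hL₂.le)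
    have h4 := (Complex.abs_im_le_norm L).trans hL₂.le
    have h5 : (γ t).im * L.im ≤ C * (‖L₀‖ + 1) := by
      refine (le_abs_self _).trans ?_
      rw [abs_mul]
      exact mul_le_mul (hγ t).1 h4 (abs_nonneg _) hC
    have h6 : -(γ t).re * (L.re - ρ) ≤ C * (‖L₀‖ + 1) :=
      mul_le_mul (by linarith [(hγ t).2]) (by linarith) (by linarith) hC
    linarith
  · exact Eventually.of_forall fun t => by fun_prop

theorem integrable_mul_exp (h : IsCurveFromInfinity γ) {g : ℝ → ℂ} {L : ℂ}
    (hg : MeasureTheory.Integrable fun t => g t * Complex.exp (-γ t * L.re)) :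
    MeasureTheory.Integrable fun t => g t * Complex.exp (-γ t * L) := by
  obtain ⟨C, hC, hγ⟩ := h.exists_bound
  have hc := h.continuous
  have e : (fun t => g t * Complex.exp (-γ t * L)) = fun t =>
      (g t * Complex.exp (-γ t * L.re)) * Complex.exp (-γ t * (L - L.re)) := by
    funext t
    rw [mul_assoc, ← Complex.exp_add]
    ring_nf
  rw [e]
  refine hg.mul_bdd (c := Real.exp (C * |L.im|)) (Continuous.aestronglyMeasurable (by fun_prop))
    (Eventually.of_forall fun t => ?_)
  rw [Complex.norm_exp]
  refine Real.exp_le_exp.mpr ?_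
  simp only [Complex.mul_re, Complex.neg_re, Complex.sub_re, Complex.sub_im,
    Complex.ofReal_re, Complex.ofReal_im, sub_zero, sub_self, mul_zero, zero_sub, neg_mul, neg_neg]
  refine (le_abs_self _).trans ?_
  rw [abs_mul]
  exact mul_le_mul_of_nonneg_right (hγ t).1 (abs_nonneg _)

end IsCurveFromInfinity

section real

variable {p : ℕ} {a : Fin (p + 1) → ℝ} {b : Fin p → ℝ}

/-- The boundary values of the hypergeometric function on the cut as integrals over one loop, which
converge absolutely. Off the real axis `(-z)⁻¹ ^ s = exp (-s (log z ∓ πi))`, the sign being that of `Im z`, and the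
integrals over the loop are continuous up to the cut. -/
theorem exists_loop_tendsto_hypergeometric (ha : ∀ i, ∀ k : ℕ, a i ≠ -(k : ℝ))
    (hb : ∀ j, ∀ k : ℕ, b j ≠ -(k : ℝ)) : ∃ γ : ℝ → ℂ,
    IsMeijerLoop (p + 1) 1 (Matrix.vecCons 1 fun j => (b j : ℂ)) (fun i => (a i : ℂ)) γ ∧
    (∀ L : ℂ, 0 < L.re → MeasureTheory.Integrable fun t =>
      barnesKernel (fun i => (a i : ℂ)) (fun j => (b j : ℂ)) (γ t) * deriv γ t *
        Complex.exp (-γ t * L)) ∧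
    ∀ x : ℝ, 1 < x →
      Tendsto (hypergeometric (fun i => (a i : ℂ)) (fun j => (b j : ℂ)))
        (𝓝[{z : ℂ | 0 < z.im}] (x : ℂ))
        (𝓝 ((∏ j, Complex.Gamma (b j)) / (∏ i, Complex.Gamma (a i)) / (2 * Real.pi * Complex.I) *
          ∫ t, barnesKernel (fun i => (a i : ℂ)) (fun j => (b j : ℂ)) (γ t) * deriv γ t *
            Complex.exp (-γ t * (Real.log x - Real.pi * Complex.I)))) ∧
      Tendsto (hypergeometric (fun i => (a i : ℂ)) (fun j => (b j : ℂ)))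
        (𝓝[{z : ℂ | z.im < 0}] (x : ℂ))
        (𝓝 ((∏ j, Complex.Gamma (b j)) / (∏ i, Complex.Gamma (a i)) / (2 * Real.pi * Complex.I) *
          ∫ t, barnesKernel (fun i => (a i : ℂ)) (fun j => (b j : ℂ)) (γ t) * deriv γ t *
            Complex.exp (-γ t * (Real.log x + Real.pi * Complex.I)))) := by
  obtain ⟨M, hM⟩ := exists_nat_half_sub_lt a
  obtain ⟨γ, hγ, hint⟩ := exists_barnesLoop ha hb hM
  obtain ⟨f, hf, hfout⟩ := exists_isHypergeometricContinuation ha hb hM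
  set A : Fin (p + 1) → ℂ := fun i => (a i : ℂ) with hA
  set B : Fin p → ℂ := fun j => (b j : ℂ) with hB
  have hcurve := hγ.isCurveFromInfinity
  have hI : ∀ ρ : ℝ, 0 < ρ → MeasureTheory.Integrable fun t =>
      barnesKernel A B (γ t) * deriv γ t * Complex.exp (-γ t * ρ) := by
    intro ρ hρ
    have hz : ‖Complex.exp (-ρ)‖ < 1 := by
      rw [Complex.norm_exp]
      simpa using hρ
    have h1 := (isGeometricallyDecaying_meijerIntegrand (p + 1) 1 (Matrix.vecCons 1 B) A
      (Complex.exp_ne_zero (-ρ)) hz).integrable hcurve hγ.notMem_meijerPoles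
    refine h1.congr (Eventually.of_forall fun t => ?_)
    simp only [meijerIntegrand_eq_barnesKernel]
    rw [Complex.cpow_def_of_ne_zero (Complex.exp_ne_zero _), Complex.log_exp (by
      simpa using Real.pi_pos) (by simpa using Real.pi_pos.le)]
    ring_nf
  have hside : ∀ (S : Set ℂ) (w : ℂ), w.re = 0 →
      (∀ z ∈ S, z.im ≠ 0 ∧ Complex.log (-z) = Complex.log z + w) → ∀ x : ℝ, 1 < x →
      Tendsto (hypergeometric A B) (𝓝[S] (x : ℂ))
        (𝓝 ((∏ j, Complex.Gamma (b j)) / (∏ i, Complex.Gamma (a i)) / (2 * Real.pi * Complex.I) *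
          ∫ t, barnesKernel A B (γ t) * deriv γ t *
            Complex.exp (-γ t * (Real.log x + w)))) := by
    intro S w hw hS x hx
    have h1 := hcurve.continuousAt_integral_mul_exp hI (L₀ := Real.log x + w) (by
      simpa [hw] using Real.log_pos hx)
    have h2 : ContinuousAt (fun z => Complex.log z + w) (x : ℂ) :=
      (continuousAt_clog (Complex.ofReal_mem_slitPlane.mpr (by linarith))).add continuousAt_const
    rw [Complex.ofReal_log (by linarith)] at h1 ⊢
    have h3 := ((ContinuousAt.comp (f := fun z => Complex.log z + w) h1 h2).tendsto.const_mul
      ((∏ j, Complex.Gamma (b j)) / (∏ i, Complex.Gamma (a i)) /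
        (2 * Real.pi * Complex.I))).mono_left (nhdsWithin_le_nhds (s := S))
    refine h3.congr' ?_
    have h4 : ∀ᶠ z : ℂ in 𝓝 (x : ℂ), 1 < ‖z‖ := continuous_norm.continuousAt.eventually
      (lt_mem_nhds (by simpa using hx.trans_le (le_abs_self x)))
    filter_upwards [self_mem_nhdsWithin, nhdsWithin_le_nhds h4] with z hzS hz
    have hz₁ : -z ∈ Complex.slitPlane := Complex.mem_slitPlane_iff.mpr (Or.inr (by
      simpa using (hS z hzS).1))
    rw [hf.hypergeometric_eqOn (mem_cutPlane_of_im_ne_zero (hS z hzS).1), hfout z hz,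
      ← hint z hz hz₁]
    simp only [Function.comp_apply]
    congr 1
    refine MeasureTheory.integral_congr_ae (Eventually.of_forall fun t => ?_)
    simp only
    rw [← (hS z hzS).2, Complex.cpow_def_of_ne_zero (inv_ne_zero (Complex.slitPlane_ne_zero hz₁)),
      Complex.log_inv _ (Complex.slitPlane_arg_ne_pi hz₁)]
    ring_nf
  refine ⟨γ, hγ, fun L hL => hcurve.integrable_mul_exp (hI _ hL), fun x hx => ⟨?_, ?_⟩⟩
  · have := hside {z : ℂ | 0 < z.im} (-(Real.pi * Complex.I)) (by simp) (fun z hz => ⟨ne_of_gt hz, by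
      rw [log_of_im_pos hz]; ring⟩) x hx
    simpa only [sub_eq_add_neg] using this
  · exact hside {z : ℂ | z.im < 0} (Real.pi * Complex.I) (by simp) (fun z hz => ⟨ne_of_lt hz, by
      rw [log_of_im_neg hz]; ring⟩) x hx

end real

/-! ### The jump and the average across the cut -/

/-- Unlike in the reflection formula with `sin (π s)` as a denominator, the positive integers need not be
excluded; there both sides are `0`. -/
theorem Gamma_mul_sin_eq {s : ℂ} (hs : ∀ k : ℕ, s ≠ -k) :
    Complex.Gamma s * Complex.sin (Real.pi * s) = Real.pi * (Complex.Gamma (1 - s))⁻¹ := by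
  have h := Complex.Gamma_mul_Gamma_one_sub s
  have hΓ := Complex.Gamma_ne_zero hs
  by_cases h0 : Complex.sin (Real.pi * s) = 0
  · rw [h0, div_zero] at h
    rw [h0, (mul_eq_zero.mp h).resolve_left hΓ]
    simp
  · have hpi : (Real.pi : ℂ) ≠ 0 := by exact_mod_cast Real.pi_ne_zero
    have h1 : Complex.Gamma (1 - s) ≠ 0 := fun h1 => by
      rw [h1, mul_zero] at h
      exact div_ne_zero hpi h0 h.symm
    rw [eq_div_iff h0] at h
    rw [eq_mul_inv_iff_mul_eq₀ h1]
    linear_combination h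

theorem cos_eq_inv_Gamma_mul (s : ℂ) : Complex.cos (Real.pi * s) =
    -(Real.pi * ((Complex.Gamma (s - 1 / 2))⁻¹ * (Complex.Gamma (1 - (s - 1 / 2)))⁻¹)) := by
  have h := Complex.Gamma_mul_Gamma_one_sub (s - 1 / 2)
  rw [show (Real.pi : ℂ) * (s - 1 / 2) = Real.pi * s - Real.pi / 2 by ring,
    Complex.sin_sub_pi_div_two] at h
  rw [← mul_inv, h]
  have hpi : (Real.pi : ℂ) ≠ 0 := by exact_mod_cast Real.pi_ne_zero
  field_simp

theorem meijerIntegrand_zero_eq {p : ℕ} (a : Fin (p + 1) → ℂ) (b : Fin p → ℂ) (z : ℂ) {s : ℂ}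
    (hs : ∀ k : ℕ, s ≠ -k) :
    Real.pi * meijerIntegrand (p + 1) 0 (Matrix.vecCons 1 b) a z s =
      barnesKernel a b s * Complex.sin (Real.pi * s) * z ^ s := by
  have h1 : (∏ j : Fin (p + 1), if (j : ℕ) < p + 1 then Complex.Gamma (a j - s)
      else (Complex.Gamma (1 - a j + s))⁻¹) = ∏ j, Complex.Gamma (a j - s) :=
    Finset.prod_congr rfl fun j _ => if_pos j.2
  have h2 := Gamma_mul_sin_eq hs
  have h3 : (∏ i : Fin (p + 1), if (i : ℕ) < 0 then Complex.Gamma (1 - Matrix.vecCons (1 : ℂ) b i + s)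
      else (Complex.Gamma (Matrix.vecCons (1 : ℂ) b i - s))⁻¹) =
      (Complex.Gamma (1 - s))⁻¹ * ∏ j, (Complex.Gamma (b j - s))⁻¹ := by
    rw [Fin.prod_univ_succ]
    rfl
  rw [meijerIntegrand, h1, h3, barnesKernel]
  linear_combination (-(∏ j, Complex.Gamma (a j - s)) * (∏ j, (Complex.Gamma (b j - s))⁻¹) *
    z ^ s) * h2

/-- With `cos (π s) = -sin (π (s - 1/2))` the reflection formula at `s - 1/2` produces the parameters `1` of
the integrand. -/
theorem meijerIntegrand_half_eq {p : ℕ} (a : Fin (p + 1) → ℂ) (b : Fin p → ℂ) {z : ℂ} (hz : z ≠ 0)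
    (s : ℂ) :
    -(Real.pi * meijerIntegrand (p + 1) 1 (Matrix.vecCons (1 / 2) (Matrix.vecCons 1 fun j => b j - 1 / 2))
      (Fin.snoc (α := fun _ => ℂ) (fun i => a i - 1 / 2) 1) z (s - 1 / 2)) =
      barnesKernel a b s * Complex.cos (Real.pi * s) * z ^ s * z ^ (-(1 / 2) : ℂ) := by
  have h1 : (∏ j : Fin (p + 2), if (j : ℕ) < p + 1
      then Complex.Gamma (Fin.snoc (α := fun _ => ℂ) (fun i => a i - 1 / 2) 1 j - (s - 1 / 2))
      else (Complex.Gamma (1 - Fin.snoc (α := fun _ => ℂ) (fun i => a i - 1 / 2) 1 j +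
        (s - 1 / 2)))⁻¹) = (∏ i, Complex.Gamma (a i - s)) * (Complex.Gamma (s - 1 / 2))⁻¹ := by
    rw [Fin.prod_univ_castSucc]
    congr 1
    · refine Finset.prod_congr rfl fun i _ => ?_
      rw [if_pos (by rw [Fin.val_castSucc]; exact i.2), Fin.snoc_castSucc, sub_sub_sub_cancel_right]
    · rw [if_neg (by simp), Fin.snoc_last, sub_self, zero_add]
  have h2 : (∏ i : Fin (p + 2), if (i : ℕ) < 1
      then Complex.Gamma (1 - Matrix.vecCons (1 / 2 : ℂ)
        (Matrix.vecCons 1 fun j => b j - 1 / 2) i + (s - 1 / 2))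
      else (Complex.Gamma (Matrix.vecCons (1 / 2 : ℂ)
        (Matrix.vecCons 1 fun j => b j - 1 / 2) i - (s - 1 / 2)))⁻¹) =
      Complex.Gamma s * ((Complex.Gamma (1 - (s - 1 / 2)))⁻¹ *
        ∏ j, (Complex.Gamma (b j - s))⁻¹) := by
    rw [Fin.prod_univ_succ, Fin.prod_univ_succ]
    congr 1
    · rw [if_pos (by simp), Matrix.cons_val_zero]
      congr 1
      ring
    · congr 1
      refine Finset.prod_congr rfl fun j _ => ?_
      rw [if_neg (by simp), Matrix.cons_val_succ, Matrix.cons_val_succ, sub_sub_sub_cancel_right]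
  rw [meijerIntegrand, h1, h2, barnesKernel, cos_eq_inv_Gamma_mul s, sub_eq_add_neg s (1 / 2),
    Complex.cpow_add _ _ hz]
  ring

theorem HasWindingNumber.sub_const {γ : ℝ → ℂ} {w : ℂ} {k : ℤ} (h : HasWindingNumber γ w k) (c : ℂ) :
    HasWindingNumber (fun t => γ t - c) (w - c) k := by
  refine ⟨fun t ht => h.1 t (sub_left_injective ht), ?_⟩
  simpa only [deriv_sub_const, sub_sub_sub_cancel_right] using h.2

theorem IsMeijerLoop.hasMeijerG_meijerG {m n p : ℕ} {a b : Fin p → ℂ} {γ : ℝ → ℂ}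
    (h : IsMeijerLoop m n a b γ) {z : ℂ} (hz : z ≠ 0) (hz₁ : ‖z‖ < 1) :
    HasMeijerG m n a b z (meijerG m n a b z) := by
  have h1 := h.hasMeijerG hz hz₁
  rwa [h1.meijerG_eq]

/-- Without poles to exclude, every hairpin to the left of all poles is a loop. -/
theorem exists_isMeijerLoop_zero {m p q : ℕ} (a : Fin p → ℂ) (b : Fin q → ℝ) :
    ∃ γ, IsMeijerLoop m 0 a (fun j => (b j : ℂ)) γ := by
  obtain ⟨A, hA⟩ := (Set.finite_range b).bddBelow
  have h := isCurveFromInfinity_hairpin (c := A - 1) one_pos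
  refine ⟨_, h.lipschitz, h.differentiable, h.start, h.finish, fun j _ k => ?_, fun i hi => ?_⟩
  · refine hasWindingNumber_hairpin_of_lt_re one_pos (by simp) ?_
    simp only [Complex.add_re, Complex.ofReal_re, Complex.natCast_re]
    linarith [hA (Set.mem_range_self j), k.cast_nonneg (α := ℝ)]
  · exact absurd hi (Nat.not_lt_zero _)

theorem IsMeijerLoop.zero {m n p q : ℕ} {a : Fin p → ℂ} {b : Fin q → ℂ} {γ : ℝ → ℂ}
    (h : IsMeijerLoop m n a b γ) : IsMeijerLoop m 0 a b γ :=
  ⟨h.lipschitz, h.differentiable, h.start, h.finish, h.encircles,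
    fun _ hi => absurd hi (Nat.not_lt_zero _)⟩

/-- The poles to encircle, `aᵢ + k`, and to exclude, `-k`, move along with the loop. -/
theorem IsMeijerLoop.sub_half {p : ℕ} {a : Fin (p + 1) → ℂ} {b : Fin p → ℂ} {γ : ℝ → ℂ}
    (h : IsMeijerLoop (p + 1) 1 (Matrix.vecCons 1 b) a γ) :
    IsMeijerLoop (p + 1) 1 (Matrix.vecCons (1 / 2) (Matrix.vecCons 1 fun j => b j - 1 / 2))
      (Fin.snoc (α := fun _ => ℂ) (fun i => a i - 1 / 2) 1) (fun t => γ t - 1 / 2) := by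
  refine ⟨?_, ?_, ?_, ?_, fun j hj k => ?_, fun i hi k => ?_⟩
  · obtain ⟨K, hK⟩ := h.lipschitz
    exact ⟨K, LipschitzWith.of_dist_le_mul fun s t => by
      rw [dist_sub_right]
      exact hK.dist_le_mul s t⟩
  · refine h.differentiable.subset fun t ht ht' => ht (ht'.sub_const _)
  · obtain ⟨c, T, hc⟩ := h.start
    exact ⟨c - 1 / 2, T, fun t ht => by rw [hc t ht]; ring⟩
  · obtain ⟨c, T, hc⟩ := h.finish
    exact ⟨c - 1 / 2, T, fun t ht => by rw [hc t ht]; ring⟩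
  · obtain ⟨i, rfl⟩ : ∃ i : Fin (p + 1), j = i.castSucc := ⟨⟨j, hj⟩, rfl⟩
    rw [Fin.snoc_castSucc, show a i - 1 / 2 + k = a i + k - 1 / 2 by ring]
    exact (h.encircles i i.2 k).sub_const _
  · have hi0 : i = 0 := Fin.ext (by simpa using hi)
    have h1 := (h.excludes 0 Nat.one_pos k).sub_const (1 / 2)
    rw [hi0, Matrix.cons_val_zero]
    rw [Matrix.cons_val_zero] at h1
    rwa [show (1 / 2 : ℂ) - 1 - k = 1 - 1 - k - 1 / 2 by ring]

theorem one_div_cpow {x : ℝ} (hx : 0 < x) (s : ℂ) :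
    (1 / x : ℂ) ^ s = Complex.exp (-s * Real.log x) := by
  have hx0 : (1 / x : ℂ) ≠ 0 := one_div_ne_zero (by exact_mod_cast hx.ne')
  rw [Complex.cpow_def_of_ne_zero hx0, show (1 / x : ℂ) = ((1 / x : ℝ) : ℂ) by push_cast; rfl,
    ← Complex.ofReal_log (by positivity), one_div, Real.log_inv]
  push_cast
  ring_nf

theorem one_div_cpow_neg_half {x : ℝ} (hx : 0 < x) :
    (1 / x : ℂ) ^ (-(1 / 2) : ℂ) = Real.sqrt x := by
  rw [one_div_cpow hx, ← Real.exp_log (Real.sqrt_pos.mpr hx), Real.log_sqrt hx.le]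
  push_cast
  ring_nf

theorem mainTheorem1 (p : ℕ) (a : Fin (p + 1) → ℝ) (b : Fin p → ℝ)
    (hb : ∀ (j : Fin p) (k : ℕ), b j ≠ -(k : ℝ)) (x : ℝ) (hx : 1 < x) :
    ∃ Fplus Fminus : ℂ,
      -- the boundary values `F(x + i0)` and `F(x - i0)`
      Tendsto (hypergeometric (fun i => (a i : ℂ)) (fun j => (b j : ℂ)))
        (𝓝[{z : ℂ | 0 < z.im}] (x : ℂ)) (𝓝 Fplus) ∧
      Tendsto (hypergeometric (fun i => (a i : ℂ)) (fun j => (b j : ℂ)))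
        (𝓝[{z : ℂ | z.im < 0}] (x : ℂ)) (𝓝 Fminus) ∧
      -- the jump
      (HasMeijerG (p + 1) 0 (Matrix.vecCons 1 (fun j => (b j : ℂ))) (fun i => (a i : ℂ)) (1 / x)
          (meijerG (p + 1) 0 (Matrix.vecCons 1 (fun j => (b j : ℂ))) (fun i => (a i : ℂ)) (1 / x)) ∧
        Fplus - Fminus =
          2 * Real.pi * Complex.I *
            ((∏ j, Complex.Gamma (b j)) / ∏ i, Complex.Gamma (a i)) *
            meijerG (p + 1) 0 (Matrix.vecCons 1 (fun j => (b j : ℂ))) (fun i => (a i : ℂ))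
              (1 / x)) ∧
      -- the average
      ((∀ (i : Fin (p + 1)) (k : ℕ), a i ≠ -(k : ℝ)) →
        HasMeijerG (p + 1) 1
          (Matrix.vecCons (1 / 2) (Matrix.vecCons 1 (fun j => (b j : ℂ) - 1 / 2)))
          (Fin.snoc (α := fun _ => ℂ) (fun i => (a i : ℂ) - 1 / 2) 1) (1 / x)
          (meijerG (p + 1) 1
            (Matrix.vecCons (1 / 2) (Matrix.vecCons 1 (fun j => (b j : ℂ) - 1 / 2)))
            (Fin.snoc (α := fun _ => ℂ) (fun i => (a i : ℂ) - 1 / 2) 1) (1 / x)) ∧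
        (Fplus + Fminus) / 2 =
          -(Real.pi * (∏ j, Complex.Gamma (b j)) /
              ((Real.sqrt x : ℂ) * ∏ i, Complex.Gamma (a i))) *
            meijerG (p + 1) 1
              (Matrix.vecCons (1 / 2) (Matrix.vecCons 1 (fun j => (b j : ℂ) - 1 / 2)))
              (Fin.snoc (α := fun _ => ℂ) (fun i => (a i : ℂ) - 1 / 2) 1) (1 / x)) := by
  have hx₀ : 0 < x := one_pos.trans hx
  have hz : (1 / x : ℂ) ≠ 0 := one_div_ne_zero (by exact_mod_cast hx₀.ne')
  have hz₁ : ‖(1 / x : ℂ)‖ < 1 := by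
    rw [norm_div, norm_one, Complex.norm_real, Real.norm_of_nonneg hx₀.le]
    exact (div_lt_one hx₀).mpr hx
  have hpi : (Real.pi : ℂ) ≠ 0 := by exact_mod_cast Real.pi_ne_zero
  by_cases ha : ∀ i, ∀ k : ℕ, a i ≠ -(k : ℝ)
  · obtain ⟨γ, hγ, hint, hlim⟩ := exists_loop_tendsto_hypergeometric ha hb
    obtain ⟨hplus, hminus⟩ := hlim x hx
    have hlog := Real.log_pos hx
    have hi₁ := hint (Real.log x - Real.pi * Complex.I) (by simpa using hlog)
    have hi₂ := hint (Real.log x + Real.pi * Complex.I) (by simpa using hlog)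
    refine ⟨_, _, hplus, hminus, ⟨hγ.zero.hasMeijerG_meijerG hz hz₁, ?_⟩,
      fun _ => ⟨hγ.sub_half.hasMeijerG_meijerG hz hz₁, ?_⟩⟩
    · rw [(hγ.zero.hasMeijerG hz hz₁).meijerG_eq, ← mul_sub, ← MeasureTheory.integral_sub hi₁ hi₂]
      have h1 : ∀ t, barnesKernel (fun i => (a i : ℂ)) (fun j => (b j : ℂ)) (γ t) * deriv γ t *
            Complex.exp (-γ t * (Real.log x - Real.pi * Complex.I)) -
          barnesKernel (fun i => (a i : ℂ)) (fun j => (b j : ℂ)) (γ t) * deriv γ t *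
            Complex.exp (-γ t * (Real.log x + Real.pi * Complex.I)) =
          2 * Real.pi * Complex.I * (meijerIntegrand (p + 1) 0 (Matrix.vecCons 1 (fun j => (b j : ℂ)))
            (fun i => (a i : ℂ)) (1 / x) (γ t) * deriv γ t) := by
        intro t
        have h2 := meijerIntegrand_zero_eq (fun i => (a i : ℂ)) (fun j => (b j : ℂ)) (1 / x)
          (s := γ t) fun k hk => hγ.notMem_meijerPoles t
            (Or.inr ⟨0, Nat.one_pos, k, by simpa using hk⟩)
        rw [one_div_cpow hx₀, Complex.sin] at h2
        have e₁ : Complex.exp (-γ t * (Real.log x - Real.pi * Complex.I)) =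
            Complex.exp (-γ t * Real.log x) * Complex.exp (Real.pi * γ t * Complex.I) := by
          rw [← Complex.exp_add]
          ring_nf
        have e₂ : Complex.exp (-γ t * (Real.log x + Real.pi * Complex.I)) =
            Complex.exp (-γ t * Real.log x) * Complex.exp (-(Real.pi * γ t) * Complex.I) := by
          rw [← Complex.exp_add]
          ring_nf
        rw [e₁, e₂]
        linear_combination (-2 * Complex.I * deriv γ t) * h2 +
          barnesKernel (fun i => (a i : ℂ)) (fun j => (b j : ℂ)) (γ t) * deriv γ t *
            Complex.exp (-γ t * Real.log x) * (Complex.exp (Real.pi * γ t * Complex.I) -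
              Complex.exp (-(Real.pi * γ t) * Complex.I)) * Complex.I_sq
      rw [MeasureTheory.integral_congr_ae (Eventually.of_forall h1),
        MeasureTheory.integral_const_mul]
      field_simp
    · rw [(hγ.sub_half.hasMeijerG hz hz₁).meijerG_eq, ← mul_add,
        ← MeasureTheory.integral_add hi₁ hi₂]
      have hsqrt : (Real.sqrt x : ℂ) ≠ 0 := by exact_mod_cast (Real.sqrt_pos.mpr hx₀).ne'
      have h1 : ∀ t, barnesKernel (fun i => (a i : ℂ)) (fun j => (b j : ℂ)) (γ t) * deriv γ t *
            Complex.exp (-γ t * (Real.log x - Real.pi * Complex.I)) +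
          barnesKernel (fun i => (a i : ℂ)) (fun j => (b j : ℂ)) (γ t) * deriv γ t *
            Complex.exp (-γ t * (Real.log x + Real.pi * Complex.I)) =
          -(2 * Real.pi) / Real.sqrt x * (meijerIntegrand (p + 1) 1
            (Matrix.vecCons (1 / 2) (Matrix.vecCons 1 (fun j => (b j : ℂ) - 1 / 2)))
            (Fin.snoc (α := fun _ => ℂ) (fun i => (a i : ℂ) - 1 / 2) 1) (1 / x) (γ t - 1 / 2) *
              deriv (fun t => γ t - 1 / 2) t) := by
        intro t
        have h2 := meijerIntegrand_half_eq (fun i => (a i : ℂ)) (fun j => (b j : ℂ)) hz (γ t)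
        rw [one_div_cpow_neg_half hx₀, one_div_cpow hx₀, Complex.cos] at h2
        have e₁ : Complex.exp (-γ t * (Real.log x - Real.pi * Complex.I)) =
            Complex.exp (-γ t * Real.log x) * Complex.exp (Real.pi * γ t * Complex.I) := by
          rw [← Complex.exp_add]
          ring_nf
        have e₂ : Complex.exp (-γ t * (Real.log x + Real.pi * Complex.I)) =
            Complex.exp (-γ t * Real.log x) * Complex.exp (-(Real.pi * γ t) * Complex.I) := by
          rw [← Complex.exp_add]
          ring_nf
        rw [e₁, e₂, deriv_sub_const, div_mul_eq_mul_div, eq_div_iff hsqrt]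
        linear_combination (-2 * deriv γ t) * h2
      rw [MeasureTheory.integral_congr_ae (Eventually.of_forall h1),
        MeasureTheory.integral_const_mul]
      field_simp
  · push Not at ha
    obtain ⟨i, k, hik⟩ := ha
    -- the series is a polynomial, and `1 / ∏ Γ(aᵢ) = 0`
    have hf := isHypergeometricContinuation_of_eq_neg_nat (a := fun i => (a i : ℂ))
      (fun j => (b j : ℂ)) (i := i) (k := k) (by rw [hik]; push_cast; rfl)
    set f : ℂ → ℂ := fun z => ∑ n ∈ Finset.range (k + 1),
      hypergeometricCoeff (fun i => (a i : ℂ)) (fun j => (b j : ℂ)) n * z ^ n with hfdef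
    have hside : ∀ S : Set ℂ, (∀ z ∈ S, z.im ≠ 0) →
        Tendsto (hypergeometric (fun i => (a i : ℂ)) (fun j => (b j : ℂ))) (𝓝[S] (x : ℂ))
          (𝓝 (f x)) := by
      intro S hS
      have hc : Continuous f := by fun_prop
      refine (hc.continuousAt.tendsto.mono_left (nhdsWithin_le_nhds (s := S))).congr' ?_
      filter_upwards [self_mem_nhdsWithin] with z hzS
      exact (hf.hypergeometric_eqOn (mem_cutPlane_of_im_ne_zero (hS z hzS))).symm
    have hΓ : (∏ i, Complex.Gamma (a i)) = 0 := by
      refine Finset.prod_eq_zero (Finset.mem_univ i) ?_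
      rw [hik]
      exact_mod_cast Complex.Gamma_neg_nat_eq_zero k
    obtain ⟨γ, hγ⟩ := exists_isMeijerLoop_zero (m := p + 1)
      (Matrix.vecCons 1 (fun j => (b j : ℂ))) a
    refine ⟨f x, f x, hside _ fun z hz => ne_of_gt hz, hside _ fun z hz => ne_of_lt hz,
      ⟨hγ.hasMeijerG_meijerG hz hz₁, ?_⟩, fun h => absurd hik (h i k)⟩
    rw [hΓ, sub_self, div_zero, mul_zero, zero_mul]
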